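/- Let $\mathcal H=\mathbb C^n$ be finite-dimensional. A superoperator is a linear map on the complex $n\times n$ matrices; $\|\cdot\|_\diamond$ is the diamond norm, $\|\Phi\|_\diamond=\sup\{\|(\Phi\otimes\mathrm{id})(X)\|_1:\|X\|_1\le 1\}$ with an ancilla of dimension $n$. A Lindbladian is a superoperator of the form $\rho\mapsto -i[H,\rho]+\sum_{\nu}\big(L_\nu\rho L_\nu^\dagger-\tfrac12\{L_\nu^\dagger L_\nu,\rho\}\big)$ with $H$ Hermitian and finitely many matrices $L_\nu$. Write $[A_1,\dots,A_q]:=[A_1,[A_2,\dots,[A_{q-1},A_q]\dots]]$ for right-nested commutators, with $[A_1]=A_1$. For superoperators $\mathcal L_1,\dots,\mathcal L_M$ the $q$-th formal BCH term of $e^{\mathcal L_M}\cdots e^{\mathcal L_1}$ is $$\Phi_q(\mathcal L_1,\dots,\mathcal L_M)=\sum_{\substack{p_v\ge 0\\ p_1+\cdots+p_M=q}}\frac1{p_1!\cdots p_M!}\sum_{\sigma\in S_q}c_{\sigma,q}\,[A_{\sigma(1)},\dots,A_{\sigma(q)}],\qquad c_{\sigma,q}=\frac{1}{q^2}\frac{(-1)^{d_\sigma}}{\binom{q-1}{d_\sigma}},$$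 where $(A_1,\dots,A_q)=(\underbrace{\mathcal L_M,\dots,\mathcal L_M}_{p_M},\dots,\underbrace{\mathcal L_1,\dots,\mathcal L_1}_{p_1})$ and $d_\sigma$ is the number of $i\in\{1,\dots,q-1\}$ with $\sigma(i)>\sigma(i+1)$. Put $$\alpha_{\mathrm{comm}}^{(q_1,\dots,q_d)}(\mathcal L_1,\dots,\mathcal L_M)=\sum_{v_{1,1},\dots,v_{d,q_d}=1}^M\Big\|\big[[\mathcal L_{v_{1,1}},\dots,\mathcal L_{v_{1,q_1}}],\dots,[\mathcal L_{v_{d,1}},\dots,\mathcal L_{v_{d,q_d}}]\big]\Big\|_\diamond .$$ **(a)** Let $\mathcal L_1,\dots,\mathcal L_M$ be Lindbladians, let $q_0\ge1$ be an integer, and let $$\alpha_{\mathrm{comm},q_0}=\sum_{d=1}^\infty\frac1{d!}\sum_{\substack{1\le q_1,\dots,q_d\le q_0\\ q_1+\cdots+q_d\ge q_0+1}}\alpha_{\mathrm{comm}}^{(q_1,\dots,q_d)}(\mathcal L_1,\dots,\mathcal L_M)\in[0,\infty].$$ If $\alpha_{\mathrm{comm},q_0}\le1$, then, without any assumption on the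 convergence of the BCH series, $$\Big\|\exp\Big(\sum_{q=1}^{q_0}\Phi_q(\mathcal L_1,\dots,\mathcal L_M)\Big)-e^{\mathcal L_M}\cdots e^{\mathcal L_2}e^{\mathcal L_1}\Big\|_\diamond\le e\,\alpha_{\mathrm{comm},q_0}.$$ **(b)** Let $\mathcal L_1,\dots,\mathcal L_m$ be Lindbladians, let $q_0\ge1$ be an integer and $t\ge0$ real, and let $\mathcal S(t)=e^{t\mathcal L_1/2}\cdots e^{t\mathcal L_m/2}\,e^{t\mathcal L_m/2}\cdots e^{t\mathcal L_1/2}$ be the second-order product formula, whose formal BCH series is $\sum_q\Phi_qt^q$ with $\Phi_q=\Phi_q\big(\tfrac12\mathcal L_1,\dots,\tfrac12\mathcal L_m,\tfrac12\mathcal L_m,\dots,\tfrac12\mathcal L_1\big)$. Let $$\alpha_{\mathrm{comm},q_0}(t)=\sum_{d=1}^\infty\frac1{d!}\sum_{\substack{1\le q_1,\dots,q_d\le q_0\\ q_1+\cdots+q_d\ge q_0+1}}\alpha_{\mathrm{comm}}^{(q_1,\dots,q_d)}(\mathcal L_1,\dots,\mathcal L_m)\,t^{q_1+\cdots+q_d}.$$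 If $\alpha_{\mathrm{comm},q_0}(t)\le1$, then $$\Big\|\exp\Big(\sum_{q=1}^{q_0}\Phi_qt^q\Big)-\mathcal S(t)\Big\|_\diamond\le e\,\alpha_{\mathrm{comm},q_0}(t).$$ -/

import Mathlib

open scoped Matrix Nat ENNReal

noncomputable section

namespace BCHTruncation

/-- Superoperators of a quantum system with state space `ℂⁿ` (`n` a finite index set):
linear maps on the complex `n × n` matrices, with composition as product. The Lie bracket
`⁅A, B⁆ = A * B - B * A` is that of the ring of endomorphisms. -/
abbrev Superop (n : Type*) := Module.End ℂ (Matrix n n ℂ)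

section Lindblad

variable {n : Type*} [Fintype n] [DecidableEq n]

/-- The superoperator
`ρ ↦ -i [H, ρ] + ∑_ν (L_ν ρ L_ν† - ½ (L_ν† L_ν ρ + ρ L_ν† L_ν))`. -/
def lindbladGenerator (H : Matrix n n ℂ) {k : ℕ} (J : Fin k → Matrix n n ℂ) : Superop n where
  toFun ρ := (-Complex.I) • (H * ρ - ρ * H)
    + ∑ ν, (J ν * ρ * (J ν)ᴴ
      - (1 / 2 : ℂ) • ((J ν)ᴴ * J ν * ρ + ρ * ((J ν)ᴴ * J ν)))
  map_add' x y := by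
    simp only [mul_add, add_mul, smul_add, smul_sub, Finset.sum_add_distrib,
      Finset.sum_sub_distrib]
    abel
  map_smul' c x := by
    simp only [mul_smul_comm, smul_mul_assoc, ← smul_sub, ← smul_add, smul_comm _ c,
      ← Finset.smul_sum, RingHom.id_apply]

/-- A superoperator is a Lindbladian if it has the Lindblad form for some Hermitian `H` and
finitely many jump operators. -/
def IsLindbladian (Φ : Superop n) : Prop :=
  ∃ (H : Matrix n n ℂ) (k : ℕ) (J : Fin k → Matrix n n ℂ),
    H.IsHermitian ∧ Φ = lindbladGenerator H J

end Lindblad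

section DiamondNorm

variable {n m : Type*} [Fintype n] [DecidableEq n] [Fintype m] [DecidableEq m]

/-- The trace norm `tr √(X† X)`: the sum of the square roots of the eigenvalues of `X† X`. -/
def traceNorm (X : Matrix m m ℂ) : ℝ :=
  ∑ i, √((Matrix.isHermitian_conjTranspose_mul_self X).eigenvalues i)

/-- The amplification `Φ ⊗ id` with an ancilla system `m`. On matrices indexed by `n × m`, it
applies `Φ` to each `n × n` block with fixed ancilla indices. -/
def amplify (m : Type*) (Φ : Superop n) : Superop (n × m) where
  toFun X := Matrix.of fun p q => Φ (Matrix.of fun i j => X (i, p.2) (j, q.2)) p.1 q.1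
  map_add' X Y := by
    ext p q
    simp only [Matrix.of_apply, Matrix.add_apply]
    rw [← Matrix.add_apply, ← map_add]
    rfl
  map_smul' c X := by
    ext p q
    simp only [Matrix.of_apply, Matrix.smul_apply, RingHom.id_apply]
    rw [← Matrix.smul_apply, ← map_smul]
    rfl

/-- The diamond norm `‖Φ‖_⋄`: the norm of `Φ ⊗ id` induced by the trace norm, where the ancilla
is a copy of the system itself. -/
def diamondNorm (Φ : Superop n) : ℝ :=
  sSup {r : ℝ | ∃ X : Matrix (n × n) (n × n) ℂ,
    traceNorm X ≤ 1 ∧ r = traceNorm (amplify n Φ X)}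

theorem sum_eigenvalues_eq (X : Matrix m m ℂ) :
    ∑ k, (Matrix.isHermitian_conjTranspose_mul_self X).eigenvalues k
      = ∑ a, ∑ b, ‖X b a‖ ^ 2 := by
  have h := (Matrix.isHermitian_conjTranspose_mul_self X).trace_eq_sum_eigenvalues
  have h' : (Xᴴ * X).trace = ((∑ a, ∑ b, ‖X b a‖ ^ 2 : ℝ) : ℂ) := by
    simp [Matrix.trace, Matrix.mul_apply, ← Complex.conj_mul']
  rw [h'] at h
  apply Complex.ofReal_injective
  rw [h]
  simp

open scoped ComplexOrder in
theorem norm_entry_le_traceNorm (X : Matrix m m ℂ) (i j : m) : ‖X i j‖ ≤ traceNorm X := by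
  set hX := Matrix.isHermitian_conjTranspose_mul_self X
  have hpos : ∀ k, 0 ≤ hX.eigenvalues k :=
    (Matrix.posSemidef_conjTranspose_mul_self X).eigenvalues_nonneg
  have h2 : ‖X i j‖ ^ 2 ≤ ∑ k, hX.eigenvalues k := by
    rw [sum_eigenvalues_eq]
    calc ‖X i j‖ ^ 2 ≤ ∑ b, ‖X b j‖ ^ 2 :=
          Finset.single_le_sum (f := fun b => ‖X b j‖ ^ 2) (fun b _ => by positivity)
            (Finset.mem_univ i)
      _ ≤ _ := Finset.single_le_sum (f := fun a => ∑ b, ‖X b a‖ ^ 2)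
            (fun a _ => by positivity) (Finset.mem_univ j)
  have h3 : (∑ k, hX.eigenvalues k) ≤ traceNorm X ^ 2 := by
    calc (∑ k, hX.eigenvalues k) = ∑ k, √(hX.eigenvalues k) ^ 2 :=
          Finset.sum_congr rfl fun k _ => (Real.sq_sqrt (hpos k)).symm
      _ ≤ _ := Finset.sum_sq_le_sq_sum_of_nonneg fun k _ => Real.sqrt_nonneg _
  exact le_of_sq_le_sq (h2.trans h3) (Finset.sum_nonneg fun k _ => Real.sqrt_nonneg _)

open scoped ComplexOrder in
/-- The supremum in the definition of the diamond norm is finite. -/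
theorem bddAbove_diamondNorm (Φ : Superop n) :
    BddAbove {r : ℝ | ∃ X : Matrix (n × n) (n × n) ℂ,
      traceNorm X ≤ 1 ∧ r = traceNorm (amplify n Φ X)} := by
  let C : n × n → n × n → ℝ := fun a b =>
    ∑ p, ∑ q, ‖amplify n Φ (Matrix.single p q 1) a b‖
  refine ⟨∑ _k : n × n, √(∑ a, ∑ b, C b a ^ 2), ?_⟩
  rintro r ⟨X, hX, rfl⟩
  have hC : ∀ a b, ‖amplify n Φ X a b‖ ≤ C a b := by
    intro a b
    have h : amplify n Φ X a b
        = ∑ p, ∑ q, X p q * amplify n Φ (Matrix.single p q 1) a b := by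
      conv_lhs => rw [Matrix.matrix_eq_sum_single X]
      simp only [map_sum, Matrix.sum_apply]
      refine Finset.sum_congr rfl fun p _ => Finset.sum_congr rfl fun q _ => ?_
      have h1 : Matrix.single p q (X p q) = X p q • Matrix.single p q (1 : ℂ) := by simp
      rw [h1, map_smul, Matrix.smul_apply, smul_eq_mul]
    rw [h]
    refine (norm_sum_le _ _).trans (Finset.sum_le_sum fun p _ => ?_)
    refine (norm_sum_le _ _).trans (Finset.sum_le_sum fun q _ => ?_)
    rw [norm_mul]
    exact mul_le_of_le_one_left (norm_nonneg _) ((norm_entry_le_traceNorm X p q).trans hX)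
  refine Finset.sum_le_sum fun k _ => Real.sqrt_le_sqrt ?_
  refine (Finset.single_le_sum
    (f := (Matrix.isHermitian_conjTranspose_mul_self (amplify n Φ X)).eigenvalues)
    (fun k _ => (Matrix.posSemidef_conjTranspose_mul_self _).eigenvalues_nonneg k)
    (Finset.mem_univ k)).trans ?_
  rw [sum_eigenvalues_eq]
  gcongr with a _ b _
  exact hC b a

end DiamondNorm

section Exponential

variable {n : Type*} [Fintype n] [DecidableEq n]

/-- The exponential `e^Φ = ∑ Φᵏ / k!` of a superoperator, computed as the matrix exponential in
the standard basis of matrix units. -/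
def superExp (Φ : Superop n) : Superop n :=
  (LinearMap.toMatrixAlgEquiv (Matrix.stdBasis ℂ n n)).symm
    (NormedSpace.exp (LinearMap.toMatrixAlgEquiv (Matrix.stdBasis ℂ n n) Φ))

theorem hasSum_superExp (Φ : Superop n) (X : Matrix n n ℂ) :
    HasSum (fun k : ℕ => ((k ! : ℂ)⁻¹) • (Φ ^ k) X) (superExp Φ X) := by
  set e := LinearMap.toMatrixAlgEquiv (Matrix.stdBasis ℂ n n) with he
  have h : HasSum (fun k : ℕ => ((k ! : ℂ)⁻¹) • (e Φ) ^ k) (NormedSpace.exp (e Φ)) := by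
    let _ : NormedRing (Matrix (n × n) (n × n) ℂ) := Matrix.linftyOpNormedRing
    let _ : NormedAlgebra ℂ (Matrix (n × n) (n × n) ℂ) := Matrix.linftyOpNormedAlgebra
    exact NormedSpace.exp_series_hasSum_exp' (𝕂 := ℂ) (e Φ)
  let f : Matrix (n × n) (n × n) ℂ →ₗ[ℂ] Matrix n n ℂ :=
    (LinearMap.applyₗ X).comp e.symm.toLinearMap
  have hf : Continuous f := f.continuous_of_finiteDimensional
  have h2 := h.map f.toAddMonoidHom hf
  have h3 : (⇑f.toAddMonoidHom ∘ fun k : ℕ => ((k ! : ℂ)⁻¹) • (e Φ) ^ k)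
      = fun k : ℕ => ((k ! : ℂ)⁻¹) • (Φ ^ k) X := by
    funext k
    simp [f, ← map_pow]
  rw [h3] at h2
  exact h2

end Exponential

section Commutators

/-- The right-nested commutator `[A₁, [A₂, …, [A_{q-1}, A_q] …]]` of a list; it is `A₁` for a
list of length one (and `0` for the empty list, which does not occur). -/
def nestedComm {A : Type*} [Ring A] : List A → A
  | [] => 0
  | [a] => a
  | a :: b :: l => ⁅a, nestedComm (b :: l)⁆

/-- The number `d_σ` of descents of a permutation: the `i` with `σ(i) > σ(i+1)`. -/
def descents {q : ℕ} (σ : Equiv.Perm (Fin q)) : ℕ :=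
  (Finset.univ.filter fun i : Fin q =>
    ∃ h : (i : ℕ) + 1 < q, σ ⟨(i : ℕ) + 1, h⟩ < σ i).card

/-- The coefficient `c_{σ,q} = q⁻² (-1)^{d_σ} / binom(q-1, d_σ)`. -/
def bchCoeff {q : ℕ} (σ : Equiv.Perm (Fin q)) : ℝ :=
  1 / (q : ℝ) ^ 2 * ((-1) ^ descents σ / ((q - 1).choose (descents σ) : ℝ))

variable {n : Type*} [Fintype n] [DecidableEq n]

/-- The sequence `L_M, …, L_M, …, L_1, …, L_1` in which `L_v` occurs `p v` times. -/
def blockList {M : ℕ} (L : Fin M → Superop n) (p : Fin M → ℕ) : List (Superop n) :=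
  (List.finRange M).reverse.flatMap fun v => List.replicate (p v) (L v)

/-- The `q`-th term of the formal Baker–Campbell–Hausdorff series of `e^{L_M} ⋯ e^{L_1}`,
`∑_{p_1+⋯+p_M=q} 1/(p_1!⋯p_M!) ∑_{σ ∈ S_q} c_{σ,q} [A_{σ(1)}, …, A_{σ(q)}]`
with `(A_1, …, A_q)` the sequence `blockList L p` (which has length `q`). -/
def bchTerm {M : ℕ} (L : Fin M → Superop n) (q : ℕ) : Superop n :=
  ∑ p ∈ Finset.piAntidiag (Finset.univ : Finset (Fin M)) q,
    ((1 / ∏ v, ((p v)! : ℝ) : ℝ) : ℂ) •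
      ∑ σ : Equiv.Perm (Fin q), ((bchCoeff σ : ℝ) : ℂ) •
        nestedComm (List.ofFn fun i => (blockList L p).getD (σ i) 0)

/-- The product `e^{L_M} ⋯ e^{L_2} e^{L_1}` (so `e^{L_1}` acts first). -/
def expProduct {M : ℕ} (L : Fin M → Superop n) : Superop n :=
  (List.ofFn fun v => superExp (L v)).reverse.prod

/-- `α_comm^{(q_1, …, q_d)}`: the sum of the diamond norms of all doubly right-nested commutators
`[[L_{v_{1,1}}, …, L_{v_{1,q_1}}], …, [L_{v_{d,1}}, …, L_{v_{d,q_d}}]]`. -/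
def alphaComm {M : ℕ} (L : Fin M → Superop n) {d : ℕ} (q : Fin d → ℕ) : ℝ :=
  ∑ v : (i : Fin d) → Fin (q i) → Fin M,
    diamondNorm (nestedComm (List.ofFn fun i =>
      nestedComm (List.ofFn fun j => L (v i j))))

/-- The tuples `(q_1, …, q_d)` with `1 ≤ q_i ≤ q₀` and `q_1 + ⋯ + q_d ≥ q₀ + 1`. -/
def gradeTuples (q₀ d : ℕ) : Finset (Fin d → ℕ) :=
  (Fintype.piFinset fun _ : Fin d => Finset.Icc 1 q₀).filter fun q => q₀ + 1 ≤ ∑ i, q i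

/-- `α_{comm,q₀} = ∑_{d ≥ 1} 1/d! ∑_{(q_1, …, q_d)} α_comm^{(q_1, …, q_d)}`, a series of
nonnegative terms summed in `[0, ∞]`. The index `k` of the sum stands for `d = k + 1`. -/
def alphaTrunc {M : ℕ} (L : Fin M → Superop n) (q₀ : ℕ) : ℝ≥0∞ :=
  ∑' k : ℕ, ENNReal.ofReal
    (1 / ((k + 1)! : ℝ) * ∑ q ∈ gradeTuples q₀ (k + 1), alphaComm L q)

/-- `α_{comm,q₀}(t) = ∑_{d ≥ 1} 1/d! ∑_{(q_1, …, q_d)} α_comm^{(q_1, …, q_d)} t^{q_1+⋯+q_d}`,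
for `t ≥ 0`, with the sum taken in `[0, ∞]`. -/
def alphaTruncStep {m : ℕ} (L : Fin m → Superop n) (q₀ : ℕ) (t : ℝ) : ℝ≥0∞ :=
  ∑' k : ℕ, ENNReal.ofReal
    (1 / ((k + 1)! : ℝ) * ∑ q ∈ gradeTuples q₀ (k + 1), alphaComm L q * t ^ (∑ i, q i))

/-- The second-order product formula
`S(t) = e^{t L_1/2} ⋯ e^{t L_m/2} e^{t L_m/2} ⋯ e^{t L_1/2}`. -/
def secondOrderFormula {m : ℕ} (L : Fin m → Superop n) (t : ℝ) : Superop n :=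
  (List.ofFn fun j => superExp (((t / 2 : ℝ) : ℂ) • L j)).prod *
    (List.ofFn fun j => superExp (((t / 2 : ℝ) : ℂ) • L j)).reverse.prod

/-- The sequence `½ L_1, …, ½ L_m, ½ L_m, …, ½ L_1`. The BCH formula `exp(∑ Φ_q t^q)` of `S(t)`
has `Φ_q = bchTerm (halvedPalindrome L) q`. -/
def halvedPalindrome {m : ℕ} (L : Fin m → Superop n) : Fin (m + m) → Superop n :=
  Fin.append (fun j => (1 / 2 : ℂ) • L j) (fun j => (1 / 2 : ℂ) • L j.rev)

end Commutators

end BCHTruncation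

end

/-!
The error of a truncated Baker–Campbell–Hausdorff (BCH) series is bounded without using the
convergence of the series. Three ingredients carry the proof.

*The BCH formula as an exact identity.* In an algebra with a nilpotent filtration the logarithm of
`e^{T_M} ⋯ e^{T_1} = 1 + Z` is `∫₀¹ Z (1 + t Z)⁻¹ dt`. A permutation with `d` descents occurs in
`Z (1 + t Z)⁻¹` with the coefficient `(-t)^d (1 - t)^(q-1-d)` (`orderingSum_eq_sub`,
`orderingSum_eq_geomCoeff`), whose integral is `q c_{σ,q}` by the beta integral
(`IsNilFiltration.logTrunc_prod_exp`). Applied to the operators `ad X_v` and evaluated at a grading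
element, this associative formula becomes the formula with nested commutators: the commutator of
the logarithm with the grading element multiplies the part of degree `q` by `q`, which cancels that
factor (`IsBoundedFiltration.exists_log`). Realizing `z L_v` with
`z ^ (N + 1) = 0` by lower triangular matrices over the algebra gives
`exp (∑_{q ≤ N} z^q Φ_q) = e^{z L_M} ⋯ e^{z L_1}` (`exp_sum_shiftMat_bchWord`).

*The generator of the truncated series.* The factors are switched on one at a time, replacing the
generator `L_k` by `s L_k` with `s` from `0` to `1`. If `F(s)` is the truncated BCH series at stage
`s`, then `exp (F(s))` solves `V' = (L_k + R(s)) V`, since its logarithmic derivative is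
`∑_d [F, [F, …, [F, F']]] / d!`. Expanded in grades, the commutators of total degree at most `N`
add up to `L_k` by the identity modulo `z ^ (N + 1)`, and `R(s)` consists of those of total degree
above `N` (`hasSum_high_grades`). As each word has a coefficient of modulus at most one in the BCH
series (`abs_wordCoeff_le_one`), `‖R(s)‖` is at most the derivative in `s` of the commutator sum
`α` of the weighted generators (`norm_nestedComm_stage_le`), so its integral over all stages is at
most `α`. If the `e^{s L_v}` are contractions, Grönwall's inequality (`norm_perturbed_flow_le`)
yields the error `e^α - 1`, which is at most `e α` for `α ≤ 1` (`norm_exp_sum_bchWord_sub_le`).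

*Lindblad semigroups are contractions for the diamond norm.* The trace norm is the nuclear norm
(`exists_outerMat_decomposition`, `traceNorm_sum_outerMat_le`), which makes the diamond norm an
algebra norm and bounds maps in Kraus form (`traceNorm_kraus_le`). An Euler step
`1 + h L` of a Lindbladian is in Kraus form up to `O(h²)` and trace preserving up to `O(h²)`, hence
`‖1 + h L‖ ≤ 1 + C h²` (`exists_diamondNorm_one_add_smul_le`) and `‖e^{s L}‖ ≤ 1`.

The second-order product formula is the product of exponentials of the palindrome
`½ t L_1, …, ½ t L_m, ½ t L_m, …, ½ t L_1`. Each `L_j` occurs there twice with the factor `t / 2`,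
so the commutator sums of the palindrome are those of `t L_1, …, t L_m`
(`alphaComm_smul_halvedPalindrome`).
-/

open scoped Matrix Nat ENNReal

noncomputable section

namespace BCHTruncation

/-! ### Alternating sums over the orderings of a finite set -/

section DescentWeight

variable {α : Type*} [LinearOrder α]

/-- The weight `(-t)^d (1 - t)^a` of a list with `d` descents and `a` ascents, and `0` for the
empty list. Each step that is not an ascent counts as a descent. -/
def descentWeight (t : ℝ) : List α → ℝ
  | [] => 0
  | [_] => 1
  | a :: b :: l => (if a < b then 1 - t else -t) * descentWeight t (b :: l)

/-- Expansion along the initial increasing runs of the list. This is the identity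
`(1 - t) [a < b] - t [b ≤ a] = [a < b] - t` at each step, multiplied out from the left. -/
theorem descentWeight_eq_sub (t : ℝ) (l : List α) (hl : l ≠ []) :
    descentWeight t l = (if l.IsChain (· < ·) then 1 else 0) -
      t * ∑ j ∈ Finset.range l.length,
        if (l.take (j + 1)).IsChain (· < ·) then descentWeight t (l.drop (j + 1)) else 0 := by
  induction l with
  | nil => exact absurd rfl hl
  | cons a l ih =>
    cases l with
    | nil => simp [descentWeight]
    | cons b l =>
      specialize ih (by simp)
      rw [List.length_cons, Finset.sum_range_succ']
      by_cases hab : a < b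
      · simp only [descentWeight, List.take_succ_cons, List.isChain_cons_cons, hab, true_and,
          List.drop_succ_cons, if_true, List.take_zero, List.isChain_singleton,
          List.drop_zero] at ih ⊢
        linear_combination ih
      · simp [descentWeight, List.take_succ_cons, List.isChain_cons_cons, hab]

/-- All lists without repetition whose set of entries is `S`. -/
def orderings (S : Finset α) : Finset (List α) := ⟨S.val.lists, Multiset.lists_nodup_finset S⟩

theorem mem_orderings {S : Finset α} {l : List α} :
    l ∈ orderings S ↔ l.Nodup ∧ l.toFinset = S := by
  simp only [orderings, Finset.mem_mk, Multiset.mem_lists_iff, Multiset.quot_mk_to_coe]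
  constructor
  · intro h
    have hn : l.Nodup := by
      have := S.nodup
      rw [h] at this
      exact this
    refine ⟨hn, ?_⟩
    ext x
    rw [List.mem_toFinset, ← Finset.mem_val, h, Multiset.mem_coe]
  · rintro ⟨hn, rfl⟩
    rw [List.toFinset_val, List.dedup_eq_self.2 hn]

theorem eq_sort_of_isChain {S : Finset α} {l : List α} (hl : l.toFinset = S)
    (h : l.IsChain (· < ·)) : l = S.sort := by
  have h1 : l.SortedLT := List.sortedLT_iff_isChain.2 h
  rw [← hl]
  exact ((List.toFinset_sort _ h1.nodup).2 h1.sortedLE.pairwise).symm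

theorem sort_isChain (S : Finset α) : S.sort.IsChain (· < ·) :=
  List.sortedLT_iff_isChain.1 (S.sortedLT_sort)

variable {B : Type*} [Ring B] [Algebra ℝ B]

/-- The product of the `A x` over `x ∈ S`, in increasing order of `x`. -/
def sortedProd (A : α → B) (S : Finset α) : B := (S.sort.map A).prod

/-- The sum of the products of the `A x` over all orderings of `S`, weighted by descents. It
is the part of `Z (1 + t Z)⁻¹` that is linear in each of the `A x` with `x ∈ S`, where `1 + Z` is
the product of the `1 + A x` in increasing order. -/
def orderingSum (t : ℝ) (A : α → B) (S : Finset α) : B :=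
  ∑ l ∈ orderings S, descentWeight t l • (l.map A).prod

theorem orderingSum_empty (t : ℝ) (A : α → B) : orderingSum t A ∅ = 0 := by
  refine Finset.sum_eq_zero fun l hl => ?_
  obtain ⟨-, h⟩ := mem_orderings.1 hl
  rw [List.toFinset_eq_empty_iff] at h
  simp [h, descentWeight]

/-- An ordering of `S` together with an increasing initial segment is a nonempty subset `T`,
listed increasingly, followed by an ordering of `S \ T`. -/
theorem orderingSum_eq_sub (t : ℝ) (A : α → B) (S : Finset α) (hS : S.Nonempty) :
    orderingSum t A S = sortedProd A S -
      t • ∑ T ∈ S.powerset.erase ∅, sortedProd A T * orderingSum t A (S \ T) := by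
  have h1 : ∀ l ∈ orderings S, descentWeight t l • (l.map A).prod =
      (if l.IsChain (· < ·) then (l.map A).prod else 0) -
      t • ∑ j ∈ (Finset.range l.length).filter fun j => (l.take (j + 1)).IsChain (· < ·),
        ((l.take (j + 1)).map A).prod * (descentWeight t (l.drop (j + 1)) •
          ((l.drop (j + 1)).map A).prod) := by
    intro l hl
    have hne : l ≠ [] := by
      rintro rfl
      obtain ⟨-, h⟩ := mem_orderings.1 hl
      simp at h
      simp [← h] at hS
    rw [descentWeight_eq_sub t l hne, sub_smul, mul_smul, Finset.sum_smul, ite_smul, one_smul,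
      zero_smul, Finset.sum_filter]
    congr 2
    refine Finset.sum_congr rfl fun j _ => ?_
    split_ifs
    · rw [mul_smul_comm, ← List.prod_append, ← List.map_append, List.take_append_drop]
    · simp
  rw [orderingSum, Finset.sum_congr rfl h1, Finset.sum_sub_distrib, ← Finset.smul_sum]
  congr 1
  · rw [Finset.sum_eq_single S.sort]
    · rw [if_pos (sort_isChain S)]; rfl
    · intro l hl hne
      rw [if_neg]
      intro hc
      exact hne (eq_sort_of_isChain (mem_orderings.1 hl).2 hc)
    · intro h
      exact absurd (mem_orderings.2 ⟨S.sort_nodup _, S.sort_toFinset _⟩) h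
  · congr 1
    simp only [orderingSum, Finset.mul_sum]
    rw [Finset.sum_sigma', Finset.sum_sigma']
    -- an ordering cut after an increasing segment of length `j + 1` corresponds to the pair of the
    -- set of that segment and the ordering of the rest
    refine Finset.sum_bij' (fun x _ => ⟨(x.1.take (x.2 + 1)).toFinset, x.1.drop (x.2 + 1)⟩)
      (fun y _ => ⟨y.1.sort ++ y.2, y.1.card - 1⟩) ?_ ?_ ?_ ?_ ?_
    · rintro ⟨l, j⟩ h
      simp only [Finset.mem_sigma, Finset.mem_filter, Finset.mem_range, mem_orderings,
        Finset.mem_erase, Finset.mem_powerset] at h ⊢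
      obtain ⟨⟨hn, rfl⟩, hj, hc⟩ := h
      refine ⟨⟨?_, ?_⟩, hn.sublist (List.drop_sublist _ _), ?_⟩
      · rw [Ne, List.toFinset_eq_empty_iff, List.take_eq_nil_iff]
        rintro (h | h)
        · omega
        · simp [h] at hj
      · intro x hx
        rw [List.mem_toFinset] at hx ⊢
        exact List.mem_of_mem_take hx
      · rw [← List.take_append_drop (j + 1) l, List.nodup_append] at hn
        have e : l.toFinset = (l.take (j + 1)).toFinset ∪ (l.drop (j + 1)).toFinset := by
          rw [← List.toFinset_append, List.take_append_drop]
        rw [e]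
        ext x
        simp only [List.mem_toFinset, Finset.mem_sdiff, Finset.mem_union]
        constructor
        · exact fun hx => ⟨Or.inr hx, fun h => hn.2.2 x h x hx rfl⟩
        · exact fun ⟨h, h'⟩ => h.resolve_left h'
    · rintro ⟨T, l⟩ h
      simp only [Finset.mem_sigma, Finset.mem_filter, Finset.mem_range, mem_orderings,
        Finset.mem_erase, Finset.mem_powerset] at h ⊢
      obtain ⟨⟨hT, hTS⟩, hn, hl⟩ := h
      have hpos : 0 < T.card := Finset.card_pos.2 (Finset.nonempty_iff_ne_empty.2 hT)
      refine ⟨⟨?_, ?_⟩, ?_, ?_⟩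
      · refine List.Nodup.append (T.sort_nodup _) hn ?_
        intro x hx hx'
        rw [← List.mem_toFinset, hl] at hx'
        simp at hx hx'
        exact hx'.2 hx
      · rw [List.toFinset_append, Finset.sort_toFinset, hl]
        exact Finset.union_sdiff_of_subset hTS
      · simp; omega
      · rw [Nat.sub_add_cancel hpos, ← Finset.length_sort (s := T) (· ≤ ·), List.take_left']
        · exact sort_isChain T
        · rfl
    · rintro ⟨l, j⟩ h
      simp only [Finset.mem_sigma, Finset.mem_filter, Finset.mem_range, mem_orderings] at h
      obtain ⟨⟨hn, rfl⟩, hj, hc⟩ := h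
      have e : (l.take (j + 1)).toFinset.sort = l.take (j + 1) := (eq_sort_of_isChain rfl hc).symm
      simp only [e, List.take_append_drop]
      rw [List.toFinset_card_of_nodup (hn.sublist (List.take_sublist _ _)), List.length_take,
        min_eq_left (by omega), Nat.add_sub_cancel]
    · rintro ⟨T, l⟩ h
      simp only [Finset.mem_sigma, mem_orderings, Finset.mem_erase, Finset.mem_powerset] at h ⊢
      obtain ⟨⟨hT, hTS⟩, hn, hl⟩ := h
      have hpos : 0 < T.card := Finset.card_pos.2 (Finset.nonempty_iff_ne_empty.2 hT)
      have e : T.card - 1 + 1 = T.sort.length := by simp; omega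
      rw [e, List.take_left' rfl, List.drop_left' rfl, Finset.sort_toFinset]
    · rintro ⟨l, j⟩ h
      simp only [Finset.mem_sigma, Finset.mem_filter, Finset.mem_range, mem_orderings] at h
      obtain ⟨⟨hn, rfl⟩, hj, hc⟩ := h
      have e : (l.take (j + 1)).toFinset.sort = l.take (j + 1) := (eq_sort_of_isChain rfl hc).symm
      simp only [sortedProd, e]

end DescentWeight

/-! ### Counting letters -/

section LetterCount

variable {M : ℕ}

/-- The word `M, …, M, …, 1, …, 1` in which the letter `v` occurs `p v` times. -/
def blockIndices (p : Fin M → ℕ) : List (Fin M) :=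
  (List.finRange M).reverse.flatMap fun v => List.replicate (p v) v

theorem count_blockIndices (p : Fin M → ℕ) (v : Fin M) : (blockIndices p).count v = p v := by
  rw [blockIndices, List.count_flatMap, List.map_reverse, List.sum_reverse, ← List.ofFn_eq_map,
    List.sum_ofFn, Finset.sum_eq_single v]
  · simp
  · intro w _ hw
    simp [List.count_replicate, hw]
  · simp

theorem length_blockIndices (p : Fin M → ℕ) : (blockIndices p).length = ∑ v, p v := by
  rw [blockIndices, List.length_flatMap, List.map_reverse, List.sum_reverse, ← List.ofFn_eq_map,
    List.sum_ofFn]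
  simp

theorem pairwise_blockIndices (p : Fin M → ℕ) : (blockIndices p).Pairwise (· ≥ ·) := by
  rw [blockIndices, List.pairwise_flatMap]
  refine ⟨fun v _ => List.pairwise_replicate.2 (Or.inr le_rfl), ?_⟩
  rw [List.pairwise_reverse]
  refine (List.sortedLT_finRange M).pairwise.imp fun {a b} hab x hx y hy => ?_
  rw [List.eq_of_mem_replicate hx, List.eq_of_mem_replicate hy]
  exact hab.le

variable {α : Type*}

/-- The number of occurrences of the letter `v` among the `b x` with `x ∈ S`. -/
def letterCount (b : α → Fin M) (S : Finset α) (v : Fin M) : ℕ := (S.filter (b · = v)).card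

theorem letterCount_eq_zero {b : α → Fin M} {S : Finset α} : letterCount b S = 0 ↔ S = ∅ := by
  constructor
  · intro h
    by_contra hne
    obtain ⟨x, hx⟩ := Finset.nonempty_iff_ne_empty.2 hne
    have := congrFun h (b x)
    simp only [letterCount, Pi.zero_apply, Finset.card_eq_zero] at this
    have hx' : x ∈ S.filter (b · = b x) := by simp [hx]
    simp [this] at hx'
  · rintro rfl
    ext v
    simp [letterCount]

theorem letterCount_mono (b : α → Fin M) {S T : Finset α} (h : T ⊆ S) :
    letterCount b T ≤ letterCount b S :=
  fun _ => Finset.card_le_card (Finset.filter_subset_filter _ h)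

theorem letterCount_sdiff [DecidableEq α] (b : α → Fin M) {S T : Finset α} (h : T ⊆ S) :
    letterCount b (S \ T) = letterCount b S - letterCount b T := by
  ext v
  simp only [letterCount, Pi.sub_apply]
  rw [← Finset.card_sdiff_of_subset (Finset.filter_subset_filter _ h)]
  congr 1
  ext x
  simp only [Finset.mem_filter, Finset.mem_sdiff]
  tauto

/-- Choosing a subset with `k v` elements of each letter `v` is choosing independently inside the
fibres of `b`. -/
theorem card_powerset_letterCount [DecidableEq α] (b : α → Fin M) (S : Finset α)
    (k : Fin M → ℕ) :
    (S.powerset.filter fun T => letterCount b T = k).card =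
      ∏ v, (letterCount b S v).choose (k v) := by
  have h : (Fintype.piFinset fun v => (S.filter (b · = v)).powersetCard (k v)).card =
      ∏ v, (letterCount b S v).choose (k v) := by
    simp [Fintype.card_piFinset, letterCount]
  rw [← h]
  refine Finset.card_bij' (fun T _ v => T.filter (b · = v)) (fun f _ => Finset.univ.biUnion f)
    ?_ ?_ ?_ ?_
  · intro T hT
    simp only [Finset.mem_filter, Finset.mem_powerset, Fintype.mem_piFinset,
      Finset.mem_powersetCard] at hT ⊢
    exact fun v => ⟨Finset.filter_subset_filter _ hT.1, congrFun hT.2 v⟩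
  · intro f hf
    simp only [Fintype.mem_piFinset, Finset.mem_powersetCard, Finset.mem_filter,
      Finset.mem_powerset] at hf ⊢
    have hfb : ∀ v, ∀ x ∈ f v, x ∈ S ∧ b x = v := fun v x hx => by
      simpa using (hf v).1 hx
    refine ⟨Finset.biUnion_subset.2 fun v _ x hx => (hfb v x hx).1, ?_⟩
    ext v
    rw [letterCount, ← (hf v).2]
    congr 1
    ext x
    simp only [Finset.mem_filter, Finset.mem_biUnion, Finset.mem_univ, true_and]
    constructor
    · rintro ⟨⟨w, hw⟩, rfl⟩
      rwa [(hfb w x hw).2]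
    · exact fun hx => ⟨⟨v, hx⟩, (hfb v x hx).2⟩
  · intro T hT
    ext x
    simp
  · intro f hf
    simp only [Fintype.mem_piFinset, Finset.mem_powersetCard] at hf
    have hfb : ∀ v, ∀ x ∈ f v, x ∈ S ∧ b x = v := fun v x hx => by
      simpa using (hf v).1 hx
    ext v x
    simp only [Finset.mem_filter, Finset.mem_biUnion, Finset.mem_univ, true_and]
    constructor
    · rintro ⟨⟨w, hw⟩, rfl⟩
      rwa [(hfb w x hw).2]
    · exact fun hx => ⟨⟨v, hx⟩, (hfb v x hx).2⟩

theorem sum_powerset_letterCount [DecidableEq α] {B : Type*} [AddCommMonoid B] (b : α → Fin M)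
    (S : Finset α) (F : (Fin M → ℕ) → B) :
    ∑ T ∈ S.powerset, F (letterCount b T) =
      ∑ k ∈ Finset.Iic (letterCount b S), (∏ v, (letterCount b S v).choose (k v)) • F k := by
  rw [← Finset.sum_fiberwise_of_maps_to (t := Finset.Iic (letterCount b S))
    (g := letterCount b)]
  · refine Finset.sum_congr rfl fun k _ => ?_
    rw [← card_powerset_letterCount, ← Finset.sum_const]
    refine Finset.sum_congr rfl fun T hT => ?_
    rw [(Finset.mem_filter.1 hT).2]
  · intro T hT
    exact Finset.mem_Iic.2 (letterCount_mono b (Finset.mem_powerset.1 hT))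

end LetterCount

/-! ### Ordered monomials with divided powers -/

section OrderedMonomial

variable {M : ℕ} {α : Type*} [LinearOrder α] {B : Type*} [Ring B]

/-- The monomial `T_M ^ n_M ⋯ T_1 ^ n_1`. -/
def orderedMonomial (T : Fin M → B) (n : Fin M → ℕ) : B :=
  ((List.finRange M).reverse.map fun v => T v ^ n v).prod

theorem prod_map_blockIndices (T : Fin M → B) (n : Fin M → ℕ) :
    ((blockIndices n).map T).prod = orderedMonomial T n := by
  rw [blockIndices, orderedMonomial, List.map_flatMap]
  induction (List.finRange M).reverse with
  | nil => rfl
  | cons v l ih =>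
    rw [List.flatMap_cons, List.prod_append, ih, List.map_cons, List.prod_cons, List.map_replicate,
      List.prod_replicate]

theorem map_sort_eq_blockIndices {b : α → Fin M} (hb : Antitone b) (S : Finset α) :
    S.sort.map b = blockIndices (letterCount b S) := by
  refine List.Perm.eq_of_pairwise (le := (· ≥ ·)) (fun a c _ _ h h' => le_antisymm h' h) ?_
    (pairwise_blockIndices _) ?_
  · rw [List.pairwise_map]
    exact (S.pairwise_sort _).imp fun h => hb h
  · rw [List.perm_iff_count]
    intro v
    rw [count_blockIndices, List.count_eq_countP, List.countP_map, List.countP_eq_length_filter,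
      letterCount, Finset.card_def, Finset.filter_val, ← Finset.sort_eq S (· ≤ ·),
      Multiset.filter_coe, Multiset.coe_card]
    rfl

theorem sortedProd_comp {b : α → Fin M} (hb : Antitone b) (T : Fin M → B) (S : Finset α) :
    sortedProd (fun x => T (b x)) S = orderedMonomial T (letterCount b S) := by
  rw [← prod_map_blockIndices, ← map_sort_eq_blockIndices hb, List.map_map]
  rfl

/-- The multi-index factorial `n_1! ⋯ n_M!`. -/
def multiFactorial (n : Fin M → ℕ) : ℕ := ∏ v, (n v)!

theorem multiFactorial_pos (n : Fin M → ℕ) : 0 < multiFactorial n :=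
  Finset.prod_pos fun _ _ => Nat.factorial_pos _

variable [Algebra ℝ B]

/-- The monomial `(T_M ^ n_M / n_M!) ⋯ (T_1 ^ n_1 / n_1!)`, the part of multidegree `n` of
`e^{T_M} ⋯ e^{T_1}`. -/
def dividedMonomial (T : Fin M → B) (n : Fin M → ℕ) : B :=
  (1 / (multiFactorial n : ℝ)) • orderedMonomial T n

/-- The part of multidegree `n` of the formal series `Z (1 + t Z)⁻¹`, with
`Z = e^{T_M} ⋯ e^{T_1} - 1`, defined by the recursion that `G = Z - t Z G` imposes. -/
def geomCoeff (t : ℝ) (T : Fin M → B) (n : Fin M → ℕ) : B :=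
  if n = 0 then 0 else dividedMonomial T n - t • ∑ k : {k // k ∈ (Finset.Iic n).erase 0},
    dividedMonomial T k * geomCoeff t T (n - k)
termination_by ∑ v, n v
decreasing_by
  have h1 := k.2
  rw [Finset.mem_erase, Finset.mem_Iic] at h1
  obtain ⟨v, hv⟩ := Function.ne_iff.1 h1.1
  exact Finset.sum_lt_sum (fun w _ => Nat.sub_le _ _) ⟨v, Finset.mem_univ _,
    Nat.sub_lt ((Nat.pos_of_ne_zero hv).trans_le (h1.2 v)) (Nat.pos_of_ne_zero hv)⟩

theorem geomCoeff_zero (t : ℝ) (T : Fin M → B) : geomCoeff t T 0 = 0 := by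
  rw [geomCoeff, if_pos rfl]

theorem geomCoeff_eq_sub (t : ℝ) (T : Fin M → B) {n : Fin M → ℕ} (hn : n ≠ 0) :
    geomCoeff t T n = dividedMonomial T n - t • ∑ k ∈ (Finset.Iic n).erase 0,
      dividedMonomial T k * geomCoeff t T (n - k) := by
  rw [geomCoeff, if_neg hn, Finset.sum_coe_sort ((Finset.Iic n).erase 0)
    (fun k => dividedMonomial T k * geomCoeff t T (n - k))]

theorem multiFactorial_mul_choose {n k : Fin M → ℕ} (h : k ≤ n) :
    (∏ v, (n v).choose (k v)) * (multiFactorial k * multiFactorial (n - k)) =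
      multiFactorial n := by
  simp only [multiFactorial, ← Finset.prod_mul_distrib]
  refine Finset.prod_congr rfl fun v _ => ?_
  rw [← mul_assoc]
  exact Nat.choose_mul_factorial_mul_factorial (h v)

/-- Polarization: for letters arranged in blocks, the sum over the orderings of a set depends
only on the letter counts. Both sides satisfy the same recursion, because a subset with letter
counts `k` can be chosen in `∏ v, (n v).choose (k v)` ways. -/
theorem orderingSum_eq_geomCoeff (t : ℝ) {b : α → Fin M} (hb : Antitone b) (T : Fin M → B)
    (S : Finset α) :
    orderingSum t (fun x => T (b x)) S =
      (multiFactorial (letterCount b S) : ℝ) • geomCoeff t T (letterCount b S) := by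
  induction S using Finset.strongInduction with
  | H S ih =>
  rcases S.eq_empty_or_nonempty with rfl | hS
  · rw [orderingSum_empty, letterCount_eq_zero.2 rfl, geomCoeff_zero, smul_zero]
  have hn : letterCount b S ≠ 0 := fun h => hS.ne_empty (letterCount_eq_zero.1 h)
  have hmon : ∀ n : Fin M → ℕ, orderedMonomial T n =
      (multiFactorial n : ℝ) • dividedMonomial T n := fun n => by
    have := multiFactorial_pos n
    rw [dividedMonomial, smul_smul, mul_one_div_cancel (by positivity), one_smul]
  set n := letterCount b S with hndef
  rw [orderingSum_eq_sub t _ S hS, geomCoeff_eq_sub t T hn, smul_sub, sortedProd_comp hb, hmon,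
    smul_comm _ t]
  congr 2
  have h1 : ∑ U ∈ S.powerset.erase ∅, sortedProd (fun x => T (b x)) U *
      orderingSum t (fun x => T (b x)) (S \ U) =
      ∑ U ∈ S.powerset, (fun k => if k = 0 then 0 else
        ((multiFactorial k : ℝ) • dividedMonomial T k) *
        ((multiFactorial (n - k) : ℝ) • geomCoeff t T (n - k))) (letterCount b U) := by
    rw [← Finset.sum_erase S.powerset (a := ∅) (by simp [letterCount_eq_zero.2])]
    refine Finset.sum_congr rfl fun U hU => ?_
    rw [Finset.mem_erase, Finset.mem_powerset] at hU
    have hU0 : letterCount b U ≠ 0 := fun h => hU.1 (letterCount_eq_zero.1 h)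
    rw [ih (S \ U) (Finset.sdiff_ssubset hU.2 (Finset.nonempty_iff_ne_empty.2 hU.1)),
      letterCount_sdiff b hU.2, sortedProd_comp hb, hmon]
    simp [hU0, hndef]
  rw [h1, sum_powerset_letterCount b S fun k => if k = 0 then 0 else
        ((multiFactorial k : ℝ) • dividedMonomial T k) *
        ((multiFactorial (n - k) : ℝ) • geomCoeff t T (n - k)),
    ← Finset.sum_erase _ (a := 0) (by simp), Finset.smul_sum]
  refine Finset.sum_congr rfl fun k hk => ?_
  rw [Finset.mem_erase, Finset.mem_Iic] at hk
  rw [if_neg hk.1, smul_mul_smul_comm, ← Nat.cast_smul_eq_nsmul ℝ, smul_smul,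
    ← multiFactorial_mul_choose hk.2]
  push_cast
  rfl

end OrderedMonomial

/-! ### Descents and the coefficients of the BCH series -/

section PermutationSums

theorem sum_orderings_univ {V : Type*} [AddCommMonoid V] (q : ℕ) (f : List (Fin q) → V) :
    ∑ l ∈ orderings (Finset.univ : Finset (Fin q)), f l =
      ∑ σ : Equiv.Perm (Fin q), f (List.ofFn σ) := by
  symm
  refine Finset.sum_bij (fun σ _ => List.ofFn σ) ?_ ?_ ?_ ?_
  · intro σ _
    rw [mem_orderings, List.nodup_ofFn]
    refine ⟨σ.injective, ?_⟩
    ext x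
    simp only [List.mem_toFinset, List.mem_ofFn, Finset.mem_univ, iff_true]
    exact σ.surjective x
  · intro σ _ τ _ h
    exact Equiv.coe_fn_injective (List.ofFn_injective h)
  · intro l hl
    obtain ⟨hn, hu⟩ := mem_orderings.1 hl
    have hlen : l.length = q := by
      rw [← List.toFinset_card_of_nodup hn, hu, Finset.card_univ, Fintype.card_fin]
    obtain ⟨g, rfl⟩ : ∃ g : Fin q → Fin q, l = List.ofFn g :=
      ⟨fun i => l.get (i.cast hlen.symm), List.ext_get (by simp [hlen]) (by simp)⟩
    have hinj : Function.Injective g := List.nodup_ofFn.1 hn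
    exact ⟨Equiv.ofBijective g (Finite.injective_iff_bijective.1 hinj), Finset.mem_univ _, rfl⟩
  · intro σ _
    rfl

/-- For distinct entries, every step is an ascent or a descent. -/
theorem descentWeight_ofFn {α : Type*} [LinearOrder α] (t : ℝ) (k : ℕ) (f : Fin (k + 1) → α)
    (hf : Function.Injective f) :
    (Finset.univ.filter fun i : Fin (k + 1) =>
      ∃ h : (i : ℕ) + 1 < k + 1, f ⟨(i : ℕ) + 1, h⟩ < f i).card ≤ k ∧
    descentWeight t (List.ofFn f) =
      (-t) ^ (Finset.univ.filter fun i : Fin (k + 1) =>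
        ∃ h : (i : ℕ) + 1 < k + 1, f ⟨(i : ℕ) + 1, h⟩ < f i).card *
      (1 - t) ^ (k - (Finset.univ.filter fun i : Fin (k + 1) =>
        ∃ h : (i : ℕ) + 1 < k + 1, f ⟨(i : ℕ) + 1, h⟩ < f i).card) := by
  induction k with
  | zero =>
    have h0 : (Finset.univ.filter fun i : Fin (0 + 1) =>
        ∃ h : (i : ℕ) + 1 < 0 + 1, f ⟨(i : ℕ) + 1, h⟩ < f i) = ∅ :=
      Finset.filter_eq_empty_iff.2 fun i _ ⟨h, _⟩ => by omega
    rw [h0]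
    simp [descentWeight]
  | succ k ih =>
    obtain ⟨ih1, ih2⟩ := ih (fun i => f i.succ) (hf.comp (Fin.succ_injective _))
    have hcard : (Finset.univ.filter fun i : Fin (k + 1 + 1) =>
        ∃ h : (i : ℕ) + 1 < k + 1 + 1, f ⟨(i : ℕ) + 1, h⟩ < f i).card =
        (if f 1 < f 0 then 1 else 0) + (Finset.univ.filter fun i : Fin (k + 1) =>
          ∃ h : (i : ℕ) + 1 < k + 1,
            (fun j : Fin (k + 1) => f j.succ) ⟨(i : ℕ) + 1, h⟩ <
              (fun j : Fin (k + 1) => f j.succ) i).card := by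
      rw [Fin.card_filter_univ_succ]
      have e0 : (∃ h : ((0 : Fin (k + 1 + 1)) : ℕ) + 1 < k + 1 + 1,
          f ⟨((0 : Fin (k + 1 + 1)) : ℕ) + 1, h⟩ < f 0) ↔ f 1 < f 0 :=
        ⟨fun ⟨_, h⟩ => h, fun h => ⟨by simp, h⟩⟩
      have e1 : ∀ i : Fin (k + 1), (∃ h : ((i.succ : Fin (k + 1 + 1)) : ℕ) + 1 < k + 1 + 1,
          f ⟨((i.succ : Fin (k + 1 + 1)) : ℕ) + 1, h⟩ < f i.succ) ↔
          (∃ h : (i : ℕ) + 1 < k + 1,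
            (fun j : Fin (k + 1) => f j.succ) ⟨(i : ℕ) + 1, h⟩ <
              (fun j : Fin (k + 1) => f j.succ) i) := fun i =>
        ⟨fun ⟨h, h'⟩ => ⟨by simpa using h, h'⟩, fun ⟨h, h'⟩ => ⟨by simpa using h, h'⟩⟩
      simp only [e0, e1]
      split_ifs <;> simp [add_comm]
    rw [hcard]
    have hl : List.ofFn f = f 0 :: f 1 :: List.ofFn (fun i : Fin k => f i.succ.succ) := by
      rw [List.ofFn_succ, List.ofFn_succ]; rfl
    have hl' : List.ofFn (fun i => f i.succ) =
        f 1 :: List.ofFn (fun i : Fin k => f i.succ.succ) := by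
      rw [List.ofFn_succ]; rfl
    rw [hl, descentWeight, ← hl', ih2]
    have hne : f 0 ≠ f 1 := fun h => by simpa using hf h
    rcases hne.lt_or_gt with h | h
    · rw [if_pos h, if_neg h.not_gt, zero_add, Nat.succ_sub ih1, pow_succ]
      exact ⟨ih1.trans (Nat.le_succ k), by ring⟩
    · rw [if_neg h.not_gt, if_pos h, add_comm 1, pow_succ, Nat.add_sub_add_right]
      exact ⟨Nat.succ_le_succ ih1, by ring⟩

theorem integral_neg_pow_mul_one_sub_pow (a b : ℕ) :
    ∫ t in (0 : ℝ)..1, (-t) ^ a * (1 - t) ^ b =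
      (-1) ^ a * (a ! * b !) / (a + b + 1)! := by
  induction b generalizing a with
  | zero =>
    have : ∀ t : ℝ, (-t) ^ a * (1 - t) ^ 0 = (-1) ^ a * t ^ a := fun t => by
      rw [pow_zero, mul_one, neg_pow]
    simp only [this, intervalIntegral.integral_const_mul, integral_pow]
    rw [add_zero, Nat.factorial_succ]
    have := Nat.factorial_pos a
    push_cast
    field_simp
    simp
  | succ b ih =>
    have : ∀ t : ℝ, (-t) ^ a * (1 - t) ^ (b + 1) =
        (-t) ^ a * (1 - t) ^ b + (-t) ^ (a + 1) * (1 - t) ^ b := fun t => by ring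
    simp only [this]
    rw [intervalIntegral.integral_add (Continuous.intervalIntegrable (by fun_prop) _ _)
      (Continuous.intervalIntegrable (by fun_prop) _ _), ih, ih,
      show a + 1 + b + 1 = (a + b + 1) + 1 by ring, show a + (b + 1) + 1 = (a + b + 1) + 1 by ring,
      Nat.factorial_succ (a + b + 1), Nat.factorial_succ a, Nat.factorial_succ b]
    have := Nat.factorial_pos (a + b + 1)
    push_cast
    field_simp
    ring

/-- The beta integral turns descent weights into the coefficients of the BCH series. The factor
`q` is the one lost in passing from associative words to nested commutators. -/
theorem integral_descentWeight {q : ℕ} (hq : 1 ≤ q) (σ : Equiv.Perm (Fin q)) :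
    ∫ t in (0 : ℝ)..1, descentWeight t (List.ofFn σ) = q * bchCoeff σ := by
  obtain ⟨k, rfl⟩ : ∃ k, q = k + 1 := ⟨q - 1, by omega⟩
  have h := fun t => (descentWeight_ofFn t k σ σ.injective).2
  have hle := (descentWeight_ofFn 0 k σ σ.injective).1
  simp only [h]
  change ∫ t in (0 : ℝ)..1, (-t) ^ descents σ * (1 - t) ^ (k - descents σ) = _
  change descents σ ≤ k at hle
  rw [integral_neg_pow_mul_one_sub_pow, bchCoeff, Nat.add_sub_cancel' hle, Nat.add_sub_cancel,
    Nat.factorial_succ]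
  have h1 := Nat.choose_pos hle
  have h2 := Nat.factorial_pos (descents σ)
  have h3 := Nat.factorial_pos (k - descents σ)
  rw [← Nat.choose_mul_factorial_mul_factorial hle]
  push_cast
  field_simp

theorem continuous_descentWeight {α : Type*} [LinearOrder α] (l : List α) :
    Continuous fun t => descentWeight t l := by
  induction l with
  | nil => exact continuous_const
  | cons a l ih =>
    cases l with
    | nil => exact continuous_const
    | cons b l =>
      simp only [descentWeight]
      refine Continuous.mul ?_ ih
      split_ifs <;> fun_prop

end PermutationSums

/-! ### Coefficients of words -/

section WordCoefficients

variable {M : ℕ}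

/-- The coefficient of the word `w` in
`∑_{p_1+⋯+p_M=q} 1/(p_1!⋯p_M!) ∑_{σ ∈ S_q} c_σ A_{σ(1)} ⋯ A_{σ(q)}`, where `A` is the word
`blockIndices p`. -/
def wordSum {q : ℕ} (c : Equiv.Perm (Fin q) → ℝ) (w : Fin q → Fin M) : ℝ :=
  ∑ p ∈ Finset.piAntidiag (Finset.univ : Finset (Fin M)) q, 1 / (multiFactorial p : ℝ) *
    ∑ σ : Equiv.Perm (Fin q),
      if ∀ i, (blockIndices p)[(σ i : ℕ)]? = some (w i) then c σ else 0

/-- The coefficient with which the nested commutator of the word `w` enters the BCH series. -/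
def wordCoeff {q : ℕ} (w : Fin q → Fin M) : ℝ := wordSum bchCoeff w

theorem exists_blockFun {q : ℕ} {p : Fin M → ℕ}
    (hp : p ∈ Finset.piAntidiag (Finset.univ : Finset (Fin M)) q) :
    ∃ b : Fin q → Fin M, Antitone b ∧ letterCount b Finset.univ = p ∧
      ∀ i : Fin q, (blockIndices p)[(i : ℕ)]? = some (b i) := by
  have hlen : (blockIndices p).length = q := by
    rw [length_blockIndices]; exact (Finset.mem_piAntidiag.1 hp).1
  have hb : blockIndices p =
      List.ofFn (fun i : Fin q => (blockIndices p).get (i.cast hlen.symm)) := by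
    subst hlen; simp
  refine ⟨fun i => (blockIndices p).get (i.cast hlen.symm), ?_, ?_, fun i => by simp⟩
  · intro i j hij
    exact List.pairwise_iff_get.1 (pairwise_blockIndices p) |> fun h => by
      rcases hij.eq_or_lt with rfl | hlt
      · exact le_rfl
      · exact h _ _ hlt
  · ext v
    rw [← count_blockIndices p v]
    conv_rhs => rw [hb]
    rw [List.ofFn_eq_map, List.count_eq_countP, List.countP_map, List.countP_eq_length_filter,
      letterCount, Finset.card_def, Finset.filter_val, Fin.univ_def, Multiset.filter_coe,
      Multiset.coe_card]
    rfl

/-- Reorganization of a sum over exponent vectors and permutations as a sum over words. -/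
theorem sum_wordSum_smul {V : Type*} [AddCommGroup V] [Module ℝ V] {q : ℕ}
    (c : Equiv.Perm (Fin q) → ℝ) (F : (Fin q → Fin M) → V) (f : (Fin M → ℕ) → V)
    (hf : ∀ p ∈ Finset.piAntidiag (Finset.univ : Finset (Fin M)) q, ∀ b : Fin q → Fin M,
      Antitone b → letterCount b Finset.univ = p →
      (∀ i : Fin q, (blockIndices p)[(i : ℕ)]? = some (b i)) →
      f p = (1 / (multiFactorial p : ℝ)) • ∑ σ : Equiv.Perm (Fin q), c σ • F (b ∘ σ)) :
    ∑ w, wordSum c w • F w = ∑ p ∈ Finset.piAntidiag (Finset.univ : Finset (Fin M)) q, f p := by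
  simp only [wordSum, Finset.sum_smul]
  rw [Finset.sum_comm]
  refine Finset.sum_congr rfl fun p hp => ?_
  obtain ⟨b, hb, hc, hbi⟩ := exists_blockFun hp
  rw [hf p hp b hb hc hbi, Finset.smul_sum]
  simp only [mul_smul, Finset.sum_smul, hbi, Finset.smul_sum]
  rw [Finset.sum_comm]
  refine Finset.sum_congr rfl fun σ _ => ?_
  rw [Finset.sum_eq_single (b ∘ σ)]
  · simp
  · intro w _ hw
    rw [if_neg, zero_smul, smul_zero]
    intro h
    exact hw (funext fun i => (Option.some_injective _ (h i)).symm)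
  · simp

theorem abs_bchCoeff_le_one {q : ℕ} (σ : Equiv.Perm (Fin q)) : |bchCoeff σ| ≤ 1 := by
  rw [bchCoeff, abs_mul, abs_div, abs_div, abs_pow, abs_pow, abs_neg, abs_one, one_pow]
  rw [Nat.abs_cast, Nat.abs_cast]
  have h1 : ∀ k : ℕ, 1 / (k : ℝ) ≤ 1 := fun k => by
    rcases Nat.eq_zero_or_pos k with rfl | h
    · simp
    · exact (div_le_one (by positivity)).2 (by exact_mod_cast h)
  have h2 := h1 (q ^ 2)
  push_cast at h2
  exact mul_le_one₀ h2 (by positivity) (h1 _)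

/-- The permutations that turn `b` into a given word form a coset of the stabilizer of `b`, or
the empty set. -/
theorem card_perm_comp_le {q : ℕ} {p : Fin M → ℕ} (b w : Fin q → Fin M)
    (hb : letterCount b Finset.univ = p) :
    (Finset.univ.filter fun σ : Equiv.Perm (Fin q) => b ∘ σ = w).card ≤ multiFactorial p := by
  have h := DomMulAct.stabilizer_card b
  have h2 : ∏ i, (Fintype.card {a // b a = i})! = multiFactorial p := by
    rw [multiFactorial, ← hb]
    refine Finset.prod_congr rfl fun v _ => ?_
    rw [letterCount, Fintype.card_subtype]
  rw [← h2, ← h, Fintype.card_subtype]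
  rcases (Finset.univ.filter fun σ : Equiv.Perm (Fin q) => b ∘ σ = w).eq_empty_or_nonempty with
    h0 | ⟨σ₀, h0⟩
  · simp [h0]
  · refine Finset.card_le_card_of_injOn (fun σ => σ * σ₀⁻¹) ?_ ?_
    · intro σ hσ
      simp only [Finset.coe_filter, Finset.mem_univ, true_and, Set.mem_ofPred_eq,
        Finset.mem_filter] at hσ h0 ⊢
      rw [Equiv.Perm.coe_mul, ← Function.comp_assoc, hσ, ← h0]
      ext i
      simp
    · intro σ _ τ _ h
      exact mul_right_cancel h

/-- Only the exponent vector `p` that counts the letters of `w` contributes, and for it at most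
`p_1! ⋯ p_M!` permutations do, each with a coefficient of modulus at most one. -/
theorem abs_wordCoeff_le_one {q : ℕ} (w : Fin q → Fin M) : |wordCoeff w| ≤ 1 := by
  have hmem : letterCount w Finset.univ ∈ Finset.piAntidiag (Finset.univ : Finset (Fin M)) q := by
    rw [Finset.mem_piAntidiag]
    refine ⟨?_, by simp⟩
    change ∑ v, (Finset.univ.filter (w · = v)).card = q
    rw [← Finset.card_eq_sum_card_fiberwise (fun x _ => Finset.mem_coe.2 (Finset.mem_univ (w x)))]
    simp
  have hiff : ∀ (p : Fin M → ℕ) (b : Fin q → Fin M) (σ : Equiv.Perm (Fin q)),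
      (∀ i : Fin q, (blockIndices p)[(i : ℕ)]? = some (b i)) →
      ((∀ i, (blockIndices p)[(σ i : ℕ)]? = some (w i)) ↔ b ∘ σ = w) := fun p b σ hb => by
    simp only [hb, Option.some_inj, funext_iff, Function.comp_apply]
  rw [wordCoeff, wordSum, Finset.sum_eq_single_of_mem _ hmem]
  · obtain ⟨b, -, hc, hb⟩ := exists_blockFun hmem
    have hpos := multiFactorial_pos (letterCount w Finset.univ)
    rw [abs_mul, abs_of_nonneg (by positivity), one_div_mul_eq_div, div_le_one (by positivity)]
    refine (Finset.abs_sum_le_sum_abs _ _).trans ?_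
    calc _ ≤ ∑ σ : Equiv.Perm (Fin q), if b ∘ σ = w then (1 : ℝ) else 0 := by
          refine Finset.sum_le_sum fun σ _ => ?_
          simp only [hiff _ b σ hb]
          split_ifs
          · exact abs_bchCoeff_le_one σ
          · simp
      _ = ((Finset.univ.filter fun σ : Equiv.Perm (Fin q) => b ∘ σ = w).card : ℝ) := by simp
      _ ≤ _ := by exact_mod_cast card_perm_comp_le b w hc
  · intro p hp hne
    obtain ⟨b, -, hc, hb⟩ := exists_blockFun hp
    rw [Finset.sum_eq_zero, mul_zero]
    intro σ _
    rw [if_neg]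
    rw [hiff _ b σ hb]
    rintro rfl
    refine hne (hc.symm.trans ?_)
    ext v
    refine Finset.card_bij (fun i _ => σ.symm i) ?_ (fun i _ j _ h => σ.symm.injective h) ?_
    · intro i hi; simpa using hi
    · intro i hi; exact ⟨σ i, by simpa using hi, by simp⟩

end WordCoefficients

/-! ### The truncated logarithm in a nilpotent filtration -/

section NilpotentFiltration

variable {B : Type*} [Ring B] [Algebra ℝ B]

/-- A decreasing multiplicative filtration `J` of an algebra by subspaces that vanishes above `N`.
Power series in elements of `J 1` are finite sums, which makes formal identities literal. -/
structure IsNilFiltration (J : ℕ → Submodule ℝ B) (N : ℕ) : Prop where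
  one_mem : 1 ∈ J 0
  mul_mem : ∀ {a b : ℕ} {x y : B}, x ∈ J a → y ∈ J b → x * y ∈ J (a + b)
  eq_bot : ∀ {m : ℕ}, N < m → J m = ⊥
  anti : ∀ {a b : ℕ}, a ≤ b → J b ≤ J a

variable {J : ℕ → Submodule ℝ B} {N : ℕ}

theorem IsNilFiltration.pow_mem (hJ : IsNilFiltration J N) {x : B} (hx : x ∈ J 1) (k : ℕ) :
    x ^ k ∈ J k := by
  induction k with
  | zero => simpa using hJ.one_mem
  | succ k ih => rw [pow_succ]; exact hJ.mul_mem ih hx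

theorem IsNilFiltration.eq_zero (hJ : IsNilFiltration J N) {m : ℕ} (hm : N < m) {x : B}
    (hx : x ∈ J m) : x = 0 := by
  rw [hJ.eq_bot hm] at hx
  exact (Submodule.mem_bot ℝ).1 hx

variable {M : ℕ} {T : Fin M → B}

theorem IsNilFiltration.dividedMonomial_mem (hJ : IsNilFiltration J N) (hT : ∀ v, T v ∈ J 1)
    (n : Fin M → ℕ) : dividedMonomial T n ∈ J (∑ v, n v) := by
  refine (J _).smul_mem _ ?_
  have h : ∀ l : List (Fin M), (l.map fun v => T v ^ n v).prod ∈ J (l.map n).sum := by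
    intro l
    induction l with
    | nil => simpa using hJ.one_mem
    | cons v l ih =>
      rw [List.map_cons, List.map_cons, List.prod_cons, List.sum_cons]
      exact hJ.mul_mem (hJ.pow_mem (hT v) _) ih
  have h2 := h (List.finRange M).reverse
  rwa [List.map_reverse (f := n), List.sum_reverse, ← List.ofFn_eq_map, List.sum_ofFn] at h2

theorem IsNilFiltration.geomCoeff_mem (hJ : IsNilFiltration J N) (hT : ∀ v, T v ∈ J 1) (t : ℝ)
    (n : Fin M → ℕ) : geomCoeff t T n ∈ J (∑ v, n v) := by
  induction h : ∑ v, n v using Nat.strong_induction_on generalizing n with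
  | _ s ih =>
  rcases eq_or_ne n 0 with rfl | hn
  · rw [geomCoeff_zero]; exact zero_mem _
  rw [geomCoeff_eq_sub t T hn]
  refine sub_mem (h ▸ hJ.dividedMonomial_mem hT n) ((J s).smul_mem _ (sum_mem fun k hk => ?_))
  rw [Finset.mem_erase, Finset.mem_Iic] at hk
  have hsum : ∑ v, k v + ∑ v, (n - k) v = s := by
    rw [← Finset.sum_add_distrib, ← h]
    exact Finset.sum_congr rfl fun v _ => Nat.add_sub_cancel' (hk.2 v)
  have hpos : 0 < ∑ v, k v := by
    obtain ⟨v, hv⟩ := Function.ne_iff.1 hk.1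
    exact Finset.sum_pos' (fun _ _ => Nat.zero_le _) ⟨v, Finset.mem_univ _, Nat.pos_of_ne_zero hv⟩
  have h1 := hJ.mul_mem (hJ.dividedMonomial_mem hT k) (ih _ (by omega) (n - k) rfl)
  rwa [hsum] at h1

/-- The exponent vectors of total degree at most `N`. -/
def exponents (M N : ℕ) : Finset (Fin M → ℕ) :=
  (Finset.range (N + 1)).biUnion fun q => Finset.piAntidiag Finset.univ q

theorem mem_exponents {n : Fin M → ℕ} : n ∈ exponents M N ↔ ∑ v, n v ≤ N := by
  simp [exponents, Finset.mem_piAntidiag]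

theorem sum_exponents {V : Type*} [AddCommMonoid V] (f : (Fin M → ℕ) → V) :
    ∑ n ∈ exponents M N, f n =
      ∑ q ∈ Finset.range (N + 1), ∑ n ∈ Finset.piAntidiag Finset.univ q, f n := by
  rw [exponents, Finset.sum_biUnion]
  intro a _ b _ hab
  exact Finset.disjoint_left.2 fun n hn hn' =>
    hab ((Finset.mem_piAntidiag.1 hn).1.symm.trans (Finset.mem_piAntidiag.1 hn').1)

/-- The homogeneous recursion of `geomCoeff` sums to `G = Z - t Z G`; the terms of total degree
above `N` that the product creates vanish. -/
theorem IsNilFiltration.sum_geomCoeff_eq (hJ : IsNilFiltration J N) (hT : ∀ v, T v ∈ J 1) (t : ℝ) :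
    ∑ n ∈ exponents M N, geomCoeff t T n =
      (∑ n ∈ (exponents M N).erase 0, dividedMonomial T n) -
        t • ((∑ n ∈ (exponents M N).erase 0, dividedMonomial T n) *
          ∑ n ∈ exponents M N, geomCoeff t T n) := by
  rw [← Finset.sum_erase (exponents M N) (a := 0) (geomCoeff_zero t T)]
  conv_lhs => rw [Finset.sum_congr rfl fun n hn => geomCoeff_eq_sub t T (Finset.ne_of_mem_erase hn)]
  rw [Finset.sum_erase (exponents M N) (a := 0) (geomCoeff_zero t T), Finset.sum_sub_distrib,
    ← Finset.smul_sum]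
  congr 2
  rw [Finset.sum_mul_sum, ← Finset.sum_product', Finset.sum_sigma',
    ← Finset.sum_filter_of_ne (s := (exponents M N).erase 0 ×ˢ exponents M N)
      (p := fun x => x.1 + x.2 ∈ exponents M N)]
  · refine Finset.sum_bij' (fun x _ => (x.2, x.1 - x.2)) (fun y _ => ⟨y.1 + y.2, y.1⟩)
      ?_ ?_ ?_ ?_ ?_
    · rintro ⟨n, k⟩ h
      simp only [Finset.mem_sigma, Finset.mem_erase, Finset.mem_Iic, mem_exponents,
        Finset.mem_filter, Finset.mem_product] at h ⊢
      obtain ⟨⟨hn0, hn⟩, hk0, hk⟩ := h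
      rw [add_tsub_cancel_of_le hk]
      exact ⟨⟨⟨hk0, (Finset.sum_le_sum fun v _ => hk v).trans hn⟩,
        (Finset.sum_le_sum fun v _ => Nat.sub_le _ _).trans hn⟩, hn⟩
    · rintro ⟨k, l⟩ h
      simp only [Finset.mem_sigma, Finset.mem_erase, Finset.mem_Iic, mem_exponents,
        Finset.mem_filter, Finset.mem_product] at h ⊢
      obtain ⟨⟨⟨hk0, hk⟩, hl⟩, hkl⟩ := h
      refine ⟨⟨fun h0 => hk0 ?_, hkl⟩, hk0, le_self_add⟩
      exact le_antisymm (h0 ▸ le_self_add) (zero_le)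
    · rintro ⟨n, k⟩ h
      simp only [Finset.mem_sigma, Finset.mem_erase, Finset.mem_Iic] at h
      simp [add_tsub_cancel_of_le h.2.2]
    · rintro ⟨k, l⟩ h
      simp
    · rintro ⟨n, k⟩ h
      rfl
  · rintro ⟨k, l⟩ h hne
    rw [mem_exponents]
    by_contra hlt
    refine hne (hJ.eq_zero (m := ∑ v, k v + ∑ v, l v) ?_
      (hJ.mul_mem (hJ.dividedMonomial_mem hT k) (hJ.geomCoeff_mem hT t l)))
    rw [← Finset.sum_add_distrib]
    exact not_le.1 hlt

/-- The logarithm series `log (1 + Z) = Z - Z² / 2 + ⋯` up to the power `Z ^ N`. -/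
def logTrunc (N : ℕ) (Z : B) : B :=
  ∑ k ∈ Finset.range N, ((-1) ^ k / (k + 1 : ℝ)) • Z ^ (k + 1)

theorem eq_sum_of_eq_sub_smul_mul {Z G : B} {t : ℝ} (h : G = Z - t • (Z * G)) (m : ℕ) :
    G = ∑ k ∈ Finset.range m, (-t) ^ k • Z ^ (k + 1) + (-t) ^ m • (Z ^ m * G) := by
  induction m with
  | zero => simp
  | succ m ih =>
    have h2 : Z ^ m * G = Z ^ (m + 1) - t • (Z ^ (m + 1) * G) := by
      conv_lhs => rw [h]
      rw [mul_sub, mul_smul_comm, ← mul_assoc, ← pow_succ]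
    conv_lhs => rw [ih, h2]
    rw [Finset.sum_range_succ, smul_sub, pow_succ (-t), smul_smul, mul_neg, neg_smul]
    abel

/-- The homogeneous part of degree `q` of `Z (1 + t Z)⁻¹`, written as a sum over words. -/
theorem piAntidiag_sum_geomCoeff (t : ℝ) (T : Fin M → B) (q : ℕ) :
    ∑ p ∈ Finset.piAntidiag (Finset.univ : Finset (Fin M)) q, geomCoeff t T p =
      ∑ w : Fin q → Fin M, wordSum (fun σ => descentWeight t (List.ofFn σ)) w •
        (List.ofFn fun i => T (w i)).prod := by
  symm
  refine sum_wordSum_smul _ _ _ fun p _ b hb hc _ => ?_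
  have h := orderingSum_eq_geomCoeff t hb T Finset.univ
  rw [hc] at h
  have hpos := multiFactorial_pos p
  have hsum : orderingSum t (fun x => T (b x)) Finset.univ =
      ∑ σ : Equiv.Perm (Fin q), descentWeight t (List.ofFn σ) •
        (List.ofFn fun i => T ((b ∘ σ) i)).prod := by
    rw [orderingSum, sum_orderings_univ]
    simp only [List.map_ofFn]
    rfl
  rw [← hsum, h, smul_smul, one_div_mul_cancel (by positivity), one_smul]

end NilpotentFiltration

section WordSumIntegral

variable {M q : ℕ}

theorem continuous_wordSum_summand (p : Fin M → ℕ) (σ : Equiv.Perm (Fin q)) (w : Fin q → Fin M) :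
    Continuous fun t => if ∀ i, (blockIndices p)[(σ i : ℕ)]? = some (w i) then
      descentWeight t (List.ofFn σ) else 0 := by
  split_ifs
  · exact continuous_descentWeight _
  · exact continuous_const

theorem continuous_wordSum (w : Fin q → Fin M) :
    Continuous fun t => wordSum (fun σ => descentWeight t (List.ofFn σ)) w :=
  continuous_finsetSum _ fun p _ => continuous_const.mul
    (continuous_finsetSum _ fun σ _ => continuous_wordSum_summand p σ w)

theorem integral_wordSum (hq : 1 ≤ q) (w : Fin q → Fin M) :
    ∫ t in (0 : ℝ)..1, wordSum (fun σ => descentWeight t (List.ofFn σ)) w = q * wordCoeff w := by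
  have h1 : ∀ p : Fin M → ℕ, Continuous fun t : ℝ => 1 / (multiFactorial p : ℝ) *
      ∑ σ : Equiv.Perm (Fin q), if ∀ i, (blockIndices p)[(σ i : ℕ)]? = some (w i) then
        descentWeight t (List.ofFn σ) else 0 := fun p =>
    continuous_const.mul (continuous_finsetSum _ fun σ _ => continuous_wordSum_summand p σ w)
  simp only [wordSum, wordCoeff]
  rw [intervalIntegral.integral_finsetSum (fun p _ => (h1 p).intervalIntegrable _ _),
    Finset.mul_sum]
  refine Finset.sum_congr rfl fun p _ => ?_
  rw [intervalIntegral.integral_const_mul, intervalIntegral.integral_finsetSum (fun σ _ =>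
    (continuous_wordSum_summand p σ w).intervalIntegrable _ _), mul_left_comm]
  refine congrArg _ ?_
  rw [Finset.mul_sum]
  refine Finset.sum_congr rfl fun σ _ => ?_
  split_ifs
  · exact integral_descentWeight hq σ
  · simp

end WordSumIntegral

/-! ### The logarithm of a product of exponentials -/

section LogOfProduct

variable {B : Type*} [NormedRing B] [NormedAlgebra ℝ B] {J : ℕ → Submodule ℝ B} {N M : ℕ}
  {T : Fin M → B}

theorem IsNilFiltration.exp_eq_sum (hJ : IsNilFiltration J N) {x : B} (hx : x ∈ J 1) :
    NormedSpace.exp x = ∑ k ∈ Finset.range (N + 1), ((k ! : ℝ)⁻¹) • x ^ k := by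
  rw [NormedSpace.exp_eq_tsum ℝ]
  refine tsum_eq_sum fun k hk => ?_
  rw [hJ.eq_zero (m := k) (by simpa using hk) (hJ.pow_mem hx k), smul_zero]

/-- The product of exponential series, multiplied out. -/
theorem IsNilFiltration.prod_exp_eq_sum (hJ : IsNilFiltration J N) (hT : ∀ v, T v ∈ J 1) :
    ((List.finRange M).reverse.map fun v => NormedSpace.exp (T v)).prod =
      ∑ n ∈ exponents M N, dividedMonomial T n := by
  have h1 : ((List.finRange M).reverse.map fun v => NormedSpace.exp (T v)).prod =
      MultilinearMap.mkPiAlgebraFin ℝ M B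
        fun i => ∑ k ∈ Finset.range (N + 1), ((k ! : ℝ)⁻¹) • T i.rev ^ k := by
    rw [List.finRange_reverse, List.map_map, ← List.ofFn_eq_map,
      MultilinearMap.mkPiAlgebraFin_apply]
    exact congrArg _ (congrArg _ (funext fun i => hJ.exp_eq_sum (hT i.rev)))
  have h2 : ∀ r : Fin M → ℕ, MultilinearMap.mkPiAlgebraFin ℝ M B
      (fun i => (((r i) ! : ℝ)⁻¹) • T i.rev ^ r i) = dividedMonomial T (r ∘ Fin.rev) := by
    intro r
    rw [MultilinearMap.map_smul_univ, dividedMonomial, orderedMonomial, List.finRange_reverse,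
      List.map_map, ← List.ofFn_eq_map, MultilinearMap.mkPiAlgebraFin_apply, multiFactorial]
    congr 1
    · rw [Finset.prod_inv_distrib, one_div, Nat.cast_prod]
      congr 1
      exact (Equiv.prod_comp Fin.revPerm fun i => ((r i)! : ℝ)).symm
    · simp [Function.comp_def]
  have hrev : ∀ r ∈ exponents M N, r ∘ Fin.rev ∈ exponents M N := fun r hr => by
    rw [mem_exponents] at hr ⊢
    exact (Equiv.sum_comp Fin.revPerm (fun v => r v)).le.trans hr
  rw [h1, MultilinearMap.map_sum_finset]
  simp only [h2]
  rw [← Finset.sum_subset (s₁ := exponents M N)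
    (s₂ := Fintype.piFinset fun _ => Finset.range (N + 1))]
  · refine Finset.sum_bij' (fun r _ => r ∘ Fin.rev) (fun r _ => r ∘ Fin.rev) ?_ ?_ ?_ ?_ ?_
    · intro r hr
      exact hrev r hr
    · intro r hr
      exact hrev r hr
    · intro r _
      ext i; simp
    · intro r _
      ext i; simp
    · intro r _
      rfl
  · intro n hn
    rw [mem_exponents] at hn
    simp only [Fintype.mem_piFinset, Finset.mem_range, Nat.lt_succ_iff]
    exact fun v => (Finset.single_le_sum (fun _ _ => Nat.zero_le _) (Finset.mem_univ v)).trans hn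
  · intro n _ hn
    rw [mem_exponents, not_le, ← Equiv.sum_comp Fin.revPerm n] at hn
    exact hJ.eq_zero hn (hJ.dividedMonomial_mem hT (n ∘ Fin.rev))

/-- The associative form of the Baker–Campbell–Hausdorff formula. It is the integral over
`t ∈ [0, 1]` of `∑ (-t)^k Z^(k+1) = Z (1 + t Z)⁻¹`, in which the coefficient of the word read off
along a permutation with `d` descents is `(-t)^d (1 - t)^(q-1-d)`. -/
theorem IsNilFiltration.logTrunc_prod_exp [CompleteSpace B] (hJ : IsNilFiltration J N)
    (hT : ∀ v, T v ∈ J 1) :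
    logTrunc N (((List.finRange M).reverse.map fun v => NormedSpace.exp (T v)).prod - 1) =
      ∑ q ∈ Finset.Icc 1 N, ∑ w : Fin q → Fin M, (q * wordCoeff w) •
        (List.ofFn fun i => T (w i)).prod := by
  have h0 : (0 : Fin M → ℕ) ∈ exponents M N := mem_exponents.2 (by simp)
  have hd0 : dividedMonomial T 0 = 1 := by simp [dividedMonomial, orderedMonomial, multiFactorial]
  rw [hJ.prod_exp_eq_sum hT, ← Finset.add_sum_erase _ _ h0, hd0, add_sub_cancel_left]
  set Z := ∑ n ∈ (exponents M N).erase 0, dividedMonomial T n with hZ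
  have hZ1 : Z ∈ J 1 := by
    refine sum_mem fun n hn => hJ.anti ?_ (hJ.dividedMonomial_mem hT n)
    obtain ⟨v, hv⟩ := Function.ne_iff.1 (Finset.ne_of_mem_erase hn)
    exact Finset.sum_pos' (fun _ _ => Nat.zero_le _) ⟨v, Finset.mem_univ _, Nat.pos_of_ne_zero hv⟩
  have hZN : Z ^ (N + 1) = 0 := hJ.eq_zero (Nat.lt_succ_self N) (hJ.pow_mem hZ1 _)
  -- both sides are `Z (1 + t Z)⁻¹`
  have key : ∀ t : ℝ, ∑ k ∈ Finset.range N, (-t) ^ k • Z ^ (k + 1) =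
      ∑ q ∈ Finset.Icc 1 N, ∑ w : Fin q → Fin M,
        wordSum (fun σ => descentWeight t (List.ofFn σ)) w • (List.ofFn fun i => T (w i)).prod := by
    intro t
    have h1 := eq_sum_of_eq_sub_smul_mul (hJ.sum_geomCoeff_eq hT t) (N + 1)
    rw [← hZ, hZN, zero_mul, smul_zero, add_zero, Finset.sum_range_succ, hZN, smul_zero, add_zero,
      sum_exponents, Finset.sum_range_succ'] at h1
    rw [← h1, show Finset.piAntidiag (Finset.univ : Finset (Fin M)) 0 = {0} by simp,
      Finset.sum_singleton, geomCoeff_zero, add_zero,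
      show Finset.Icc 1 N = Finset.Ico 1 (N + 1) by ext; simp, Finset.sum_Ico_eq_sum_range,
      Nat.add_sub_cancel]
    refine Finset.sum_congr rfl fun q _ => ?_
    rw [piAntidiag_sum_geomCoeff, add_comm 1 q]
  have hint := intervalIntegral.integral_congr (μ := MeasureTheory.volume) (a := 0) (b := 1)
    fun t _ => key t
  rw [intervalIntegral.integral_finsetSum
    (fun k _ => Continuous.intervalIntegrable (by fun_prop) _ _)] at hint
  have hcont' : ∀ {q : ℕ} (w : Fin q → Fin M), Continuous fun t =>
      wordSum (fun σ => descentWeight t (List.ofFn σ)) w • (List.ofFn fun i => T (w i)).prod :=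
    fun w => (continuous_wordSum w).smul continuous_const
  rw [logTrunc]
  convert hint using 1
  · refine Finset.sum_congr rfl fun k _ => ?_
    rw [intervalIntegral.integral_smul_const]
    congr 1
    have h2 := integral_neg_pow_mul_one_sub_pow k 0
    simp only [pow_zero, mul_one] at h2
    rw [h2, add_zero, Nat.factorial_succ]
    have := Nat.factorial_pos k
    push_cast
    field_simp
    simp
  · rw [intervalIntegral.integral_finsetSum (fun q _ => Continuous.intervalIntegrable
      (continuous_finsetSum _ fun w _ => hcont' w) _ _)]
    refine Finset.sum_congr rfl fun q hq => ?_
    rw [intervalIntegral.integral_finsetSum (fun w _ => Continuous.intervalIntegrable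
      (hcont' w) _ _)]
    refine Finset.sum_congr rfl fun w _ => ?_
    rw [intervalIntegral.integral_smul_const]
    congr 1
    exact (integral_wordSum (Finset.mem_Icc.1 hq).1 w).symm

end LogOfProduct

/-! ### The adjoint representation and the derivative of the exponential -/

section AdjointExponential

variable {A : Type*} [NormedRing A] [NormedAlgebra ℝ A]

/-- The operator `ad X : Y ↦ [X, Y]`. -/
def adCLM (X : A) : A →L[ℝ] A :=
  ContinuousLinearMap.mul ℝ A X - (ContinuousLinearMap.mul ℝ A).flip X

@[simp]
theorem adCLM_apply (X Y : A) : adCLM X Y = ⁅X, Y⁆ := by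
  simp [adCLM, Ring.lie_def]

variable [CompleteSpace A]

theorem exp_mul_left (X : A) :
    NormedSpace.exp (ContinuousLinearMap.mul ℝ A X) =
      ContinuousLinearMap.mul ℝ A (NormedSpace.exp X) := by
  have hpow : ∀ k : ℕ, (ContinuousLinearMap.mul ℝ A X) ^ k =
      ContinuousLinearMap.mul ℝ A (X ^ k) := by
    intro k
    induction k with
    | zero => ext y; simp
    | succ k ih => ext y; simp [pow_succ, ih, mul_assoc]
  have h := (NormedSpace.exp_series_hasSum_exp' (𝕂 := ℝ) X).mapL (ContinuousLinearMap.mul ℝ A)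
  have h' := NormedSpace.exp_series_hasSum_exp' (𝕂 := ℝ) (ContinuousLinearMap.mul ℝ A X)
  simp only [map_smul, ← hpow] at h
  exact h'.unique h

theorem exp_mul_right (X : A) :
    NormedSpace.exp ((ContinuousLinearMap.mul ℝ A).flip X) =
      (ContinuousLinearMap.mul ℝ A).flip (NormedSpace.exp X) := by
  have hpow : ∀ k : ℕ, ((ContinuousLinearMap.mul ℝ A).flip X) ^ k =
      (ContinuousLinearMap.mul ℝ A).flip (X ^ k) := by
    intro k
    induction k with
    | zero => ext y; simp
    | succ k ih => ext y; simp [pow_succ', ih, mul_assoc, (Commute.pow_self X k).eq]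
  have h := (NormedSpace.exp_series_hasSum_exp' (𝕂 := ℝ) X).mapL (ContinuousLinearMap.mul ℝ A).flip
  have h' := NormedSpace.exp_series_hasSum_exp' (𝕂 := ℝ) ((ContinuousLinearMap.mul ℝ A).flip X)
  simp only [map_smul, ← hpow] at h
  exact h'.unique h

theorem exp_adCLM_apply (X Y : A) :
    NormedSpace.exp (adCLM X) Y = NormedSpace.exp X * Y * NormedSpace.exp (-X) := by
  have hc : Commute (ContinuousLinearMap.mul ℝ A X) ((ContinuousLinearMap.mul ℝ A).flip (-X)) := by
    ext y; simp [mul_assoc]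
  have : adCLM X = ContinuousLinearMap.mul ℝ A X + (ContinuousLinearMap.mul ℝ A).flip (-X) := by
    rw [map_neg, adCLM, sub_eq_add_neg]
  let _ : NormedAlgebra ℚ (A →L[ℝ] A) := NormedAlgebra.restrictScalars ℚ ℝ _
  rw [this, NormedSpace.exp_add_of_commute hc, exp_mul_left, exp_mul_right]
  simp [mul_assoc]

end AdjointExponential

section DerivativeOfExponential

variable {A : Type*} [NormedRing A] [NormedAlgebra ℝ A] [CompleteSpace A]

theorem hasSum_adCLM_integral (X Y : A) :
    HasSum (fun k : ℕ => (1 / ((k + 1)! : ℝ)) • ((adCLM X) ^ k) Y)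
      (∫ r in (0 : ℝ)..1, NormedSpace.exp (r • X) * Y * NormedSpace.exp (-(r • X))) := by
  have h1 : ∀ r : ℝ, HasSum (fun k : ℕ => ((k ! : ℝ)⁻¹ * r ^ k) • ((adCLM X) ^ k) Y)
      (NormedSpace.exp (r • X) * Y * NormedSpace.exp (-(r • X))) := by
    intro r
    have h := (NormedSpace.exp_series_hasSum_exp' (𝕂 := ℝ) (adCLM (r • X))).mapL
      (ContinuousLinearMap.apply ℝ A Y)
    simp only [ContinuousLinearMap.apply_apply, exp_adCLM_apply] at h
    have h2 : ∀ k : ℕ, ((adCLM (r • X)) ^ k) Y = r ^ k • ((adCLM X) ^ k) Y := by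
      intro k
      induction k with
      | zero => simp
      | succ k ih =>
        rw [pow_succ', mul_apply_eq_comp, ih, map_smul, pow_succ' (adCLM X),
          mul_apply_eq_comp, adCLM_apply, adCLM_apply, Ring.lie_def, Ring.lie_def,
          pow_succ, mul_smul, smul_mul_assoc, mul_smul_comm, ← smul_sub]
    have e : (fun k : ℕ => ((k ! : ℝ)⁻¹ * r ^ k) • ((adCLM X) ^ k) Y) =
        fun k : ℕ => ((k ! : ℝ)⁻¹ • (adCLM (r • X)) ^ k) Y := by
      funext k
      rw [smul_apply, h2, mul_smul]
    rw [e]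
    exact h
  have h2 := intervalIntegral.hasSum_intervalIntegral_of_summable_norm (a := 0) (b := 1)
    (f := fun k : ℕ =>
      (⟨fun r : ℝ => ((k ! : ℝ)⁻¹ * r ^ k) • ((adCLM X) ^ k) Y, by fun_prop⟩ : C(ℝ, A))) ?_
  · simp only [ContinuousMap.coe_mk, (h1 _).tsum_eq] at h2
    have e : ∀ k : ℕ, ∫ r in (0 : ℝ)..1, ((k ! : ℝ)⁻¹ * r ^ k) • ((adCLM X) ^ k) Y =
        (1 / ((k + 1)! : ℝ)) • ((adCLM X) ^ k) Y := by
      intro k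
      rw [intervalIntegral.integral_smul_const, intervalIntegral.integral_const_mul, integral_pow]
      congr 1
      rw [Nat.factorial_succ]
      have := Nat.factorial_pos k
      push_cast
      field_simp
      simp
    simp only [e] at h2
    exact h2
  -- the series converges uniformly on the unit interval, which justifies termwise integration
  · refine Summable.of_nonneg_of_le (fun _ => norm_nonneg _) (fun k => ?_)
      ((Real.summable_pow_div_factorial ‖adCLM X‖).mul_right ‖Y‖)
    rw [ContinuousMap.norm_le _ (by positivity)]
    rintro ⟨r, hr⟩
    simp only [ContinuousMap.restrict_apply, ContinuousMap.coe_mk]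
    replace hr : r ∈ Set.Icc (0 : ℝ) 1 := by
      rw [← Set.uIcc_of_le zero_le_one]; exact hr
    have h3 : ‖((adCLM X) ^ k) Y‖ ≤ ‖adCLM X‖ ^ k * ‖Y‖ := by
      refine (((adCLM X) ^ k).le_opNorm Y).trans ?_
      gcongr
      rcases Nat.eq_zero_or_pos k with rfl | hk
      · rw [pow_zero, pow_zero]; exact ContinuousLinearMap.norm_id_le
      · exact norm_pow_le' _ hk
    rw [norm_smul, norm_mul, norm_inv, norm_pow, Real.norm_natCast, Real.norm_of_nonneg hr.1]
    calc ((k ! : ℝ)⁻¹ * r ^ k) * ‖((adCLM X) ^ k) Y‖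
        ≤ ((k ! : ℝ)⁻¹ * 1) * (‖adCLM X‖ ^ k * ‖Y‖) := by
          gcongr
          exact pow_le_one₀ hr.1 hr.2
      _ = _ := by ring

theorem exp_mul_exp_neg (X : A) : NormedSpace.exp X * NormedSpace.exp (-X) = 1 := by
  let _ : NormedAlgebra ℚ A := NormedAlgebra.restrictScalars ℚ ℝ _
  rw [← NormedSpace.exp_add_of_commute (Commute.neg_right rfl), add_neg_cancel,
    NormedSpace.exp_zero]

theorem exp_neg_mul_exp (X : A) : NormedSpace.exp (-X) * NormedSpace.exp X = 1 := by
  simpa using exp_mul_exp_neg (-X)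

/-- Duhamel's formula. -/
theorem exp_mul_exp_neg_sub_one (W X : A) :
    NormedSpace.exp W * NormedSpace.exp (-X) - 1 =
      ∫ r in (0 : ℝ)..1, NormedSpace.exp (r • W) * (W - X) * NormedSpace.exp (-(r • X)) := by
  have hd : ∀ r : ℝ, HasDerivAt (fun r : ℝ => NormedSpace.exp (r • W) * NormedSpace.exp (r • (-X)))
      (NormedSpace.exp (r • W) * (W - X) * NormedSpace.exp (-(r • X))) r := by
    intro r
    have h := (hasDerivAt_exp_smul_const (𝕂 := ℝ) W r).mul
      (hasDerivAt_exp_smul_const' (𝕂 := ℝ) (-X) r)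
    refine h.congr_deriv ?_
    rw [smul_neg]
    noncomm_ring
  have hc : Continuous fun r : ℝ =>
      NormedSpace.exp (r • W) * (W - X) * NormedSpace.exp (-(r • X)) := by
    let _ : NormedAlgebra ℚ A := NormedAlgebra.restrictScalars ℚ ℝ _
    have := NormedSpace.exp_continuous (𝔸 := A)
    fun_prop
  rw [intervalIntegral.integral_eq_sub_of_hasDerivAt (fun r _ => hd r) (hc.intervalIntegrable _ _)]
  simp

/-- The derivative of the exponential along a curve. Differentiability is known from analyticity,
so it suffices to compute the derivative along a line, by Duhamel's formula. -/
theorem hasDerivAt_exp_comp {Φ : ℝ → A} {Y : A} {s : ℝ} (h : HasDerivAt Φ Y s) :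
    HasDerivAt (fun s => NormedSpace.exp (Φ s))
      ((∑' k : ℕ, (1 / ((k + 1)! : ℝ)) • ((adCLM (Φ s)) ^ k) Y) * NormedSpace.exp (Φ s)) s := by
  let _ : NormedAlgebra ℚ A := NormedAlgebra.restrictScalars ℚ ℝ _
  have hcexp := NormedSpace.exp_continuous (𝔸 := A)
  set X := Φ s
  rw [(hasSum_adCLM_integral X Y).tsum_eq]
  have hF : DifferentiableAt ℝ (NormedSpace.exp : A → A) X :=
    (NormedSpace.exp_analytic (𝕂 := ℝ) X).differentiableAt
  have hcomp := hF.hasFDerivAt.comp_hasDerivAt s h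
  -- the derivative is identified along the line through `X` in the direction `Y`
  have hline : HasDerivAt (fun u : ℝ => NormedSpace.exp (X + u • Y))
      ((fderiv ℝ NormedSpace.exp X) Y) 0 := by
    have h1 : HasDerivAt (fun u : ℝ => X + u • Y) Y 0 := by
      simpa using ((hasDerivAt_id (0 : ℝ)).smul_const Y).const_add X
    have hF' : DifferentiableAt ℝ (NormedSpace.exp : A → A) (X + (0 : ℝ) • Y) := by simpa using hF
    have h2 := hF'.hasFDerivAt.comp_hasDerivAt (0 : ℝ) h1
    rw [zero_smul, add_zero] at h2
    exact h2
  have hline' : HasDerivAt (fun u : ℝ => NormedSpace.exp (X + u • Y))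
      ((∫ r in (0 : ℝ)..1, NormedSpace.exp (r • X) * Y * NormedSpace.exp (-(r • X))) *
        NormedSpace.exp X) 0 := by
    let K : ℝ → A := fun u =>
      ∫ r in (0 : ℝ)..1, NormedSpace.exp (r • (X + u • Y)) * Y * NormedSpace.exp (-(r • X))
    have hK : Continuous K :=
      intervalIntegral.continuous_parametric_intervalIntegral_of_continuous' (by fun_prop) _ _
    have hu : ∀ u : ℝ, NormedSpace.exp (X + u • Y) = NormedSpace.exp X +
        u • (K u * NormedSpace.exp X) := by
      intro u
      have h3 := exp_mul_exp_neg_sub_one (X + u • Y) X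
      simp only [add_sub_cancel_left, mul_smul_comm, smul_mul_assoc,
        intervalIntegral.integral_smul] at h3
      have h4 := congrArg (· * NormedSpace.exp X) h3
      simp only [sub_mul, mul_assoc, exp_neg_mul_exp, mul_one, one_mul, smul_mul_assoc] at h4
      rw [← sub_eq_iff_eq_add']
      simpa only [K, mul_assoc] using h4
    have hK0 : K 0 =
        ∫ r in (0 : ℝ)..1, NormedSpace.exp (r • X) * Y * NormedSpace.exp (-(r • X)) := by
      simp [K]
    rw [← hK0, hasDerivAt_iff_tendsto_slope_zero]
    have : Filter.Tendsto (fun t => K t * NormedSpace.exp X) (nhdsWithin 0 {0}ᶜ)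
        (nhds (K 0 * NormedSpace.exp X)) :=
      ((hK.mul continuous_const).tendsto 0).mono_left nhdsWithin_le_nhds
    refine this.congr' ?_
    filter_upwards [self_mem_nhdsWithin] with t ht
    rw [zero_add, hu t]
    have ht' : t ≠ 0 := ht
    simp [smul_smul, inv_mul_cancel₀ ht']
  rw [← hline'.unique hline] at hcomp
  exact hcomp

end DerivativeOfExponential

/-! ### Exponential and logarithm of nilpotent elements -/

section NilpotentLogarithm

variable {A : Type*} [NormedRing A] [NormedAlgebra ℝ A]

variable {J : ℕ → Submodule ℝ A} {N : ℕ}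

theorem IsNilFiltration.exp_sub_one_mem (hJ : IsNilFiltration J N) {x : A} (hx : x ∈ J 1) :
    NormedSpace.exp x - 1 ∈ J 1 := by
  rw [hJ.exp_eq_sum hx, Finset.sum_range_succ']
  simp only [Nat.factorial_zero, Nat.cast_one, inv_one, pow_zero, one_smul, add_sub_cancel_right]
  exact sum_mem fun k _ => (J 1).smul_mem _ (hJ.anti (by omega) (hJ.pow_mem hx (k + 1)))

theorem IsNilFiltration.logTrunc_mem (hJ : IsNilFiltration J N) {Z : A} (hZ : Z ∈ J 1) (m : ℕ) :
    logTrunc m Z ∈ J 1 :=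
  sum_mem fun k _ => (J 1).smul_mem _ (hJ.anti (by omega) (hJ.pow_mem hZ (k + 1)))

variable [CompleteSpace A]

theorem hasDerivAt_exp_comp_of_commute {Φ : ℝ → A} {Y : A} {s : ℝ} (h : HasDerivAt Φ Y s)
    (hc : Commute (Φ s) Y) :
    HasDerivAt (fun s => NormedSpace.exp (Φ s)) (Y * NormedSpace.exp (Φ s)) s := by
  have h1 := hasDerivAt_exp_comp h
  rw [tsum_eq_single 0] at h1
  · simpa using h1
  · intro k hk
    obtain ⟨k, rfl⟩ := Nat.exists_eq_succ_of_ne_zero hk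
    rw [pow_succ, mul_apply_eq_comp, adCLM_apply, hc.lie_eq, map_zero, smul_zero]

/-- The function `exp (-log (1 + t Z)) (1 + t Z)` of `t` has derivative zero. -/
theorem IsNilFiltration.exp_logTrunc (hJ : IsNilFiltration J N) {Z : A} (hZ : Z ∈ J 1) :
    NormedSpace.exp (logTrunc N Z) = 1 + Z := by
  have hZN : Z ^ (N + 1) = 0 := hJ.eq_zero (Nat.lt_succ_self N) (hJ.pow_mem hZ _)
  -- the derivative `Z (1 + t Z)⁻¹` of `log (1 + t Z)`, a finite geometric sum
  let D : ℝ → A := fun t => ∑ k ∈ Finset.range N, (-t) ^ k • Z ^ (k + 1)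
  have hcomm : ∀ t, Commute Z (D t) := fun t => Commute.sum_right _ _ _ fun k _ =>
    (Commute.self_pow Z _).smul_right _
  have hD : ∀ t, D t * (1 + t • Z) = Z := by
    intro t
    have : ∀ m, (∑ k ∈ Finset.range m, (-t) ^ k • Z ^ (k + 1)) * (1 + t • Z) =
        Z - (-t) ^ m • Z ^ (m + 1) := by
      intro m
      induction m with
      | zero => simp
      | succ m ih =>
        rw [Finset.sum_range_succ, add_mul, ih, mul_add, mul_one, smul_mul_smul_comm, ← pow_succ,
          pow_succ (-t), mul_neg, neg_smul]
        abel
    rw [this, hZN, smul_zero, sub_zero]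
  have hlog : ∀ t, logTrunc N (t • Z) =
      ∑ k ∈ Finset.range N, ((-1) ^ k / (k + 1 : ℝ) * t ^ (k + 1)) • Z ^ (k + 1) := fun t =>
    Finset.sum_congr rfl fun k _ => by rw [smul_pow, smul_smul]
  have hlogD : ∀ t, HasDerivAt (fun t => -logTrunc N (t • Z)) (-D t) t := by
    intro t
    simp only [hlog]
    refine (HasDerivAt.fun_sum fun k _ => ?_).neg
    have h1 := ((hasDerivAt_pow (k + 1) t).const_mul ((-1) ^ k / (k + 1 : ℝ))).smul_const
      (Z ^ (k + 1))
    refine h1.congr_deriv ?_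
    congr 1
    have : (k + 1 : ℝ) ≠ 0 := by positivity
    rw [neg_pow t]
    push_cast
    field_simp
  have hlogc : ∀ t, Commute Z (-logTrunc N (t • Z)) := fun t => by
    rw [hlog]
    exact (Commute.sum_right _ _ _ fun k _ => (Commute.self_pow Z _).smul_right _).neg_right
  have hg : ∀ t : ℝ, HasDerivAt
      (fun t : ℝ => NormedSpace.exp (-logTrunc N (t • Z)) * (1 + t • Z)) 0 t := by
    intro t
    have h1 : Commute (-logTrunc N (t • Z)) (-D t) :=
      (Commute.sum_right _ _ _ fun k _ => ((hlogc t).symm.pow_right _).smul_right _).neg_right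
    have h2 := (hasDerivAt_exp_comp_of_commute (hlogD t) h1).mul
      (((hasDerivAt_id t).smul_const Z).const_add 1)
    refine h2.congr_deriv ?_
    rw [show -D t * NormedSpace.exp (-logTrunc N (t • Z)) =
      NormedSpace.exp (-logTrunc N (t • Z)) * -D t from (h1.symm.exp_right).eq, mul_assoc]
    simp [hD]
  have hconst := is_const_of_deriv_eq_zero (fun t => (hg t).differentiableAt)
    (fun t => (hg t).deriv) 1 0
  simp only [one_smul, zero_smul, add_zero, mul_one] at hconst
  rw [show logTrunc N (0 : A) = 0 from Finset.sum_eq_zero fun k _ => by simp, neg_zero,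
    NormedSpace.exp_zero] at hconst
  have := congrArg (NormedSpace.exp (logTrunc N Z) * ·) hconst
  simpa only [← mul_assoc, exp_mul_exp_neg, one_mul, mul_one] using this.symm

/-- The function `log (exp (s Q)) - s Q` of `s` has derivative zero. -/
theorem IsNilFiltration.logTrunc_exp_sub_one (hJ : IsNilFiltration J N) {Q : A} (hQ : Q ∈ J 1) :
    logTrunc N (NormedSpace.exp Q - 1) = Q := by
  let Z : ℝ → A := fun s => NormedSpace.exp (s • Q) - 1
  have hZJ : ∀ s, Z s ∈ J 1 := fun s => hJ.exp_sub_one_mem ((J 1).smul_mem s hQ)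
  have hZ' : ∀ s, HasDerivAt Z (Q * (1 + Z s)) s := fun s => by
    have h := (hasDerivAt_exp_smul_const' (𝕂 := ℝ) Q s).sub_const 1
    simpa [Z] using h
  have hc : ∀ s, Commute (Z s) (Q * (1 + Z s)) := fun s => by
    have h0 : Commute Q (Z s) :=
      (((Commute.refl Q).smul_right s).exp_right).sub_right (Commute.one_right Q)
    exact (h0.symm.mul_right ((Commute.one_right _).add_right (Commute.refl _)))
  have hd : ∀ s, HasDerivAt (fun s => logTrunc N (Z s)) Q s := by
    intro s
    have h1 : HasDerivAt (fun s => logTrunc N (Z s))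
        (∑ k ∈ Finset.range N, (-1 : ℝ) ^ k • (Z s ^ k * (Q * (1 + Z s)))) s := by
      refine HasDerivAt.fun_sum fun k _ => ?_
      have h2 := ((hZ' s).fun_pow' (k + 1)).const_smul ((-1) ^ k / (k + 1 : ℝ))
      refine h2.congr_deriv ?_
      have h3 : ∀ i ∈ Finset.range (k + 1), Z s ^ ((k + 1).pred - i) * (Q * (1 + Z s)) * Z s ^ i =
          Z s ^ k * (Q * (1 + Z s)) := by
        intro i hi
        rw [mul_assoc, ← ((hc s).pow_left i).eq, ← mul_assoc, ← pow_add, Nat.pred_succ,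
          Nat.sub_add_cancel (by simpa [Nat.lt_succ_iff] using hi)]
      rw [Finset.sum_congr rfl h3, Finset.sum_const, Finset.card_range,
        ← Nat.cast_smul_eq_nsmul ℝ, smul_smul]
      congr 1
      have : (k + 1 : ℝ) ≠ 0 := by positivity
      push_cast
      field_simp
    refine h1.congr_deriv ?_
    -- the geometric sum telescopes, and for `m = N` its last term lies above degree `N`
    have h4 : ∀ m, ∑ k ∈ Finset.range m, (-1 : ℝ) ^ k • (Z s ^ k * (Q * (1 + Z s))) =
        Q - (-1 : ℝ) ^ m • (Z s ^ m * Q) := by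
      intro m
      induction m with
      | zero => simp
      | succ m ih =>
        have h0 : Commute Q (Z s) :=
          (((Commute.refl Q).smul_right s).exp_right).sub_right (Commute.one_right Q)
        rw [Finset.sum_range_succ, ih, mul_add, mul_one, h0.eq, mul_add, ← mul_assoc, ← pow_succ,
          pow_succ (-1 : ℝ), mul_neg_one, neg_smul, smul_add]
        abel
    rw [h4, hJ.eq_zero (Nat.lt_succ_self N) (hJ.mul_mem (hJ.pow_mem (hZJ s) N) hQ), smul_zero,
      sub_zero]
  have hg : ∀ s : ℝ, HasDerivAt (fun s => logTrunc N (Z s) - s • Q) 0 s := fun s => by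
    have h := (hd s).sub ((hasDerivAt_id s).smul_const Q)
    rw [one_smul, sub_self] at h
    exact h
  have hconst := is_const_of_deriv_eq_zero (fun t => (hg t).differentiableAt)
    (fun t => (hg t).deriv) 1 0
  have h0 : logTrunc N (0 : A) = 0 := Finset.sum_eq_zero fun k _ => by simp
  simp only [Z, one_smul, zero_smul, NormedSpace.exp_zero, sub_self, h0] at hconst
  exact sub_eq_zero.1 hconst

end NilpotentLogarithm

/-! ### From associative words to nested commutators -/

section AdjointLogarithm

variable {A : Type*} [NormedRing A] [NormedAlgebra ℝ A]

/-- A decreasing multiplicative filtration by subspaces, indexed by `ℤ`, that is everything at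
`-N` and zero above `N`. Negative indices allow for elements that lower the degree. -/
structure IsBoundedFiltration (F : ℤ → Submodule ℝ A) (N : ℕ) : Prop where
  one_mem : 1 ∈ F 0
  mul_mem : ∀ {a b : ℤ} {x y : A}, x ∈ F a → y ∈ F b → x * y ∈ F (a + b)
  eq_bot : ∀ {m : ℤ}, (N : ℤ) < m → F m = ⊥
  eq_top : F (-N) = ⊤
  anti : ∀ {a b : ℤ}, a ≤ b → F b ≤ F a

variable {F : ℤ → Submodule ℝ A} {N : ℕ}

theorem IsBoundedFiltration.isNilFiltration (hF : IsBoundedFiltration F N) :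
    IsNilFiltration (fun k : ℕ => F k) N where
  one_mem := hF.one_mem
  mul_mem hx hy := by
    have := hF.mul_mem hx hy
    exact_mod_cast this
  eq_bot h := hF.eq_bot (by exact_mod_cast h)
  anti h := hF.anti (by exact_mod_cast h)

/-- The operators that raise the filtration degree by at least `k`. -/
def raising (F : ℤ → Submodule ℝ A) (k : ℕ) : Submodule ℝ (A →L[ℝ] A) where
  carrier := {T | ∀ a : ℤ, ∀ y ∈ F a, T y ∈ F (a + k)}
  add_mem' hS hT a y hy := add_mem (hS a y hy) (hT a y hy)
  zero_mem' _ _ _ := zero_mem _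
  smul_mem' c _ hT a y hy := (F _).smul_mem c (hT a y hy)

theorem IsBoundedFiltration.raising (hF : IsBoundedFiltration F N) :
    IsNilFiltration (raising F) (2 * N) where
  one_mem a y hy := by simpa using hy
  mul_mem {a b S T} hS hT c y hy := by
    have := hS _ _ (hT c y hy)
    rw [mul_apply_eq_comp, Nat.cast_add, add_comm (a : ℤ), ← add_assoc]
    exact this
  eq_bot {m} hm := by
    rw [eq_bot_iff]
    intro T hT
    rw [Submodule.mem_bot]
    ext y
    have h := hT (-N) y (by rw [hF.eq_top]; trivial)
    rw [hF.eq_bot (by omega)] at h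
    simpa using h
  anti {a b} hab T hT c y hy := hF.anti (by omega) (hT c y hy)

theorem IsBoundedFiltration.adCLM_mem (hF : IsBoundedFiltration F N) {X : A} (hX : X ∈ F 1) :
    adCLM X ∈ BCHTruncation.raising F 1 := by
  intro a y hy
  rw [adCLM_apply, Ring.lie_def]
  refine sub_mem ?_ (hF.mul_mem hy hX)
  rw [Nat.cast_one, add_comm]
  exact hF.mul_mem hX hy

variable [CompleteSpace A]

/-- A product of the `e^{ad X_v}` is conjugation by the product of the `e^{X_v}`; `W` is the
inverse of the latter. -/
theorem prod_exp_adCLM_apply {ι : Type*} (X : ι → A) (l : List ι) :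
    ∃ W : A, (l.map fun v => NormedSpace.exp (X v)).prod * W = 1 ∧
      ∀ y, (l.map fun v => NormedSpace.exp (adCLM (X v))).prod y =
        (l.map fun v => NormedSpace.exp (X v)).prod * y * W := by
  induction l with
  | nil => exact ⟨1, by simp, by simp⟩
  | cons v l ih =>
    obtain ⟨W, h1, h2⟩ := ih
    refine ⟨W * NormedSpace.exp (-X v), ?_, fun y => ?_⟩
    · rw [List.map_cons, List.prod_cons, mul_assoc, ← mul_assoc _ W, h1, one_mul, exp_mul_exp_neg]
    · rw [List.map_cons, List.map_cons, List.prod_cons, List.prod_cons, mul_apply_eq_comp, h2,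
        exp_adCLM_apply]
      simp only [mul_assoc]

/-- The logarithm `P` of `e^{X_M} ⋯ e^{X_1}` satisfies `ad P = log (e^{ad X_M} ⋯ e^{ad X_1})`, to
which the associative BCH formula applies in the algebra of operators. Evaluated at an element `y`
it expresses `[P, y]` through iterated commutators. -/
theorem IsBoundedFiltration.exists_log {M : ℕ} (hF : IsBoundedFiltration F N) {X : Fin M → A}
    (hX : ∀ v, X v ∈ F 1) :
    ∃ P ∈ F 1, NormedSpace.exp P =
        ((List.finRange M).reverse.map fun v => NormedSpace.exp (X v)).prod ∧
      ∀ y, ⁅P, y⁆ = ∑ q ∈ Finset.Icc 1 (2 * N), ∑ w : Fin q → Fin M,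
        (q * wordCoeff w) • (List.ofFn fun i => adCLM (X (w i))).prod y := by
  have hJ := hF.isNilFiltration
  set U := ((List.finRange M).reverse.map fun v => NormedSpace.exp (X v)).prod with hU
  have hU1 : U - 1 ∈ F 1 := by
    have : ∀ l : List (Fin M), (l.map fun v => NormedSpace.exp (X v)).prod - 1 ∈ F 1 := by
      intro l
      induction l with
      | nil => simp
      | cons v l ih =>
        rw [List.map_cons, List.prod_cons]
        set V := (l.map fun v => NormedSpace.exp (X v)).prod
        have h1 : NormedSpace.exp (X v) - 1 ∈ F 1 := hJ.exp_sub_one_mem (by exact_mod_cast hX v)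
        have h2 : NormedSpace.exp (X v) * V - 1 =
            (NormedSpace.exp (X v) - 1) * (V - 1) + (NormedSpace.exp (X v) - 1) + (V - 1) := by
          noncomm_ring
        rw [h2]
        exact add_mem (add_mem (hF.anti (by norm_num) (hF.mul_mem h1 ih)) h1) ih
    exact this _
  have hP : NormedSpace.exp (logTrunc N (U - 1)) = U := by
    rw [hJ.exp_logTrunc (by exact_mod_cast hU1), add_sub_cancel]
  have hP1 : logTrunc N (U - 1) ∈ F 1 := by
    exact_mod_cast hJ.logTrunc_mem (by exact_mod_cast hU1) N
  refine ⟨logTrunc N (U - 1), hP1, hP, fun y => ?_⟩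
  set P := logTrunc N (U - 1)
  -- conjugation by `exp P` is the exponential of `ad P`
  have hexp : NormedSpace.exp (adCLM P) =
      ((List.finRange M).reverse.map fun v => NormedSpace.exp (adCLM (X v))).prod := by
    obtain ⟨W, hW, h⟩ := prod_exp_adCLM_apply X (List.finRange M).reverse
    ext y
    rw [h, exp_adCLM_apply, hP]
    congr 1
    rw [← hU, ← hP] at hW
    rw [← mul_one (NormedSpace.exp (-P)), ← hW, ← mul_assoc, exp_neg_mul_exp, one_mul]
  have h1 := hF.raising.logTrunc_exp_sub_one (hF.adCLM_mem hP1)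
  rw [hexp, hF.raising.logTrunc_prod_exp (fun v => hF.adCLM_mem (hX v))] at h1
  rw [← adCLM_apply, ← h1]
  simp

end AdjointLogarithm

/-! ### Graded matrices -/

section ShiftMatrix

variable {E : Type*} [Ring E] {N : ℕ}

/-- The matrix with entry `a` on the `q`-th diagonal below the main one, and zero elsewhere: the
element `a z ^ q` of `E[z] / z ^ (N + 1)`, acting on powers of `z`. -/
def shiftMat (N q : ℕ) (a : E) : Matrix (Fin (N + 1)) (Fin (N + 1)) E :=
  Matrix.of fun i j => if (i : ℕ) = j + q then a else 0

theorem shiftMat_apply (q : ℕ) (a : E) (i j : Fin (N + 1)) :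
    shiftMat N q a i j = if (i : ℕ) = j + q then a else 0 := rfl

theorem shiftMat_mul (p q : ℕ) (a b : E) :
    shiftMat N p a * shiftMat N q b = shiftMat N (p + q) (a * b) := by
  ext i j
  rw [Matrix.mul_apply]
  simp only [shiftMat_apply]
  by_cases h : (i : ℕ) = j + (p + q)
  · have hlt : (j : ℕ) + q < N + 1 := by omega
    rw [if_pos h, Finset.sum_eq_single (⟨j + q, hlt⟩ : Fin (N + 1))]
    · rw [if_pos (by simp only; omega), if_pos rfl]
    · intro k _ hk
      rw [if_neg (c := (k : ℕ) = j + q) (fun h' => hk (Fin.ext h')), mul_zero]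
    · simp
  · rw [if_neg h]
    refine Finset.sum_eq_zero fun k _ => ?_
    split_ifs
    · omega
    · simp
    · simp
    · simp

theorem shiftMat_sub (q : ℕ) (a b : E) :
    shiftMat N q (a - b) = shiftMat N q a - shiftMat N q b := by
  ext i j
  simp only [shiftMat_apply, Matrix.sub_apply]
  split_ifs <;> simp

theorem shiftMat_lie (p q : ℕ) (a b : E) :
    ⁅shiftMat N p a, shiftMat N q b⁆ = shiftMat N (p + q) ⁅a, b⁆ := by
  rw [Ring.lie_def, Ring.lie_def, shiftMat_mul, shiftMat_mul, add_comm q p, shiftMat_sub]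

/-- `shiftMat` as a linear map. -/
def shiftLin [Module ℝ E] (N q : ℕ) : E →ₗ[ℝ] Matrix (Fin (N + 1)) (Fin (N + 1)) E where
  toFun := shiftMat N q
  map_add' a b := by
    ext i j
    simp only [shiftMat_apply, Matrix.add_apply]
    split_ifs <;> simp
  map_smul' c a := by
    ext i j
    simp only [shiftMat_apply, Matrix.smul_apply, RingHom.id_apply]
    split_ifs <;> simp

/-- The grading derivation as a matrix: the commutator with it multiplies the `q`-th diagonal
by `q`. -/
def gradingMat (N : ℕ) (E : Type*) [Ring E] : Matrix (Fin (N + 1)) (Fin (N + 1)) E :=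
  Matrix.diagonal fun i => -((i : ℕ) : E)

theorem lie_gradingMat_apply (Z : Matrix (Fin (N + 1)) (Fin (N + 1)) E) (i j : Fin (N + 1)) :
    ⁅Z, gradingMat N E⁆ i j = (((i : ℕ) : ℤ) - (j : ℕ)) • Z i j := by
  rw [Ring.lie_def, Matrix.sub_apply, gradingMat, Matrix.mul_diagonal, Matrix.diagonal_mul,
    sub_smul, natCast_zsmul, natCast_zsmul, nsmul_eq_mul, nsmul_eq_mul, neg_mul, mul_neg,
    Nat.cast_comm (j : ℕ)]
  abel

theorem lie_shiftMat_gradingMat (q : ℕ) (a : E) :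
    ⁅shiftMat N q a, gradingMat N E⁆ = shiftMat N q (q • a) := by
  ext i j
  rw [lie_gradingMat_apply]
  simp only [shiftMat_apply]
  split_ifs with h
  · rw [h, Nat.cast_add, add_sub_cancel_left, natCast_zsmul]
  · simp

end ShiftMatrix

/-! ### The BCH formula modulo degree `N + 1` -/

section BCHInMatrices

variable {E : Type*} [NormedRing E] [NormedAlgebra ℝ E] {N M : ℕ}

attribute [local instance] Matrix.linftyOpNormedRing Matrix.linftyOpNormedAlgebra

theorem completeSpace_matrix [FiniteDimensional ℝ E] :
    CompleteSpace (Matrix (Fin (N + 1)) (Fin (N + 1)) E) :=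
  FiniteDimensional.complete ℝ _

/-- The matrices supported on the diagonals with index at least `k`, where lower diagonals have
positive index. -/
def lowerFiltration (N : ℕ) (E : Type*) [Ring E] [Module ℝ E] (k : ℤ) :
    Submodule ℝ (Matrix (Fin (N + 1)) (Fin (N + 1)) E) where
  carrier := {Z | ∀ i j : Fin (N + 1), ((i : ℕ) : ℤ) < (j : ℕ) + k → Z i j = 0}
  add_mem' hY hZ i j h := by rw [Matrix.add_apply, hY i j h, hZ i j h, add_zero]
  zero_mem' _ _ _ := rfl
  smul_mem' c _ hZ i j h := by rw [Matrix.smul_apply, hZ i j h, smul_zero]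

theorem isBoundedFiltration_lowerFiltration :
    IsBoundedFiltration (lowerFiltration N E) N where
  one_mem i j h := Matrix.one_apply_ne fun hij => by subst hij; omega
  mul_mem {a b Y Z} hY hZ i j h := by
    rw [Matrix.mul_apply]
    refine Finset.sum_eq_zero fun k _ => ?_
    by_cases hk : ((i : ℕ) : ℤ) < (k : ℕ) + a
    · rw [hY i k hk, zero_mul]
    · rw [hZ k j (by omega), mul_zero]
  eq_bot {m} hm := by
    rw [eq_bot_iff]
    intro Z hZ
    rw [Submodule.mem_bot]
    ext i j
    exact hZ i j (by omega)
  eq_top := by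
    rw [eq_top_iff]
    intro Z _ i j h
    omega
  anti {a b} hab Z hZ i j h := hZ i j (by omega)

theorem shiftMat_mem (q : ℕ) (a : E) : shiftMat N q a ∈ lowerFiltration N E q := by
  intro i j h
  rw [shiftMat_apply, if_neg (by omega)]

/-- The `q`-th BCH polynomial of `e^{L_M} ⋯ e^{L_1}`, collected by words. -/
def bchWord (L : Fin M → E) (q : ℕ) : E :=
  ∑ w : Fin q → Fin M, wordCoeff w • nestedComm (List.ofFn fun i => L (w i))

theorem prod_adCLM_shiftMat (l : List E) (hl : l ≠ []) :
    (l.map fun a => adCLM (shiftMat N 1 a)).prod (gradingMat N E) =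
      shiftMat N l.length (nestedComm l) := by
  induction l with
  | nil => exact absurd rfl hl
  | cons a l ih =>
    cases l with
    | nil => simp [lie_shiftMat_gradingMat, nestedComm]
    | cons b l =>
      rw [List.map_cons, List.prod_cons, mul_apply_eq_comp, ih (by simp), adCLM_apply, shiftMat_lie,
        nestedComm, List.length_cons (a := a), add_comm 1 (b :: l).length]

/-- The Baker–Campbell–Hausdorff formula, with a formal parameter of nilpotency order `N + 1`.
The commutator of the logarithm with the grading matrix multiplies its part of degree `q` by `q`;
the iterated commutators of the `z L_v` with the grading matrix are the nested commutators. -/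
theorem exp_sum_shiftMat_bchWord [FiniteDimensional ℝ E] (L : Fin M → E) :
    NormedSpace.exp (∑ q ∈ Finset.Icc 1 N, shiftMat N q (bchWord L q)) =
      ((List.finRange M).reverse.map fun v => NormedSpace.exp (shiftMat N 1 (L v))).prod := by
  have := completeSpace_matrix (E := E) (N := N)
  obtain ⟨P, hP1, hP, h⟩ := (isBoundedFiltration_lowerFiltration (N := N) (E := E)).exists_log
    (X := fun v => shiftMat N 1 (L v)) (fun v => by exact_mod_cast shiftMat_mem 1 (L v))
  refine (congrArg _ ?_).trans hP
  specialize h (gradingMat N E)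
  have h1 : ∀ q ∈ Finset.Icc 1 (2 * N), ∑ w : Fin q → Fin M, (q * wordCoeff w) •
      (List.ofFn fun i => adCLM (shiftMat N 1 (L (w i)))).prod (gradingMat N E) =
      shiftMat N q (q • bchWord L q) := by
    intro q hq
    have hq1 := (Finset.mem_Icc.1 hq).1
    rw [bchWord, Finset.smul_sum]
    change _ = shiftLin N q _
    rw [map_sum]
    refine Finset.sum_congr rfl fun w _ => ?_
    have h2 := prod_adCLM_shiftMat (N := N) (List.ofFn fun i => L (w i)) (by
      intro h0
      have := congrArg List.length h0
      simp at this
      omega)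
    rw [List.map_ofFn, List.length_ofFn] at h2
    rw [← Nat.cast_smul_eq_nsmul ℝ, smul_smul, map_smul]
    exact congrArg _ h2
  rw [Finset.sum_congr rfl h1] at h
  ext i j
  rw [Matrix.sum_apply]
  simp only [shiftMat_apply]
  -- on the diagonal with index `r`, the commutator with the grading matrix is multiplication by
  -- `r`, which can be cancelled for `r ≠ 0`
  by_cases hij : (i : ℕ) ≤ j
  · rw [hP1 i j (by omega)]
    refine Finset.sum_eq_zero fun q hq => if_neg ?_
    have := (Finset.mem_Icc.1 hq).1
    omega
  · obtain ⟨r, hr⟩ := Nat.exists_eq_add_of_le (Nat.le_of_not_le hij)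
    have h2 := congrFun (congrFun h i) j
    rw [lie_gradingMat_apply, Matrix.sum_apply, Finset.sum_eq_single r] at h2
    · rw [shiftMat_apply, if_pos hr, hr, Nat.cast_add, add_sub_cancel_left, natCast_zsmul] at h2
      rw [Finset.sum_eq_single r]
      · rw [if_pos hr]
        have hr0 : (r : ℝ) ≠ 0 := by
          have : r ≠ 0 := by omega
          exact_mod_cast this
        rw [← Nat.cast_smul_eq_nsmul ℝ, ← Nat.cast_smul_eq_nsmul ℝ] at h2
        exact (smul_right_injective E hr0 h2).symm
      · intro q _ hq
        exact if_neg fun h => hq (by omega)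
      · intro hr'
        exact absurd (Finset.mem_Icc.2 (by omega)) hr'
    · intro q _ hq
      rw [shiftMat_apply, if_neg fun h => hq (by omega)]
    · intro hr'
      exact absurd (Finset.mem_Icc.2 (by omega)) hr'

end BCHInMatrices

/-! ### Nested commutators are multilinear -/

section NestedMultilinear

variable {E : Type*} [Ring E]

theorem nestedComm_shiftMat {N d : ℕ} (q : Fin (d + 1) → ℕ) (a : Fin (d + 1) → E) :
    nestedComm (List.ofFn fun i => shiftMat N (q i) (a i)) =
      shiftMat N (∑ i, q i) (nestedComm (List.ofFn a)) := by
  induction d with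
  | zero => simp [nestedComm]
  | succ d ih =>
    have h1 : ∀ {B : Type _} [Ring B] (f : Fin (d + 1 + 1) → B), nestedComm (List.ofFn f) =
        ⁅f 0, nestedComm (List.ofFn fun i => f i.succ)⁆ := by
      intro B _ f
      rw [List.ofFn_succ, List.ofFn_succ]
      rfl
    rw [h1, ih, shiftMat_lie, Fin.sum_univ_succ q, h1 a]

variable [Algebra ℝ E]

/-- The affine action `y ↦ [a, y] + a`, made linear on `E × ℝ`. The product of these operators
along a list, applied to `(0, 1)`, is the nested commutator. -/
def affineAd (E : Type*) [Ring E] [Algebra ℝ E] : E →ₗ[ℝ] Module.End ℝ (E × ℝ) :=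
  LinearMap.mk₂ ℝ (fun a (x : E × ℝ) => (⁅a, x.1⁆ + x.2 • a, (0 : ℝ)))
    (fun a b x => by simp [Ring.lie_def, add_mul, mul_add, smul_add]; abel)
    (fun c a x => by simp [Ring.lie_def, smul_sub, smul_comm c])
    (fun a x y => by simp [Ring.lie_def, add_mul, mul_add, add_smul]; abel)
    (fun c a x => by simp [Ring.lie_def, smul_sub, mul_smul])

theorem affineAd_apply (a : E) (x : E × ℝ) : affineAd E a x = (⁅a, x.1⁆ + x.2 • a, 0) := rfl

theorem nestedComm_eq_affineAd (l : List E) :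
    nestedComm l = ((l.map (affineAd E)).prod (0, 1)).1 := by
  have h : ∀ a : E, ∀ l : List E,
      ((a :: l).map (affineAd E)).prod (0, 1) = (nestedComm (a :: l), 0) := by
    intro a l
    induction l generalizing a with
    | nil => simp [affineAd_apply, nestedComm, Ring.lie_def]
    | cons b l ih =>
      rw [List.map_cons, List.prod_cons, Module.End.mul_apply, ih, affineAd_apply, nestedComm]
      simp
  cases l with
  | nil => simp [nestedComm]
  | cons a l => rw [h]

/-- The nested commutator of `d` elements as a multilinear map. -/
def nestedMultilinear (E : Type*) [Ring E] [Algebra ℝ E] (d : ℕ) :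
    MultilinearMap ℝ (fun _ : Fin d => E) E :=
  ((LinearMap.fst ℝ E ℝ).comp (LinearMap.applyₗ (0, 1))).compMultilinearMap
    ((MultilinearMap.mkPiAlgebraFin ℝ d (Module.End ℝ (E × ℝ))).compLinearMap fun _ => affineAd E)

theorem nestedMultilinear_apply {d : ℕ} (m : Fin d → E) :
    nestedMultilinear E d m = nestedComm (List.ofFn m) := by
  rw [nestedComm_eq_affineAd, List.map_ofFn]
  rfl

theorem nestedComm_ofFn_sum {d : ℕ} {ι : Fin d → Type*} (s : (i : Fin d) → Finset (ι i))
    (g : (i : Fin d) → ι i → E) :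
    nestedComm (List.ofFn fun i => ∑ j ∈ s i, g i j) =
      ∑ r ∈ Fintype.piFinset s, nestedComm (List.ofFn fun i => g i (r i)) := by
  simp only [← nestedMultilinear_apply]
  exact MultilinearMap.map_sum_finset _ _ _

theorem nestedComm_ofFn_smul {d : ℕ} (c : Fin d → ℝ) (m : Fin d → E) :
    nestedComm (List.ofFn fun i => c i • m i) = (∏ i, c i) • nestedComm (List.ofFn m) := by
  simp only [← nestedMultilinear_apply]
  exact MultilinearMap.map_smul_univ _ _ _

/-- The sequence `X, …, X, Y` of length `k + 1`. -/
def lastOr {V : Type*} {k : ℕ} (X Y : V) (i : Fin (k + 1)) : V := if i = Fin.last k then Y else X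

theorem nestedComm_lastOr_succ {B : Type*} [Ring B] {k : ℕ} (X Y : B) :
    nestedComm (List.ofFn (lastOr (k := k + 1) X Y)) =
      ⁅X, nestedComm (List.ofFn (lastOr (k := k) X Y))⁆ := by
  have h0 : lastOr (k := k + 1) X Y 0 = X := if_neg (by simp [Fin.ext_iff])
  have hs : (fun i : Fin (k + 1) => lastOr (k := k + 1) X Y i.succ) = lastOr X Y := by
    funext i
    simp only [lastOr, ← Fin.succ_last, Fin.succ_inj]
  rw [List.ofFn_succ, h0, hs, List.ofFn_succ]
  rfl

end NestedMultilinear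

/-! ### The generator of a path of exponentials -/

section Generator

theorem adCLM_pow_apply {A : Type*} [NormedRing A] [NormedAlgebra ℝ A] (X Y : A) (k : ℕ) :
    ((adCLM X) ^ k) Y = nestedComm (List.ofFn (lastOr (k := k) X Y)) := by
  induction k with
  | zero => simp [nestedComm, lastOr]
  | succ k ih => rw [pow_succ', mul_apply_eq_comp, ih, adCLM_apply, nestedComm_lastOr_succ]

/-- If `exp (Φ s) = exp (s Y) C`, then the logarithmic derivative of `exp ∘ Φ` is `Y`. -/
theorem hasSum_adCLM_of_exp_eq {A : Type*} [NormedRing A] [NormedAlgebra ℝ A] [CompleteSpace A]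
    {Φ : ℝ → A} {Φ' Y C : A} {s : ℝ} (hΦ : HasDerivAt Φ Φ' s)
    (hexp : ∀ s, NormedSpace.exp (Φ s) = NormedSpace.exp (s • Y) * C) :
    HasSum (fun k : ℕ => (1 / ((k + 1)! : ℝ)) • ((adCLM (Φ s)) ^ k) Φ') Y := by
  have h1 := hasDerivAt_exp_comp hΦ
  have h2 : HasDerivAt (fun s => NormedSpace.exp (Φ s)) (Y * NormedSpace.exp (Φ s)) s := by
    have h3 := (hasDerivAt_exp_smul_const' (𝕂 := ℝ) Y s).mul_const C
    rw [mul_assoc, ← hexp s] at h3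
    exact h3.congr_of_eventuallyEq (Filter.Eventually.of_forall hexp)
  have h4 := congrArg (· * NormedSpace.exp (-Φ s)) (h1.unique h2)
  simp only [mul_assoc, exp_mul_exp_neg, mul_one] at h4
  have h5 := hasSum_adCLM_integral (Φ s) Φ'
  rwa [← h5.tsum_eq, h4] at h5

theorem nestedComm_lastOr_sum {E : Type*} [Ring E] [Algebra ℝ E] (S : Finset ℕ) (f g : ℕ → E)
    (k : ℕ) :
    nestedComm (List.ofFn (lastOr (k := k) (∑ q ∈ S, f q) (∑ q ∈ S, g q))) =
      ∑ r ∈ Fintype.piFinset fun _ : Fin (k + 1) => S,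
        nestedComm (List.ofFn fun i => lastOr f g i (r i)) := by
  rw [← nestedComm_ofFn_sum]
  congr 2
  funext i
  simp only [lastOr]
  split_ifs <;> rfl

/-- The sum of the entries of the column `0`. It evaluates `∑ a_q z ^ q` at `z = 1`. -/
def columnSum (N : ℕ) (E : Type*) [Ring E] [Algebra ℝ E] :
    Matrix (Fin (N + 1)) (Fin (N + 1)) E →ₗ[ℝ] E where
  toFun Z := ∑ i, Z i 0
  map_add' Y Z := by simp [Finset.sum_add_distrib]
  map_smul' c Z := by simp [Finset.smul_sum]

theorem columnSum_shiftMat {E : Type*} [Ring E] [Algebra ℝ E] {N : ℕ} (q : ℕ) (a : E) :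
    columnSum N E (shiftMat N q a) = if q ≤ N then a else 0 := by
  change ∑ i, shiftMat N q a i 0 = _
  simp only [shiftMat_apply, Fin.val_zero, zero_add]
  split_ifs with h
  · rw [Finset.sum_eq_single (⟨q, Nat.lt_succ_of_le h⟩ : Fin (N + 1))]
    · simp
    · intro i _ hi
      exact if_neg fun h' => hi (Fin.ext h')
    · simp
  · exact Finset.sum_eq_zero fun i _ => if_neg (by omega)

variable {E : Type*} [NormedRing E] [NormedAlgebra ℝ E] [FiniteDimensional ℝ E] {N : ℕ}

attribute [local instance] Matrix.linftyOpNormedRing Matrix.linftyOpNormedAlgebra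

/-- The commutators of total degree at most `N` in the logarithmic derivative of
`exp (∑ f_q)` add up to `X`, since they are the ones that survive in the nilpotent matrices. -/
theorem hasSum_low_grades (hN : 1 ≤ N) {f : ℝ → ℕ → E} {f' : ℕ → E} {s : ℝ} {X : E}
    {C : Matrix (Fin (N + 1)) (Fin (N + 1)) E}
    (hf : ∀ q, HasDerivAt (fun s => f s q) (f' q) s)
    (hexp : ∀ s, NormedSpace.exp (∑ q ∈ Finset.Icc 1 N, shiftMat N q (f s q)) =
      NormedSpace.exp (s • shiftMat N 1 X) * C) :
    HasSum (fun k : ℕ => (1 / ((k + 1)! : ℝ)) •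
      ∑ r ∈ (Fintype.piFinset fun _ : Fin (k + 1) => Finset.Icc 1 N).filter fun r => ∑ i, r i ≤ N,
        nestedComm (List.ofFn fun i => lastOr (f s) f' i (r i))) X := by
  have hcomplete := completeSpace_matrix (E := E) (N := N)
  -- a commutator of total degree above `N` is a zero matrix, all others are evaluated at `z = 1`
  let col : Matrix (Fin (N + 1)) (Fin (N + 1)) E →L[ℝ] E :=
    LinearMap.toContinuousLinearMap (columnSum N E)
  let Φ : ℝ → Matrix (Fin (N + 1)) (Fin (N + 1)) E := fun s =>
    ∑ q ∈ Finset.Icc 1 N, shiftMat N q (f s q)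
  let Φ' : Matrix (Fin (N + 1)) (Fin (N + 1)) E := ∑ q ∈ Finset.Icc 1 N, shiftMat N q (f' q)
  have hΦ : HasDerivAt Φ Φ' s := by
    refine HasDerivAt.fun_sum fun q _ => ?_
    exact (LinearMap.toContinuousLinearMap (shiftLin (E := E) N q)).hasFDerivAt.comp_hasDerivAt s
      (hf q)
  have h5 := hasSum_adCLM_of_exp_eq hΦ hexp
  have h6 := h5.mapL col
  have h7 : col (shiftMat N 1 X) = X := by
    change columnSum N E _ = X
    rw [columnSum_shiftMat, if_pos hN]
  rw [h7] at h6
  convert h6 using 2 with k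
  rw [map_smul, adCLM_pow_apply, nestedComm_lastOr_sum, map_sum, Finset.sum_filter]
  congr 1
  refine Finset.sum_congr rfl fun r _ => ?_
  have h8 : (fun i : Fin (k + 1) => lastOr (fun q => shiftMat N q (f s q))
      (fun q => shiftMat N q (f' q)) i (r i)) =
      fun i => shiftMat N (r i) (lastOr (f s) f' i (r i)) := by
    funext i
    simp only [lastOr]
    split_ifs <;> rfl
  rw [h8, nestedComm_shiftMat]
  exact (columnSum_shiftMat _ _).symm

/-- In the logarithmic derivative of `exp (∑ f_q)`, only commutators of total degree above `N`
deviate from `X`. No convergence of the BCH series enters: the number of grades is finite, and the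
sum over the length of the commutators is that of an exponential series. -/
theorem hasSum_high_grades (hN : 1 ≤ N) {f : ℝ → ℕ → E} {f' : ℕ → E} {s : ℝ} {X : E}
    {C : Matrix (Fin (N + 1)) (Fin (N + 1)) E}
    (hf : ∀ q, HasDerivAt (fun s => f s q) (f' q) s)
    (hexp : ∀ s, NormedSpace.exp (∑ q ∈ Finset.Icc 1 N, shiftMat N q (f s q)) =
      NormedSpace.exp (s • shiftMat N 1 X) * C) :
    HasSum (fun k : ℕ => (1 / ((k + 1)! : ℝ)) • ∑ r ∈ gradeTuples N (k + 1),
        nestedComm (List.ofFn fun i => lastOr (f s) f' i (r i)))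
      ((∫ r in (0 : ℝ)..1, NormedSpace.exp (r • ∑ q ∈ Finset.Icc 1 N, f s q) *
        (∑ q ∈ Finset.Icc 1 N, f' q) *
        NormedSpace.exp (-(r • ∑ q ∈ Finset.Icc 1 N, f s q))) - X) := by
  have : CompleteSpace E := FiniteDimensional.complete ℝ E
  have h1 := (hasSum_adCLM_integral (∑ q ∈ Finset.Icc 1 N, f s q)
    (∑ q ∈ Finset.Icc 1 N, f' q)).sub (hasSum_low_grades hN hf hexp)
  have e : ∀ k : ℕ, (1 / ((k + 1)! : ℝ)) • ∑ r ∈ gradeTuples N (k + 1),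
        nestedComm (List.ofFn fun i => lastOr (f s) f' i (r i)) =
      (1 / ((k + 1)! : ℝ)) • ((adCLM (∑ q ∈ Finset.Icc 1 N, f s q)) ^ k)
          (∑ q ∈ Finset.Icc 1 N, f' q) -
        (1 / ((k + 1)! : ℝ)) •
          ∑ r ∈ (Fintype.piFinset fun _ : Fin (k + 1) => Finset.Icc 1 N).filter
            fun r => ∑ i, r i ≤ N, nestedComm (List.ofFn fun i => lastOr (f s) f' i (r i)) := by
    intro k
    rw [← smul_sub, adCLM_pow_apply, nestedComm_lastOr_sum, gradeTuples]
    congr 1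
    rw [← Finset.sum_filter_add_sum_filter_not
        (Fintype.piFinset fun _ : Fin (k + 1) => Finset.Icc 1 N) (fun r => ∑ i, r i ≤ N),
      add_sub_cancel_left]
    refine Finset.sum_congr (Finset.filter_congr fun r _ => ?_) fun _ _ => rfl
    omega
  simp only [e]
  exact h1

end Generator

/-! ### Switching the factors on one at a time -/

section WeightedCommutators

/-- The weights `1, …, 1, s, 0, …, 0`, with `s` in place `k`: the first `k` factors are switched on
and the next one is being switched on. -/
def stageWeight {M : ℕ} (k : ℕ) (s : ℝ) (v : Fin M) : ℝ :=
  if (v : ℕ) < k then 1 else if (v : ℕ) = k then s else 0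

theorem stageWeight_one {M : ℕ} (k : ℕ) :
    (stageWeight k 1 : Fin M → ℝ) = stageWeight (k + 1) 0 := by
  funext v
  simp only [stageWeight]
  split_ifs <;> first | rfl | omega

theorem stageWeight_of_le {M : ℕ} {k : ℕ} (h : M ≤ k) (s : ℝ) :
    (stageWeight k s : Fin M → ℝ) = 1 := by
  funext v
  exact if_pos (by omega)

theorem stageWeight_nonneg {M : ℕ} (k : ℕ) {s : ℝ} (hs : 0 ≤ s) (v : Fin M) :
    0 ≤ stageWeight k s v := by
  unfold stageWeight
  split_ifs <;> simp [hs]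

theorem stageWeight_le_one {M : ℕ} (k : ℕ) {s : ℝ} (hs : s ≤ 1) (v : Fin M) :
    stageWeight k s v ≤ 1 := by
  unfold stageWeight
  split_ifs <;> simp [hs]

theorem hasDerivAt_stageWeight {M : ℕ} (k : ℕ) (s : ℝ) (v : Fin M) :
    HasDerivAt (fun s => stageWeight k s v) (if (v : ℕ) = k then 1 else 0) s := by
  unfold stageWeight
  by_cases h1 : (v : ℕ) < k
  · simp only [if_pos h1, if_neg h1.ne]
    exact hasDerivAt_const _ _
  · by_cases h2 : (v : ℕ) = k
    · simp only [if_neg h1, if_pos h2]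
      exact hasDerivAt_id' s
    · simp only [if_neg h1, if_neg h2]
      exact hasDerivAt_const _ _

variable {M : ℕ}

/-- The product of the weights of the letters of a word. -/
def wordWeight {q : ℕ} (k : ℕ) (w : Fin q → Fin M) (s : ℝ) : ℝ := ∏ i, stageWeight k s (w i)

/-- The derivative of `wordWeight` in `s`. -/
def wordWeightDeriv {q : ℕ} (k : ℕ) (w : Fin q → Fin M) (s : ℝ) : ℝ :=
  ∑ i, (∏ j ∈ Finset.univ.erase i, stageWeight k s (w j)) * if (w i : ℕ) = k then 1 else 0

theorem hasDerivAt_wordWeight {q : ℕ} (k : ℕ) (w : Fin q → Fin M) (s : ℝ) :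
    HasDerivAt (wordWeight k w) (wordWeightDeriv k w s) s :=
  HasDerivAt.fun_finsetProd fun i _ => hasDerivAt_stageWeight k s (w i)

theorem wordWeight_nonneg {q : ℕ} (k : ℕ) (w : Fin q → Fin M) {s : ℝ} (hs : 0 ≤ s) :
    0 ≤ wordWeight k w s :=
  Finset.prod_nonneg fun i _ => stageWeight_nonneg k hs (w i)

theorem wordWeightDeriv_nonneg {q : ℕ} (k : ℕ) (w : Fin q → Fin M) {s : ℝ} (hs : 0 ≤ s) :
    0 ≤ wordWeightDeriv k w s :=
  Finset.sum_nonneg fun i _ => mul_nonneg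
    (Finset.prod_nonneg fun j _ => stageWeight_nonneg k hs (w j)) (by split_ifs <;> simp)

theorem continuous_stageWeight (k : ℕ) (v : Fin M) : Continuous fun s => stageWeight k s v :=
  continuous_iff_continuousAt.2 fun s => (hasDerivAt_stageWeight k s v).continuousAt

theorem continuous_wordWeight {q : ℕ} (k : ℕ) (w : Fin q → Fin M) :
    Continuous (wordWeight k w) :=
  continuous_finsetProd _ fun i _ => continuous_stageWeight k (w i)

theorem continuous_wordWeightDeriv {q : ℕ} (k : ℕ) (w : Fin q → Fin M) :
    Continuous (wordWeightDeriv k w) :=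
  continuous_finsetSum _ fun _ _ => (continuous_finsetProd _ fun j _ =>
    continuous_stageWeight k (w j)).mul continuous_const

variable {E : Type*} [NormedRing E]

/-- The `d`-th term of the commutator series for the weighted generators
`stageWeight k s v • L v`. -/
def weightedAlpha (L : Fin M → E) (N k d : ℕ) (s : ℝ) : ℝ :=
  1 / (d ! : ℝ) * ∑ q ∈ gradeTuples N d, ∑ v : (i : Fin d) → Fin (q i) → Fin M,
    (∏ i, wordWeight k (v i) s) *
      ‖nestedComm (List.ofFn fun i => nestedComm (List.ofFn fun j => L (v i j)))‖

/-- The derivative of `weightedAlpha` in `s`. -/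
def weightedAlphaDeriv (L : Fin M → E) (N k d : ℕ) (s : ℝ) : ℝ :=
  1 / (d ! : ℝ) * ∑ q ∈ gradeTuples N d, ∑ v : (i : Fin d) → Fin (q i) → Fin M,
    (∑ i, (∏ j ∈ Finset.univ.erase i, wordWeight k (v j) s) * wordWeightDeriv k (v i) s) *
      ‖nestedComm (List.ofFn fun i => nestedComm (List.ofFn fun j => L (v i j)))‖

theorem hasDerivAt_weightedAlpha (L : Fin M → E) (N k d : ℕ) (s : ℝ) :
    HasDerivAt (weightedAlpha L N k d) (weightedAlphaDeriv L N k d s) s :=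
  (HasDerivAt.fun_sum fun _ _ => HasDerivAt.fun_sum fun v _ =>
    (HasDerivAt.fun_finsetProd fun i _ => hasDerivAt_wordWeight k (v i) s).mul_const _).const_mul _

theorem continuous_weightedAlphaDeriv (L : Fin M → E) (N k d : ℕ) :
    Continuous (weightedAlphaDeriv L N k d) :=
  continuous_const.mul <| continuous_finsetSum _ fun _ _ => continuous_finsetSum _ fun v _ =>
    (continuous_finsetSum _ fun i _ => (continuous_finsetProd _ fun j _ =>
      continuous_wordWeight k (v j)).mul (continuous_wordWeightDeriv k (v i))).mul continuous_const

theorem weightedAlpha_nonneg (L : Fin M → E) (N k d : ℕ) {s : ℝ} (hs : 0 ≤ s) :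
    0 ≤ weightedAlpha L N k d s :=
  mul_nonneg (by positivity) <| Finset.sum_nonneg fun _ _ => Finset.sum_nonneg fun v _ =>
    mul_nonneg (Finset.prod_nonneg fun i _ => wordWeight_nonneg k (v i) hs) (norm_nonneg _)

theorem weightedAlphaDeriv_nonneg (L : Fin M → E) (N k d : ℕ) {s : ℝ} (hs : 0 ≤ s) :
    0 ≤ weightedAlphaDeriv L N k d s :=
  mul_nonneg (by positivity) <| Finset.sum_nonneg fun _ _ => Finset.sum_nonneg fun v _ =>
    mul_nonneg (Finset.sum_nonneg fun i _ => mul_nonneg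
      (Finset.prod_nonneg fun j _ => wordWeight_nonneg k (v j) hs)
      (wordWeightDeriv_nonneg k (v i) hs)) (norm_nonneg _)

theorem weightedAlpha_one (L : Fin M → E) (N k d : ℕ) :
    weightedAlpha L N k d 1 = weightedAlpha L N (k + 1) d 0 := by
  simp only [weightedAlpha, wordWeight, stageWeight_one]

theorem weightedAlpha_of_le (L : Fin M → E) (N d : ℕ) {k : ℕ} (h : M ≤ k) (s : ℝ) :
    weightedAlpha L N k d s = 1 / (d ! : ℝ) * ∑ q ∈ gradeTuples N d,
      ∑ v : (i : Fin d) → Fin (q i) → Fin M,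
        ‖nestedComm (List.ofFn fun i => nestedComm (List.ofFn fun j => L (v i j)))‖ := by
  simp [weightedAlpha, wordWeight, stageWeight_of_le h]

theorem weightedAlpha_le_of_le (L : Fin M → E) (N d : ℕ) {k k' : ℕ} (h : M ≤ k') {s : ℝ}
    (hs : 0 ≤ s) (hs1 : s ≤ 1) :
    weightedAlpha L N k d s ≤ weightedAlpha L N k' d 0 := by
  rw [weightedAlpha_of_le L N d h, weightedAlpha]
  refine mul_le_mul_of_nonneg_left (Finset.sum_le_sum fun _ _ => Finset.sum_le_sum fun v _ =>
    mul_le_of_le_one_left (norm_nonneg _) ?_) (by positivity)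
  exact Finset.prod_le_one (fun i _ => wordWeight_nonneg k (v i) hs) fun i _ =>
    Finset.prod_le_one (fun j _ => stageWeight_nonneg k hs _) fun j _ => stageWeight_le_one k hs1 _

variable [NormedAlgebra ℝ E]

theorem bchWord_smul (c : Fin M → ℝ) (L : Fin M → E) (q : ℕ) :
    bchWord (fun v => c v • L v) q = ∑ w : Fin q → Fin M,
      (wordCoeff w * ∏ i, c (w i)) • nestedComm (List.ofFn fun i => L (w i)) := by
  refine Finset.sum_congr rfl fun w _ => ?_
  rw [nestedComm_ofFn_smul, smul_smul]

/-- The derivative in `s` of the `q`-th BCH polynomial of the weighted generators. -/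
def bchWordDeriv (k : ℕ) (L : Fin M → E) (s : ℝ) (q : ℕ) : E :=
  ∑ w : Fin q → Fin M,
    (wordCoeff w * wordWeightDeriv k w s) • nestedComm (List.ofFn fun i => L (w i))

theorem bchWord_stage (k : ℕ) (L : Fin M → E) (s : ℝ) (q : ℕ) :
    bchWord (fun v => stageWeight k s v • L v) q = ∑ w : Fin q → Fin M,
      (wordCoeff w * wordWeight k w s) • nestedComm (List.ofFn fun i => L (w i)) :=
  bchWord_smul _ _ _

theorem hasDerivAt_bchWord_stage (k : ℕ) (L : Fin M → E) (s : ℝ) (q : ℕ) :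
    HasDerivAt (fun s => bchWord (fun v => stageWeight k s v • L v) q)
      (bchWordDeriv k L s q) s := by
  simp only [bchWord_stage]
  exact HasDerivAt.fun_sum fun w _ => ((hasDerivAt_wordWeight k w s).const_mul _).smul_const _

theorem continuous_bchWordDeriv (k : ℕ) (L : Fin M → E) (q : ℕ) :
    Continuous fun s => bchWordDeriv k L s q :=
  continuous_finsetSum _ fun w _ =>
    (continuous_const.mul (continuous_wordWeightDeriv k w)).smul continuous_const

/-- The product rule for the weight of a tuple of words has one nonnegative term for each word;
the term for the last word bounds the commutator on the left. -/
theorem norm_nestedComm_stage_le (L : Fin M → E) (k : ℕ) {d : ℕ} (r : Fin (d + 1) → ℕ) {s : ℝ}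
    (hs : 0 ≤ s) :
    ‖nestedComm (List.ofFn fun i => lastOr
        (fun q => bchWord (fun v => stageWeight k s v • L v) q) (bchWordDeriv k L s) i (r i))‖ ≤
      ∑ v : (i : Fin (d + 1)) → Fin (r i) → Fin M,
        (∑ i, (∏ j ∈ Finset.univ.erase i, wordWeight k (v j) s) * wordWeightDeriv k (v i) s) *
          ‖nestedComm (List.ofFn fun i => nestedComm (List.ofFn fun j => L (v i j)))‖ := by
  have h1 : (fun i => lastOr (fun q => bchWord (fun v => stageWeight k s v • L v) q)
      (bchWordDeriv k L s) i (r i)) = fun i => ∑ w ∈ (Finset.univ : Finset (Fin (r i) → Fin M)),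
        (wordCoeff w * if i = Fin.last d then wordWeightDeriv k w s else wordWeight k w s) •
          nestedComm (List.ofFn fun j => L (w j)) := by
    funext i
    by_cases hi : i = Fin.last d
    · simp only [lastOr, if_pos hi, bchWordDeriv]
    · simp only [lastOr, if_neg hi, bchWord_stage]
  rw [h1, nestedComm_ofFn_sum, Fintype.piFinset_univ]
  refine (norm_sum_le _ _).trans (Finset.sum_le_sum fun v _ => ?_)
  rw [nestedComm_ofFn_smul, norm_smul]
  refine mul_le_mul_of_nonneg_right ?_ (norm_nonneg _)
  have h2 : ∀ i, 0 ≤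
      if i = Fin.last d then wordWeightDeriv k (v i) s else wordWeight k (v i) s := by
    intro i
    split_ifs
    · exact wordWeightDeriv_nonneg k (v i) hs
    · exact wordWeight_nonneg k (v i) hs
  calc _ = ∏ i, (|wordCoeff (v i)| *
        if i = Fin.last d then wordWeightDeriv k (v i) s else wordWeight k (v i) s) := by
        rw [Real.norm_eq_abs, Finset.abs_prod]
        exact Finset.prod_congr rfl fun i _ => by rw [abs_mul, abs_of_nonneg (h2 i)]
    _ ≤ ∏ i, if i = Fin.last d then wordWeightDeriv k (v i) s else wordWeight k (v i) s :=
        Finset.prod_le_prod (fun i _ => mul_nonneg (abs_nonneg _) (h2 i)) fun i _ =>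
          mul_le_of_le_one_left (h2 i) (abs_wordCoeff_le_one _)
    _ = (∏ j ∈ Finset.univ.erase (Fin.last d), wordWeight k (v j) s) *
          wordWeightDeriv k (v (Fin.last d)) s := by
        rw [← Finset.prod_erase_mul _ _ (Finset.mem_univ (Fin.last d)), if_pos rfl]
        congr 1
        exact Finset.prod_congr rfl fun i hi => if_neg (Finset.ne_of_mem_erase hi)
    _ ≤ _ := Finset.single_le_sum (f := fun i =>
          (∏ j ∈ Finset.univ.erase i, wordWeight k (v j) s) * wordWeightDeriv k (v i) s)
          (fun i _ => mul_nonneg (Finset.prod_nonneg fun j _ => wordWeight_nonneg k (v j) hs)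
            (wordWeightDeriv_nonneg k (v i) hs)) (Finset.mem_univ _)

end WeightedCommutators

/-! ### Ordered products of the switched factors -/

section OrderedProducts

theorem prod_reverse_finRange_eq_mul {B : Type*} [Monoid B] {M : ℕ} {g h : Fin M → B} {k : Fin M}
    (hlt : ∀ v < k, h v = g v) (hgt : ∀ v, k < v → h v = 1) (hge : ∀ v, k ≤ v → g v = 1) :
    ((List.finRange M).reverse.map h).prod = h k * ((List.finRange M).reverse.map g).prod := by
  induction M with
  | zero => exact k.elim0
  | succ M ih =>
    have e : ∀ f : Fin (M + 1) → B, ((List.finRange (M + 1)).reverse.map f).prod =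
        f (Fin.last M) * ((List.finRange M).reverse.map fun v => f v.castSucc).prod := by
      intro f
      rw [List.finRange_succ_last, List.reverse_append, List.map_append, List.prod_append,
        ← List.map_reverse, List.map_map]
      simp [Function.comp_def]
    rw [e, e, hge _ (Fin.le_last k), one_mul]
    induction k using Fin.lastCases with
    | last =>
      congr 2
      exact List.map_congr_left fun v _ => hlt _ (Fin.castSucc_lt_last v)
    | cast k =>
      rw [hgt _ (Fin.castSucc_lt_last k), one_mul]
      exact ih (g := fun v => g v.castSucc) (h := fun v => h v.castSucc)
        (fun v hv => hlt _ (Fin.castSucc_lt_castSucc_iff.2 hv))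
        (fun v hv => hgt _ (Fin.castSucc_lt_castSucc_iff.2 hv))
        (fun v hv => hge _ (Fin.castSucc_le_castSucc_iff.2 hv))

theorem prod_stage {B : Type*} [Monoid B] {M : ℕ} {h : Fin M → ℝ → B} (h0 : ∀ v, h v 0 = 1)
    (k : Fin M) (s : ℝ) :
    ((List.finRange M).reverse.map fun v => h v (stageWeight k s v)).prod =
      h k s * ((List.finRange M).reverse.map fun v => h v (stageWeight k 0 v)).prod := by
  have hk : stageWeight k s k = s := by simp [stageWeight]
  refine (prod_reverse_finRange_eq_mul (g := fun v => h v (stageWeight k 0 v))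
    (h := fun v => h v (stageWeight k s v)) (k := k) ?_ ?_ ?_).trans (by simp only [hk])
  · intro v hv
    simp [stageWeight, Fin.lt_def.1 hv]
  · intro v hv
    have h1 : ¬ (v : ℕ) < k := by omega
    have h2 : (v : ℕ) ≠ k := by omega
    simp [stageWeight, h1, h2, h0]
  · intro v hv
    have h1 : ¬ (v : ℕ) < k := by omega
    simp [stageWeight, h1, h0]

end OrderedProducts

/-! ### Perturbation of a contraction semigroup -/

section Duhamel

variable {E : Type*} [NormedRing E] [NormedAlgebra ℝ E] [CompleteSpace E]

theorem continuous_exp_of_real : Continuous (NormedSpace.exp : E → E) :=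
  let _ : NormedAlgebra ℚ E := NormedAlgebra.restrictScalars ℚ ℝ E
  NormedSpace.exp_continuous

/-- Grönwall's inequality for `V' = (X + R) V` with `X` generating contractions. The bounds on `V`
and on its distance from the unperturbed flow propagate together. -/
theorem norm_perturbed_flow_le {X U : E} {R V : ℝ → E} {J b : ℝ} (hR : Continuous R)
    (hX : ∀ s : ℝ, 0 ≤ s → ‖NormedSpace.exp (s • X)‖ ≤ 1)
    (hV : ∀ s, HasDerivAt V ((X + R s) * V s) s)
    (hJ : ‖V 0‖ ≤ J) (hU : ‖V 0 - U‖ ≤ J - 1) (hb : ∫ s in (0 : ℝ)..1, ‖R s‖ ≤ b) :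
    ‖V 1‖ ≤ J * Real.exp b ∧ ‖V 1 - NormedSpace.exp X * U‖ ≤ J * Real.exp b - 1 := by
  have hVc : Continuous V := continuous_iff_continuousAt.2 fun s => (hV s).continuousAt
  have hRV : Continuous fun s => ‖R s‖ * ‖V s‖ := hR.norm.mul hVc.norm
  have hJ0 : 0 ≤ J := (norm_nonneg _).trans hJ
  -- variation of constants
  have hduh : ∀ τ : ℝ, 0 ≤ τ →
      ‖V τ - NormedSpace.exp (τ • X) * V 0‖ ≤ ∫ s in (0 : ℝ)..τ, ‖R s‖ * ‖V s‖ := by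
    intro τ hτ
    have hd : ∀ s, HasDerivAt (fun s => NormedSpace.exp ((τ - s) • X) * V s)
        (NormedSpace.exp ((τ - s) • X) * (R s * V s)) s := by
      intro s
      have h1 : HasDerivAt (fun s : ℝ => NormedSpace.exp ((τ - s) • X))
          (-(NormedSpace.exp ((τ - s) • X) * X)) s := by
        have := (hasDerivAt_exp_smul_const (𝕂 := ℝ) X (τ - s)).scomp s
          ((hasDerivAt_id s).const_sub τ)
        simpa [Function.comp_def] using this
      refine (h1.mul (hV s)).congr_deriv ?_
      simp only [add_mul, mul_add, neg_mul, mul_assoc]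
      abel
    have hc : Continuous fun s => NormedSpace.exp ((τ - s) • X) * (R s * V s) :=
      (continuous_exp_of_real.comp (by fun_prop)).mul (hR.mul hVc)
    have h2 := intervalIntegral.integral_eq_sub_of_hasDerivAt (a := 0) (b := τ)
      (fun s _ => hd s) (hc.intervalIntegrable _ _)
    rw [sub_self, zero_smul, NormedSpace.exp_zero, one_mul, sub_zero] at h2
    rw [← h2]
    refine intervalIntegral.norm_integral_le_of_norm_le hτ ?_ (hRV.intervalIntegrable _ _)
    refine Filter.Eventually.of_forall fun s hs => ?_
    calc _ ≤ ‖NormedSpace.exp ((τ - s) • X)‖ * ‖R s * V s‖ := norm_mul_le _ _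
      _ ≤ 1 * (‖R s‖ * ‖V s‖) := mul_le_mul (hX _ (sub_nonneg.2 hs.2)) (norm_mul_le _ _)
          (norm_nonneg _) zero_le_one
      _ = _ := one_mul _
  have hexpJ : ∀ τ : ℝ, 0 ≤ τ → ‖NormedSpace.exp (τ • X) * V 0‖ ≤ J := fun τ hτ =>
    (norm_mul_le _ _).trans <| (mul_le_mul (hX τ hτ) hJ (norm_nonneg _) zero_le_one).trans_eq
      (one_mul J)
  have hVI : ∀ τ : ℝ, 0 ≤ τ → ‖V τ‖ ≤ J + ∫ s in (0 : ℝ)..τ, ‖R s‖ * ‖V s‖ := by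
    intro τ hτ
    have := norm_sub_norm_le (V τ) (NormedSpace.exp (τ • X) * V 0)
    linarith [hduh τ hτ, hexpJ τ hτ]
  -- Grönwall: the majorant divided by the exponential of the primitive of ‖R‖ decreases
  have hI : ∀ τ, HasDerivAt (fun τ => J + ∫ s in (0 : ℝ)..τ, ‖R s‖ * ‖V s‖) (‖R τ‖ * ‖V τ‖) τ :=
    fun τ => (hRV.integral_hasStrictDerivAt 0 τ).hasDerivAt.const_add J
  have hρ : ∀ τ, HasDerivAt (fun τ => ∫ s in (0 : ℝ)..τ, ‖R s‖) ‖R τ‖ τ :=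
    fun τ => (hR.norm.integral_hasStrictDerivAt 0 τ).hasDerivAt
  have hG : ∀ τ, HasDerivAt (fun τ => (J + ∫ s in (0 : ℝ)..τ, ‖R s‖ * ‖V s‖) *
      Real.exp (-∫ s in (0 : ℝ)..τ, ‖R s‖))
      ((‖R τ‖ * (‖V τ‖ - (J + ∫ s in (0 : ℝ)..τ, ‖R s‖ * ‖V s‖))) *
        Real.exp (-∫ s in (0 : ℝ)..τ, ‖R s‖)) τ := by
    intro τ
    refine ((hI τ).mul (hρ τ).fun_neg.exp).congr_deriv ?_
    ring
  have hanti : AntitoneOn (fun τ => (J + ∫ s in (0 : ℝ)..τ, ‖R s‖ * ‖V s‖) *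
      Real.exp (-∫ s in (0 : ℝ)..τ, ‖R s‖)) (Set.Ici 0) := by
    refine antitoneOn_of_deriv_nonpos (convex_Ici 0)
      (fun τ _ => (hG τ).continuousAt.continuousWithinAt)
      (fun τ _ => (hG τ).differentiableAt.differentiableWithinAt) fun τ hτ => ?_
    rw [interior_Ici, Set.mem_Ioi] at hτ
    rw [(hG τ).deriv]
    refine mul_nonpos_of_nonpos_of_nonneg ?_ (Real.exp_nonneg _)
    exact mul_nonpos_of_nonneg_of_nonpos (norm_nonneg _) (sub_nonpos.2 (hVI τ hτ.le))
  have h1 := hanti (Set.mem_Ici.2 le_rfl) (Set.mem_Ici.2 zero_le_one) zero_le_one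
  simp only [intervalIntegral.integral_same, neg_zero, Real.exp_zero, add_zero, mul_one,
    Real.exp_neg] at h1
  rw [← div_eq_mul_inv, div_le_iff₀ (Real.exp_pos _)] at h1
  have h2 : J + ∫ s in (0 : ℝ)..1, ‖R s‖ * ‖V s‖ ≤ J * Real.exp b :=
    h1.trans (mul_le_mul_of_nonneg_left (Real.exp_le_exp.2 hb) hJ0)
  refine ⟨(hVI 1 zero_le_one).trans h2, ?_⟩
  have h3 := hduh 1 zero_le_one
  rw [one_smul] at h3
  have h4 : ‖NormedSpace.exp X * (V 0 - U)‖ ≤ J - 1 := by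
    have hX1 := hX 1 zero_le_one
    rw [one_smul] at hX1
    exact (norm_mul_le _ _).trans <| (mul_le_mul hX1 hU (norm_nonneg _) zero_le_one).trans_eq
      (one_mul _)
  calc _ = ‖(V 1 - NormedSpace.exp X * V 0) + NormedSpace.exp X * (V 0 - U)‖ := by
        congr 1
        noncomm_ring
    _ ≤ _ := norm_add_le _ _
    _ ≤ _ := by linarith

end Duhamel

/-! ### The truncation bound in a normed algebra -/

section Truncation

variable {E : Type*} [NormedRing E] [NormedAlgebra ℝ E] {M : ℕ}

/-- The truncated BCH series of the weighted generators. -/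
def stageLog (L : Fin M → E) (N k : ℕ) (s : ℝ) : E :=
  ∑ q ∈ Finset.Icc 1 N, bchWord (fun v => stageWeight k s v • L v) q

/-- The logarithmic derivative of `exp ∘ stageLog L N k`, minus the generator `L k`. -/
def stageRemainder (L : Fin M → E) (N : ℕ) (k : Fin M) (s : ℝ) : E :=
  (∫ r in (0 : ℝ)..1, NormedSpace.exp (r • stageLog L N k s) *
    (∑ q ∈ Finset.Icc 1 N, bchWordDeriv k L s q) *
      NormedSpace.exp (-(r • stageLog L N k s))) - L k

theorem hasDerivAt_stageLog (L : Fin M → E) (N k : ℕ) (s : ℝ) :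
    HasDerivAt (stageLog L N k) (∑ q ∈ Finset.Icc 1 N, bchWordDeriv k L s q) s :=
  HasDerivAt.fun_sum fun q _ => hasDerivAt_bchWord_stage k L s q

variable [FiniteDimensional ℝ E]

theorem continuous_stageRemainder (L : Fin M → E) (N : ℕ) (k : Fin M) :
    Continuous (stageRemainder L N k) := by
  have : CompleteSpace E := FiniteDimensional.complete ℝ E
  have h1 : Continuous (stageLog L N k) :=
    continuous_iff_continuousAt.2 fun s => (hasDerivAt_stageLog L N k s).continuousAt
  have h2 : Continuous fun s => ∑ q ∈ Finset.Icc 1 N, bchWordDeriv k L s q :=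
    continuous_finsetSum _ fun q _ => continuous_bchWordDeriv k L q
  refine Continuous.sub ?_ continuous_const
  refine intervalIntegral.continuous_parametric_intervalIntegral_of_continuous' ?_ 0 1
  have h3 : Continuous fun p : ℝ × ℝ => p.2 • stageLog L N k p.1 :=
    continuous_snd.smul (h1.comp continuous_fst)
  exact ((continuous_exp_of_real.comp h3).mul (h2.comp continuous_fst)).mul
    (continuous_exp_of_real.comp h3.neg)

theorem hasDerivAt_exp_stageLog (L : Fin M → E) (N : ℕ) (k : Fin M) (s : ℝ) :
    HasDerivAt (fun s => NormedSpace.exp (stageLog L N k s))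
      ((L k + stageRemainder L N k s) * NormedSpace.exp (stageLog L N k s)) s := by
  have : CompleteSpace E := FiniteDimensional.complete ℝ E
  have h := hasDerivAt_exp_comp (hasDerivAt_stageLog L N k s)
  rwa [(hasSum_adCLM_integral _ _).tsum_eq, ← add_sub_cancel (L k) (∫ r in (0 : ℝ)..1, _)] at h

section
attribute [local instance] Matrix.linftyOpNormedRing Matrix.linftyOpNormedAlgebra

theorem exp_sum_shiftMat_stage (L : Fin M → E) (N : ℕ) (k : Fin M) (s : ℝ) :
    NormedSpace.exp (∑ q ∈ Finset.Icc 1 N,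
        shiftMat N q (bchWord (fun v => stageWeight k s v • L v) q)) =
      NormedSpace.exp (s • shiftMat N 1 (L k)) * ((List.finRange M).reverse.map fun v =>
        NormedSpace.exp (stageWeight k 0 v • shiftMat N 1 (L v))).prod := by
  have e : ∀ (c : ℝ) (a : E), shiftMat N 1 (c • a) = c • shiftMat N 1 a :=
    fun c a => (shiftLin N 1).map_smul c a
  refine (exp_sum_shiftMat_bchWord (N := N) fun v => stageWeight k s v • L v).trans ?_
  simp only [e]
  refine prod_stage (h := fun v c => NormedSpace.exp (c • shiftMat N 1 (L v))) (fun v => ?_) k s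
  have := NormedSpace.exp_zero (𝔸 := Matrix (Fin (N + 1)) (Fin (N + 1)) E)
  simpa only [zero_smul] using this

end

theorem hasSum_stageRemainder (L : Fin M → E) {N : ℕ} (hN : 1 ≤ N) (k : Fin M) (s : ℝ) :
    HasSum (fun d : ℕ => (1 / ((d + 1)! : ℝ)) • ∑ r ∈ gradeTuples N (d + 1),
      nestedComm (List.ofFn fun i => lastOr
        (fun q => bchWord (fun v => stageWeight k s v • L v) q) (bchWordDeriv k L s) i (r i)))
      (stageRemainder L N k s) := by
  have h := hasSum_high_grades (f := fun s q => bchWord (fun v => stageWeight k s v • L v) q)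
    (f' := bchWordDeriv k L s) (X := L k) hN (fun q => hasDerivAt_bchWord_stage k L s q)
    (exp_sum_shiftMat_stage L N k)
  exact h

theorem enorm_stageRemainder_le (L : Fin M → E) {N : ℕ} (hN : 1 ≤ N) (k : Fin M) {s : ℝ}
    (hs : 0 ≤ s) :
    ‖stageRemainder L N k s‖ₑ ≤
      ∑' d : ℕ, ENNReal.ofReal (weightedAlphaDeriv L N k (d + 1) s) := by
  rw [← (hasSum_stageRemainder L hN k s).tsum_eq]
  refine enorm_tsum_le_tsum_enorm.trans (ENNReal.tsum_le_tsum fun d => ?_)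
  rw [← ofReal_norm]
  refine ENNReal.ofReal_le_ofReal ?_
  rw [norm_smul, Real.norm_of_nonneg (by positivity), weightedAlphaDeriv]
  refine mul_le_mul_of_nonneg_left ((norm_sum_le _ _).trans (Finset.sum_le_sum fun r _ => ?_))
    (by positivity)
  exact norm_nestedComm_stage_le L k r hs

/-- The integrand is bounded by the derivative of the commutator series. -/
theorem integral_norm_stageRemainder_le (L : Fin M → E) {N : ℕ} (hN : 1 ≤ N) (k : Fin M)
    (h0 : Summable fun d : ℕ => weightedAlpha L N k (d + 1) 0)
    (h1 : Summable fun d : ℕ => weightedAlpha L N (k + 1) (d + 1) 0) :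
    ∫ s in (0 : ℝ)..1, ‖stageRemainder L N k s‖ ≤
      ∑' d : ℕ, weightedAlpha L N (k + 1) (d + 1) 0 - ∑' d : ℕ, weightedAlpha L N k (d + 1) 0 := by
  have hint : ∀ d : ℕ, ∫ s in (0 : ℝ)..1, weightedAlphaDeriv L N k (d + 1) s =
      weightedAlpha L N (k + 1) (d + 1) 0 - weightedAlpha L N k (d + 1) 0 := fun d => by
    rw [← weightedAlpha_one]
    exact intervalIntegral.integral_eq_sub_of_hasDerivAt
      (fun s _ => hasDerivAt_weightedAlpha L N k (d + 1) s)
      ((continuous_weightedAlphaDeriv L N k (d + 1)).intervalIntegrable _ _)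
  have hnn : ∀ d : ℕ, 0 ≤ weightedAlpha L N (k + 1) (d + 1) 0 - weightedAlpha L N k (d + 1) 0 :=
    fun d => by
      rw [← hint]
      exact intervalIntegral.integral_nonneg zero_le_one fun s hs =>
        weightedAlphaDeriv_nonneg L N k (d + 1) hs.1
  rw [← (h1.tsum_sub h0)]
  -- in `[0, ∞]` the series and the integral can be interchanged freely
  refine (ENNReal.ofReal_le_ofReal_iff (tsum_nonneg hnn)).1 ?_
  rw [intervalIntegral.integral_of_le zero_le_one,
    MeasureTheory.ofReal_integral_norm_eq_lintegral_enorm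
      ((continuous_stageRemainder L N k).integrableOn_Ioc),
    ENNReal.ofReal_tsum_of_nonneg hnn (h1.sub h0)]
  calc _ ≤ ∫⁻ s in Set.Ioc (0 : ℝ) 1,
        ∑' d : ℕ, ENNReal.ofReal (weightedAlphaDeriv L N k (d + 1) s) :=
        MeasureTheory.setLIntegral_mono' measurableSet_Ioc fun s hs =>
          enorm_stageRemainder_le L hN k hs.1.le
    _ = ∑' d : ℕ, ∫⁻ s in Set.Ioc (0 : ℝ) 1,
        ENNReal.ofReal (weightedAlphaDeriv L N k (d + 1) s) :=
        MeasureTheory.lintegral_tsum fun d =>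
          (continuous_weightedAlphaDeriv L N k (d + 1)).measurable.ennreal_ofReal.aemeasurable
    _ ≤ _ := by
        refine ENNReal.tsum_le_tsum fun d => ?_
        rw [← hint, intervalIntegral.integral_of_le zero_le_one,
          MeasureTheory.ofReal_integral_eq_lintegral_ofReal
            (continuous_weightedAlphaDeriv L N k (d + 1)).integrableOn_Ioc]
        filter_upwards [MeasureTheory.ae_restrict_mem measurableSet_Ioc] with s hs
        exact weightedAlphaDeriv_nonneg L N k (d + 1) hs.1.le

/-- The bounds after `k` factors have been switched on. -/
theorem norm_exp_stageLog_le (L : Fin M → E) {N : ℕ} (hN : 1 ≤ N) (hone : ‖(1 : E)‖ ≤ 1)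
    (hL : ∀ v, ∀ s : ℝ, 0 ≤ s → ‖NormedSpace.exp (s • L v)‖ ≤ 1)
    (hsum : ∀ k : ℕ, Summable fun d : ℕ => weightedAlpha L N k (d + 1) 0) (k : ℕ) (hk : k ≤ M) :
    ‖NormedSpace.exp (stageLog L N k 0)‖ ≤
        Real.exp (∑' d : ℕ, weightedAlpha L N k (d + 1) 0) ∧
      ‖NormedSpace.exp (stageLog L N k 0) - ((List.finRange M).reverse.map fun v =>
        NormedSpace.exp (stageWeight k 0 v • L v)).prod‖ ≤
        Real.exp (∑' d : ℕ, weightedAlpha L N k (d + 1) 0) - 1 := by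
  have : CompleteSpace E := FiniteDimensional.complete ℝ E
  induction k with
  | zero =>
    have h1 : (stageWeight 0 0 : Fin M → ℝ) = 0 := by
      funext v
      simp [stageWeight]
    have h2 : stageLog L N 0 0 = 0 := by
      refine Finset.sum_eq_zero fun q hq => ?_
      have hq1 : q ≠ 0 := by
        have := (Finset.mem_Icc.1 hq).1
        omega
      rw [bchWord_smul, h1]
      simp [hq1]
    have h3 : 1 ≤ Real.exp (∑' d : ℕ, weightedAlpha L N 0 (d + 1) 0) :=
      Real.one_le_exp (tsum_nonneg fun d => weightedAlpha_nonneg L N 0 (d + 1) le_rfl)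
    rw [h2, NormedSpace.exp_zero, h1]
    refine ⟨hone.trans h3, ?_⟩
    simpa using h3
  | succ k ih =>
    obtain ⟨ih1, ih2⟩ := ih (by omega)
    let k' : Fin M := ⟨k, hk⟩
    have h1 := norm_perturbed_flow_le (continuous_stageRemainder L N k') (hL k')
      (hasDerivAt_exp_stageLog L N k') ih1 ih2
      (integral_norm_stageRemainder_le L hN k' (hsum k) (hsum (k + 1)))
    rw [← Real.exp_add, add_sub_cancel] at h1
    have h2 : stageLog L N (k' : ℕ) 1 = stageLog L N (k + 1) 0 := by
      rw [stageLog, stageWeight_one]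
      rfl
    have h3 := prod_stage (h := fun v c => NormedSpace.exp (c • L v))
      (fun v => by rw [zero_smul, NormedSpace.exp_zero]) k' 1
    rw [stageWeight_one] at h3
    simp only [one_smul] at h3
    rw [h2, ← h3] at h1
    exact h1

/-- The truncation bound for generators of contraction semigroups in a finite-dimensional normed
algebra. -/
theorem norm_exp_sum_bchWord_sub_le (L : Fin M → E) {N : ℕ} (hN : 1 ≤ N) (hone : ‖(1 : E)‖ ≤ 1)
    (hL : ∀ v, ∀ s : ℝ, 0 ≤ s → ‖NormedSpace.exp (s • L v)‖ ≤ 1) {α : ℝ≥0∞}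
    (hα : α = ∑' d : ℕ, ENNReal.ofReal (1 / ((d + 1)! : ℝ) * ∑ q ∈ gradeTuples N (d + 1),
      ∑ v : (i : Fin (d + 1)) → Fin (q i) → Fin M,
        ‖nestedComm (List.ofFn fun i => nestedComm (List.ofFn fun j => L (v i j)))‖))
    (hα1 : α ≤ 1) :
    ‖NormedSpace.exp (∑ q ∈ Finset.Icc 1 N, bchWord L q) -
      ((List.finRange M).reverse.map fun v => NormedSpace.exp (L v)).prod‖ ≤
      Real.exp 1 * α.toReal := by
  simp only [← weightedAlpha_of_le L N _ le_rfl 0] at hα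
  have hnn := fun d : ℕ => weightedAlpha_nonneg L N M (d + 1) (le_refl (0 : ℝ))
  have hM : Summable fun d : ℕ => weightedAlpha L N M (d + 1) 0 := by
    have h1 : ∑' d : ℕ, ENNReal.ofReal (weightedAlpha L N M (d + 1) 0) ≠ ∞ := by
      rw [← hα]
      exact (hα1.trans_lt ENNReal.one_lt_top).ne
    have h2 := ENNReal.summable_toReal h1
    simpa only [ENNReal.toReal_ofReal (hnn _)] using h2
  have hsum : ∀ k : ℕ, Summable fun d : ℕ => weightedAlpha L N k (d + 1) 0 := fun k =>
    hM.of_nonneg_of_le (fun d => weightedAlpha_nonneg L N k (d + 1) le_rfl)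
      fun d => weightedAlpha_le_of_le L N (d + 1) le_rfl le_rfl zero_le_one
  have hB : α.toReal = ∑' d : ℕ, weightedAlpha L N M (d + 1) 0 := by
    rw [hα, ← ENNReal.ofReal_tsum_of_nonneg hnn hM, ENNReal.toReal_ofReal (tsum_nonneg hnn)]
  have h := (norm_exp_stageLog_le L hN hone hL hsum M le_rfl).2
  rw [← hB] at h
  simp only [stageLog, stageWeight_of_le le_rfl, Pi.one_apply, one_smul] at h
  refine h.trans ?_
  -- by convexity, `e^x - 1 ≤ e x` on the unit interval
  have hx0 : 0 ≤ α.toReal := ENNReal.toReal_nonneg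
  have hx1 : α.toReal ≤ 1 := ENNReal.toReal_le_of_le_ofReal zero_le_one (by simpa using hα1)
  have h5 : 1 - α.toReal ≤ Real.exp (-α.toReal) := by
    linarith [Real.add_one_le_exp (-α.toReal)]
  have h6 : Real.exp α.toReal ≤ Real.exp 1 := Real.exp_le_exp.2 hx1
  have h7 : Real.exp α.toReal * Real.exp (-α.toReal) = 1 := by
    rw [← Real.exp_add, add_neg_cancel, Real.exp_zero]
  nlinarith [Real.exp_pos α.toReal]

end Truncation

/-! ### The trace norm as a nuclear norm -/

section NuclearNorm

variable {m : Type*} [Fintype m] [DecidableEq m]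

/-- The rank-one matrix `u v†`. -/
def outerMat (u v : EuclideanSpace ℂ m) : Matrix m m ℂ := Matrix.vecMulVec u.ofLp (star v.ofLp)

theorem toEuclideanLin_outerMat (u v x : EuclideanSpace ℂ m) :
    Matrix.toEuclideanLin (outerMat u v) x = inner ℂ v x • u := by
  ext a
  rw [Matrix.toLpLin_apply, outerMat, Matrix.vecMulVec_mulVec]
  simp [EuclideanSpace.inner_eq_star_dotProduct, dotProduct_comm, mul_comm]

theorem mul_outerMat_mul_conjTranspose (K : Matrix m m ℂ) (u v : EuclideanSpace ℂ m) :
    K * outerMat u v * Kᴴ =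
      outerMat (Matrix.toEuclideanLin K u) (Matrix.toEuclideanLin K v) := by
  rw [outerMat, Matrix.mul_vecMulVec, Matrix.vecMulVec_mul, ← Matrix.star_mulVec]
  rfl

theorem inner_toEuclideanLin_right (K : Matrix m m ℂ) (u v : EuclideanSpace ℂ m) :
    inner ℂ u (Matrix.toEuclideanLin K v) = inner ℂ (Matrix.toEuclideanLin Kᴴ u) v := by
  rw [Matrix.toEuclideanLin_conjTranspose_eq_adjoint, LinearMap.adjoint_inner_left]

theorem toEuclideanLin_eigenvectorBasis (X : Matrix m m ℂ) (i : m) :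
    Matrix.toEuclideanLin (Xᴴ * X)
        ((Matrix.isHermitian_conjTranspose_mul_self X).eigenvectorBasis i) =
      ((Matrix.isHermitian_conjTranspose_mul_self X).eigenvalues i : ℂ) •
        (Matrix.isHermitian_conjTranspose_mul_self X).eigenvectorBasis i := by
  ext a
  rw [Matrix.toLpLin_apply, Matrix.IsHermitian.mulVec_eigenvectorBasis]
  simp

theorem inner_singularVectors (X : Matrix m m ℂ) (i j : m) :
    inner ℂ (Matrix.toEuclideanLin X
        ((Matrix.isHermitian_conjTranspose_mul_self X).eigenvectorBasis i))
      (Matrix.toEuclideanLin X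
        ((Matrix.isHermitian_conjTranspose_mul_self X).eigenvectorBasis j)) =
      if i = j then ((Matrix.isHermitian_conjTranspose_mul_self X).eigenvalues j : ℂ) else 0 := by
  set hX := Matrix.isHermitian_conjTranspose_mul_self X
  have h1 : Matrix.toEuclideanLin Xᴴ (Matrix.toEuclideanLin X (hX.eigenvectorBasis i)) =
      Matrix.toEuclideanLin (Xᴴ * X) (hX.eigenvectorBasis i) := by
    ext a
    simp [Matrix.toLpLin_apply, Matrix.mulVec_mulVec]
  rw [inner_toEuclideanLin_right, h1, toEuclideanLin_eigenvectorBasis, inner_smul_left,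
    orthonormal_iff_ite.1 hX.eigenvectorBasis.orthonormal]
  split_ifs with h
  · subst h
    simp
  · simp

theorem norm_singularVector (X : Matrix m m ℂ) (i : m) :
    ‖Matrix.toEuclideanLin X
        ((Matrix.isHermitian_conjTranspose_mul_self X).eigenvectorBasis i)‖ =
      √((Matrix.isHermitian_conjTranspose_mul_self X).eigenvalues i) := by
  rw [norm_eq_sqrt_re_inner (𝕜 := ℂ), inner_singularVectors, if_pos rfl]
  simp

/-- The singular value decomposition, `X = ∑ (X e_i) e_i†` for an orthonormal eigenbasis of
`X† X`. -/
theorem exists_outerMat_decomposition (X : Matrix m m ℂ) :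
    ∃ u v : m → EuclideanSpace ℂ m, X = ∑ i, outerMat (u i) (v i) ∧
      traceNorm X = ∑ i, ‖u i‖ * ‖v i‖ := by
  set hX := Matrix.isHermitian_conjTranspose_mul_self X
  refine ⟨fun i => Matrix.toEuclideanLin X (hX.eigenvectorBasis i), hX.eigenvectorBasis, ?_, ?_⟩
  · apply Matrix.toEuclideanLin.injective
    ext1 x
    rw [map_sum, LinearMap.sum_apply]
    simp only [toEuclideanLin_outerMat]
    conv_lhs => rw [← hX.eigenvectorBasis.sum_repr' x]
    simp only [map_sum, map_smul]
  · refine Finset.sum_congr rfl fun i _ => ?_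
    rw [norm_singularVector, hX.eigenvectorBasis.orthonormal.1 i, mul_one]

open scoped ComplexOrder in
/-- The trace norm is at most the cost of any decomposition into rank-one matrices. With left and
right singular vectors `f_i` and `e_i`, it is `∑ ⟪f_i, X e_i⟫ = ∑_j ∑_i ⟪f_i, u_j⟫ ⟪v_j, e_i⟫`, and
each inner sum is bounded by Cauchy–Schwarz and Bessel. -/
theorem traceNorm_sum_outerMat_le {ι : Type*} (s : Finset ι) (u v : ι → EuclideanSpace ℂ m) :
    traceNorm (∑ j ∈ s, outerMat (u j) (v j)) ≤ ∑ j ∈ s, ‖u j‖ * ‖v j‖ := by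
  set X := ∑ j ∈ s, outerMat (u j) (v j) with hXdef
  set hX := Matrix.isHermitian_conjTranspose_mul_self X
  set e := hX.eigenvectorBasis with he
  let S : Finset m := Finset.univ.filter fun i => √(hX.eigenvalues i) ≠ 0
  have hsq : ∀ i, √(hX.eigenvalues i) ^ 2 = hX.eigenvalues i := fun i =>
    Real.sq_sqrt ((Matrix.posSemidef_conjTranspose_mul_self X).eigenvalues_nonneg i)
  have hsqC : ∀ i, ((hX.eigenvalues i : ℝ) : ℂ) = ((√(hX.eigenvalues i) : ℝ) : ℂ) ^ 2 := fun i => by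
    exact_mod_cast (hsq i).symm
  -- left singular vectors
  let f : S → EuclideanSpace ℂ m := fun i =>
    (((√(hX.eigenvalues i))⁻¹ : ℝ) : ℂ) • Matrix.toEuclideanLin X (e i)
  have hf : Orthonormal ℂ f := by
    rw [orthonormal_iff_ite]
    intro i j
    have hi : √(hX.eigenvalues i) ≠ 0 := (Finset.mem_filter.1 i.2).2
    simp only [f, inner_smul_left, inner_smul_right, he, inner_singularVectors X,
      Complex.conj_ofReal]
    by_cases hij : i = j
    · subst hij
      rw [if_pos rfl, if_pos rfl, hsqC, Complex.ofReal_inv]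
      have hi' : ((√(hX.eigenvalues i) : ℝ) : ℂ) ≠ 0 := by exact_mod_cast hi
      field_simp
    · rw [if_neg hij, if_neg (fun h => hij (Subtype.ext h))]
      simp
  have h1 : ∀ i : S, ((√(hX.eigenvalues i) : ℝ) : ℂ) =
      ∑ j ∈ s, inner ℂ (f i) (u j) * inner ℂ (v j) (e i) := by
    intro i
    have hi : √(hX.eigenvalues i) ≠ 0 := (Finset.mem_filter.1 i.2).2
    have hi' : ((√(hX.eigenvalues i) : ℝ) : ℂ) ≠ 0 := by exact_mod_cast hi
    have h2 : inner ℂ (f i) (Matrix.toEuclideanLin X (e i)) =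
        ((√(hX.eigenvalues i) : ℝ) : ℂ) := by
      simp only [f, inner_smul_left, he, inner_singularVectors X, if_true, Complex.conj_ofReal]
      rw [hsqC, Complex.ofReal_inv]
      field_simp
    have h3 : Matrix.toEuclideanLin X (e i) = ∑ j ∈ s, inner ℂ (v j) (e i) • u j := by
      rw [hXdef, map_sum, LinearMap.sum_apply]
      simp only [toEuclideanLin_outerMat]
    rw [← h2, h3, inner_sum]
    exact Finset.sum_congr rfl fun j _ => by rw [inner_smul_right, mul_comm]
  have h4 : ∀ i : S, √(hX.eigenvalues i) ≤
      ∑ j ∈ s, ‖inner ℂ (f i) (u j)‖ * ‖inner ℂ (v j) (e i)‖ := by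
    intro i
    have := congrArg norm (h1 i)
    rw [Complex.norm_real, Real.norm_of_nonneg (Real.sqrt_nonneg _)] at this
    rw [this]
    exact (norm_sum_le _ _).trans_eq (Finset.sum_congr rfl fun j _ => norm_mul _ _)
  have hle : Orthonormal ℂ fun i : S => e i :=
    e.orthonormal.comp _ Subtype.val_injective
  calc traceNorm X = ∑ i ∈ S, √(hX.eigenvalues i) := by
        rw [Finset.sum_filter_ne_zero]
        rfl
    _ = ∑ i : S, √(hX.eigenvalues i) := (Finset.sum_coe_sort S _).symm
    _ ≤ ∑ i : S, ∑ j ∈ s, ‖inner ℂ (f i) (u j)‖ * ‖inner ℂ (v j) (e i)‖ :=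
        Finset.sum_le_sum fun i _ => h4 i
    _ = ∑ j ∈ s, ∑ i : S, ‖inner ℂ (f i) (u j)‖ * ‖inner ℂ (v j) (e i)‖ := Finset.sum_comm
    _ ≤ ∑ j ∈ s, ‖u j‖ * ‖v j‖ := by
        refine Finset.sum_le_sum fun j _ => (Real.sum_mul_le_sqrt_mul_sqrt _ _ _).trans ?_
        refine mul_le_mul (Real.sqrt_le_iff.2 ⟨norm_nonneg _, hf.sum_inner_products_le _⟩)
          (Real.sqrt_le_iff.2 ⟨norm_nonneg _, ?_⟩) (Real.sqrt_nonneg _) (norm_nonneg _)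
        simp only [norm_inner_symm (v j)]
        exact hle.sum_inner_products_le _

theorem traceNorm_nonneg (X : Matrix m m ℂ) : 0 ≤ traceNorm X :=
  Finset.sum_nonneg fun _ _ => Real.sqrt_nonneg _

theorem traceNorm_add_le (X Y : Matrix m m ℂ) : traceNorm (X + Y) ≤ traceNorm X + traceNorm Y := by
  obtain ⟨u, v, hX, hX'⟩ := exists_outerMat_decomposition X
  obtain ⟨u', v', hY, hY'⟩ := exists_outerMat_decomposition Y
  have h := traceNorm_sum_outerMat_le (Finset.univ : Finset (m ⊕ m)) (Sum.elim u u')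
    (Sum.elim v v')
  simp only [Fintype.sum_sum_type, Sum.elim_inl, Sum.elim_inr] at h
  rwa [← hX, ← hY, ← hX', ← hY'] at h

theorem traceNorm_smul_le (c : ℂ) (X : Matrix m m ℂ) : traceNorm (c • X) ≤ ‖c‖ * traceNorm X := by
  obtain ⟨u, v, hX, hX'⟩ := exists_outerMat_decomposition X
  have h := traceNorm_sum_outerMat_le (Finset.univ : Finset m) (fun i => c • u i) v
  have e : ∀ i, outerMat (c • u i) (v i) = c • outerMat (u i) (v i) := fun i => by
    simp [outerMat, Matrix.smul_vecMulVec]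
  simp only [e, norm_smul, mul_assoc] at h
  rwa [← Finset.smul_sum, ← Finset.mul_sum, ← hX, ← hX'] at h

theorem traceNorm_zero : traceNorm (0 : Matrix m m ℂ) = 0 :=
  le_antisymm (by simpa using traceNorm_smul_le 0 (0 : Matrix m m ℂ)) (traceNorm_nonneg _)

theorem eq_zero_of_traceNorm_le_zero {X : Matrix m m ℂ} (h : traceNorm X ≤ 0) : X = 0 := by
  ext i j
  exact norm_le_zero_iff.1 ((norm_entry_le_traceNorm X i j).trans h)

/-- A map in Kraus form with `∑ K† K ≤ c` has trace norm at most `c`. -/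
theorem traceNorm_kraus_le {ι : Type*} [Fintype ι] (K : ι → Matrix m m ℂ) {c : ℝ} (hc : 0 ≤ c)
    (hK : ∀ u : EuclideanSpace ℂ m, ∑ ν, ‖Matrix.toEuclideanLin (K ν) u‖ ^ 2 ≤ c * ‖u‖ ^ 2)
    (X : Matrix m m ℂ) : traceNorm (∑ ν, K ν * X * (K ν)ᴴ) ≤ c * traceNorm X := by
  obtain ⟨u, v, hX, hX'⟩ := exists_outerMat_decomposition X
  have h := traceNorm_sum_outerMat_le (Finset.univ : Finset (ι × m))
    (fun p => Matrix.toEuclideanLin (K p.1) (u p.2))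
    (fun p => Matrix.toEuclideanLin (K p.1) (v p.2))
  simp only [← mul_outerMat_mul_conjTranspose, Fintype.sum_prod_type, ← Finset.mul_sum,
    ← Finset.sum_mul, ← hX] at h
  rw [hX', Finset.mul_sum]
  refine h.trans ?_
  rw [Finset.sum_comm]
  have hs : ∀ w : EuclideanSpace ℂ m,
      √(∑ ν, ‖Matrix.toEuclideanLin (K ν) w‖ ^ 2) ≤ √c * ‖w‖ := fun w => by
    rw [← Real.sqrt_sq (norm_nonneg w), ← Real.sqrt_mul hc]
    exact Real.sqrt_le_sqrt (hK w)
  refine Finset.sum_le_sum fun i _ => (Real.sum_mul_le_sqrt_mul_sqrt _ _ _).trans ?_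
  calc _ ≤ (√c * ‖u i‖) * (√c * ‖v i‖) :=
        mul_le_mul (hs _) (hs _) (Real.sqrt_nonneg _) (by positivity)
    _ = √c ^ 2 * (‖u i‖ * ‖v i‖) := by ring
    _ = _ := by rw [Real.sq_sqrt hc]

end NuclearNorm

/-! ### The diamond norm is an algebra norm -/

section DiamondNormProperties

variable {n m : Type*}

theorem amplify_add (Φ Ψ : Superop n) : amplify m (Φ + Ψ) = amplify m Φ + amplify m Ψ := rfl

theorem amplify_smul (c : ℂ) (Φ : Superop n) : amplify m (c • Φ) = c • amplify m Φ := rfl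

theorem amplify_mul (Φ Ψ : Superop n) : amplify m (Φ * Ψ) = amplify m Φ * amplify m Ψ := rfl

theorem amplify_one : amplify m (1 : Superop n) = 1 := rfl

variable [Fintype n] [DecidableEq n]

theorem diamondNorm_nonneg (Φ : Superop n) : 0 ≤ diamondNorm Φ := by
  refine Real.sSup_nonneg ?_
  rintro r ⟨X, -, rfl⟩
  exact traceNorm_nonneg _

theorem traceNorm_amplify_le (Φ : Superop n) (X : Matrix (n × n) (n × n) ℂ) :
    traceNorm (amplify n Φ X) ≤ diamondNorm Φ * traceNorm X := by
  rcases (traceNorm_nonneg X).eq_or_lt' with h | h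
  · rw [eq_zero_of_traceNorm_le_zero h.le, map_zero, traceNorm_zero, mul_zero]
  · have hc : ‖((traceNorm X : ℂ))‖ = traceNorm X := by
      rw [Complex.norm_real, Real.norm_of_nonneg h.le]
    have h1 : traceNorm (((traceNorm X : ℂ))⁻¹ • X) ≤ 1 := by
      refine (traceNorm_smul_le _ _).trans_eq ?_
      rw [norm_inv, hc, inv_mul_cancel₀ h.ne']
    have h2 : traceNorm (amplify n Φ (((traceNorm X : ℂ))⁻¹ • X)) ≤ diamondNorm Φ :=
      le_csSup (bddAbove_diamondNorm Φ) ⟨_, h1, rfl⟩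
    have h3 : amplify n Φ X =
        (traceNorm X : ℂ) • amplify n Φ (((traceNorm X : ℂ))⁻¹ • X) := by
      rw [map_smul, smul_smul, mul_inv_cancel₀ (by exact_mod_cast h.ne'), one_smul]
    calc _ = traceNorm ((traceNorm X : ℂ) • amplify n Φ (((traceNorm X : ℂ))⁻¹ • X)) := by
          rw [← h3]
      _ ≤ traceNorm X * traceNorm (amplify n Φ (((traceNorm X : ℂ))⁻¹ • X)) :=
          (traceNorm_smul_le _ _).trans_eq (by rw [hc])
      _ ≤ traceNorm X * diamondNorm Φ := mul_le_mul_of_nonneg_left h2 h.le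
      _ = _ := mul_comm _ _

theorem diamondNorm_le {Φ : Superop n} {c : ℝ} (hc : 0 ≤ c)
    (h : ∀ X, traceNorm (amplify n Φ X) ≤ c * traceNorm X) : diamondNorm Φ ≤ c := by
  refine Real.sSup_le ?_ hc
  rintro r ⟨X, hX, rfl⟩
  exact (h X).trans (mul_le_of_le_one_right hc hX)

theorem diamondNorm_add_le (Φ Ψ : Superop n) :
    diamondNorm (Φ + Ψ) ≤ diamondNorm Φ + diamondNorm Ψ := by
  refine diamondNorm_le (add_nonneg (diamondNorm_nonneg _) (diamondNorm_nonneg _)) fun X => ?_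
  rw [amplify_add, LinearMap.add_apply, add_mul]
  exact (traceNorm_add_le _ _).trans
    (add_le_add (traceNorm_amplify_le _ _) (traceNorm_amplify_le _ _))

theorem diamondNorm_smul_le (c : ℂ) (Φ : Superop n) :
    diamondNorm (c • Φ) ≤ ‖c‖ * diamondNorm Φ := by
  refine diamondNorm_le (mul_nonneg (norm_nonneg _) (diamondNorm_nonneg _)) fun X => ?_
  rw [amplify_smul, LinearMap.smul_apply, mul_assoc]
  exact (traceNorm_smul_le _ _).trans
    (mul_le_mul_of_nonneg_left (traceNorm_amplify_le _ _) (norm_nonneg _))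

theorem diamondNorm_mul_le (Φ Ψ : Superop n) :
    diamondNorm (Φ * Ψ) ≤ diamondNorm Φ * diamondNorm Ψ := by
  refine diamondNorm_le (mul_nonneg (diamondNorm_nonneg _) (diamondNorm_nonneg _)) fun X => ?_
  rw [amplify_mul, Module.End.mul_apply, mul_assoc]
  exact (traceNorm_amplify_le _ _).trans
    (mul_le_mul_of_nonneg_left (traceNorm_amplify_le _ _) (diamondNorm_nonneg _))

theorem diamondNorm_one_le : diamondNorm (1 : Superop n) ≤ 1 :=
  diamondNorm_le zero_le_one fun X => by rw [amplify_one, Module.End.one_apply, one_mul]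

theorem eq_zero_of_diamondNorm_eq_zero {Φ : Superop n} (h : diamondNorm Φ = 0) : Φ = 0 := by
  ext1 ρ
  -- the input has the block `ρ` for every pair of ancilla indices
  ext i j
  have h1 := traceNorm_amplify_le Φ (Matrix.of fun p q : n × n => ρ p.1 q.1)
  rw [h, zero_mul] at h1
  exact congrFun (congrFun (eq_zero_of_traceNorm_le_zero h1) (i, i)) (j, j)

theorem diamondNorm_neg (Φ : Superop n) : diamondNorm (-Φ) = diamondNorm Φ := by
  have h : ∀ Ψ : Superop n, diamondNorm (-Ψ) ≤ diamondNorm Ψ := fun Ψ => by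
    have h1 := diamondNorm_smul_le (-1) Ψ
    have h2 : (-1 : ℂ) • Ψ = -Ψ := LinearMap.ext fun X => by
      rw [LinearMap.smul_apply, LinearMap.neg_apply, neg_one_smul]
    rwa [h2, norm_neg, norm_one, one_mul] at h1
  refine le_antisymm (h Φ) ?_
  have h1 := h (-Φ)
  rwa [neg_neg] at h1

/-- The diamond norm as a norm on the additive group of superoperators. -/
def diamondGroupNorm (n : Type*) [Fintype n] [DecidableEq n] : AddGroupNorm (Superop n) where
  toFun := diamondNorm
  map_zero' := le_antisymm (diamondNorm_le le_rfl fun X => by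
    rw [show amplify n (0 : Superop n) X = 0 from rfl, traceNorm_zero, zero_mul])
    (diamondNorm_nonneg _)
  add_le' := diamondNorm_add_le
  neg' := diamondNorm_neg
  eq_zero_of_map_eq_zero' _ := eq_zero_of_diamondNorm_eq_zero

/-- Superoperators as a normed ring under the diamond norm. -/
abbrev diamondNormedRing (n : Type*) [Fintype n] [DecidableEq n] : NormedRing (Superop n) where
  __ := (inferInstance : Ring (Superop n))
  __ := (diamondGroupNorm n).toNormedAddCommGroup
  norm_mul_le := diamondNorm_mul_le

attribute [local instance] diamondNormedRing

/-- Superoperators as a normed algebra under the diamond norm. -/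
abbrev diamondNormedAlgebra (n : Type*) [Fintype n] [DecidableEq n] :
    NormedAlgebra ℂ (Superop n) where
  __ := (inferInstance : Algebra ℂ (Superop n))
  norm_smul_le := diamondNorm_smul_le

attribute [local instance] diamondNormedAlgebra

theorem superExp_eq_exp (Φ : Superop n) : superExp Φ = NormedSpace.exp Φ := by
  ext1 X
  have : CompleteSpace (Superop n) := FiniteDimensional.complete ℂ _
  have h := NormedSpace.exp_series_hasSum_exp' (𝕂 := ℂ) Φ
  have hf : Continuous (LinearMap.applyₗ X : Superop n →ₗ[ℂ] Matrix n n ℂ) :=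
    LinearMap.continuous_of_finiteDimensional _
  exact (hasSum_superExp Φ X).unique
    (h.map (LinearMap.applyₗ X : Superop n →ₗ[ℂ] Matrix n n ℂ).toAddMonoidHom hf)

end DiamondNormProperties

/-! ### Semigroups with contractive Euler steps -/

section Contraction

/-- If an Euler step of size `h` is a contraction up to `O(h²)`, then the semigroup is contractive:
`exp (s X) = exp (s X / n) ^ n` has norm at most `(1 + o(s / n)) ^ n`. -/
theorem norm_exp_smul_le_one {E : Type*} [NormedRing E] [NormedAlgebra ℝ E] [CompleteSpace E]
    (hone : ‖(1 : E)‖ ≤ 1) {X : E} {C : ℝ}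
    (hX : ∀ h : ℝ, 0 ≤ h → ‖1 + h • X‖ ≤ 1 + C * h ^ 2) {s : ℝ} (hs : 0 ≤ s) :
    ‖NormedSpace.exp (s • X)‖ ≤ 1 := by
  rcases hs.eq_or_lt with rfl | hs
  · rwa [zero_smul, NormedSpace.exp_zero]
  have hderiv : HasDerivAt (fun t : ℝ => NormedSpace.exp (t • X)) X 0 := by
    simpa using hasDerivAt_exp_smul_const (𝕂 := ℝ) X (0 : ℝ)
  have hbound : ∀ ε : ℝ, 0 < ε → ‖NormedSpace.exp (s • X)‖ ≤ Real.exp (2 * ε * s) := by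
    intro ε hε
    have h1 := (hasDerivAt_iff_isLittleO_nhds_zero.1 hderiv).def hε
    have h2 : ∀ᶠ t : ℝ in nhds 0, C * t ≤ ε :=
      ((continuous_const.mul continuous_id).tendsto' (0 : ℝ) 0 (by simp)).eventually_le_const hε
    have h3 : Filter.Tendsto (fun n : ℕ => s / n) Filter.atTop (nhds 0) :=
      tendsto_const_div_atTop_nhds_zero_nat s
    obtain ⟨n, ⟨h4, h5⟩, hn⟩ :=
      ((h3.eventually (h1.and h2)).and (Filter.eventually_gt_atTop 0)).exists
    have hn' : (0 : ℝ) < n := by exact_mod_cast hn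
    -- the step `t` is small enough for both `C t ≤ ε` and the derivative estimate
    set t := s / n with ht
    have ht0 : 0 < t := div_pos hs hn'
    rw [zero_add, zero_smul, NormedSpace.exp_zero, Real.norm_of_nonneg ht0.le] at h4
    have h6 : ‖NormedSpace.exp (t • X)‖ ≤ 1 + 2 * ε * t := by
      have e : NormedSpace.exp (t • X) = (NormedSpace.exp (t • X) - 1 - t • X) + (1 + t • X) := by
        abel
      rw [e]
      refine (norm_add_le _ _).trans ?_
      have := hX t ht0.le
      nlinarith
    have h7 : NormedSpace.exp (s • X) = NormedSpace.exp (t • X) ^ n := by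
      let _ : NormedAlgebra ℚ E := NormedAlgebra.restrictScalars ℚ ℝ E
      rw [← NormedSpace.exp_nsmul, ← Nat.cast_smul_eq_nsmul ℝ, smul_smul, ht,
        mul_div_cancel₀ _ hn'.ne']
    rw [h7]
    calc _ ≤ ‖NormedSpace.exp (t • X)‖ ^ n := norm_pow_le' _ hn
      _ ≤ Real.exp (2 * ε * t) ^ n := by
          refine pow_le_pow_left₀ (norm_nonneg _) (h6.trans ?_) n
          linarith [Real.add_one_le_exp (2 * ε * t)]
      _ = _ := by
          rw [← Real.exp_nat_mul, ht]
          congr 1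
          field_simp
  have hlim : Filter.Tendsto (fun ε : ℝ => Real.exp (2 * ε * s)) (nhdsWithin 0 (Set.Ioi 0))
      (nhds 1) := by
    refine Filter.Tendsto.mono_left ?_ nhdsWithin_le_nhds
    refine Continuous.tendsto' (by fun_prop) _ _ (by simp)
  exact ge_of_tendsto hlim (by
    filter_upwards [self_mem_nhdsWithin] with ε hε using hbound ε hε)

end Contraction

/-! ### Euler steps of a Lindbladian in Kraus form -/

section Kraus

variable {n : Type*} [Fintype n]

/-- The drift `G = -i H - ½ ∑ J_ν† J_ν`, for which the Lindbladian is
`ρ ↦ G ρ + ρ G† + ∑ J_ν ρ J_ν†`. -/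
def lindbladDrift (H : Matrix n n ℂ) {k : ℕ} (J : Fin k → Matrix n n ℂ) : Matrix n n ℂ :=
  (-Complex.I) • H - (1 / 2 : ℂ) • ∑ ν, (J ν)ᴴ * J ν

theorem conjTranspose_lindbladDrift {H : Matrix n n ℂ} (hH : H.IsHermitian) {k : ℕ}
    (J : Fin k → Matrix n n ℂ) :
    (lindbladDrift H J)ᴴ = Complex.I • H - (1 / 2 : ℂ) • ∑ ν, (J ν)ᴴ * J ν := by
  simp [lindbladDrift, hH.eq, Matrix.conjTranspose_sum]

variable [DecidableEq n]

open scoped Kronecker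

/-- The completely positive map `ρ ↦ A ρ A†`. -/
def sandwich (A : Matrix n n ℂ) : Superop n := LinearMap.mulLeft ℂ A * LinearMap.mulRight ℂ Aᴴ

theorem sandwich_apply (A ρ : Matrix n n ℂ) : sandwich A ρ = A * ρ * Aᴴ := by
  rw [mul_assoc]
  rfl

theorem amplify_sandwich (A : Matrix n n ℂ) (X : Matrix (n × n) (n × n) ℂ) :
    amplify n (sandwich A) X = (A ⊗ₖ (1 : Matrix n n ℂ)) * X * (A ⊗ₖ (1 : Matrix n n ℂ))ᴴ := by
  ext p q
  change sandwich A _ p.1 q.1 = _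
  rw [sandwich_apply]
  simp [Matrix.mul_apply, Fintype.sum_prod_type, Matrix.one_apply, Finset.sum_mul,
    apply_ite (starRingEnd ℂ)]

theorem norm_sq_toEuclideanLin {m : Type*} [Fintype m] [DecidableEq m] (A : Matrix m m ℂ)
    (u : EuclideanSpace ℂ m) : ‖Matrix.toEuclideanLin A u‖ ^ 2 =
      RCLike.re (inner ℂ u (Matrix.toEuclideanLin (Aᴴ * A) u)) := by
  have h : Matrix.toEuclideanLin (Aᴴ * A) u =
      Matrix.toEuclideanLin Aᴴ (Matrix.toEuclideanLin A u) := by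
    ext a
    simp [Matrix.toLpLin_apply, Matrix.mulVec_mulVec]
  rw [h, inner_toEuclideanLin_right, Matrix.conjTranspose_conjTranspose, inner_self_eq_norm_sq]

theorem diamondNorm_kraus_le {ι : Type*} [Fintype ι] (K : ι → Matrix n n ℂ) {c : ℝ} (hc : 0 ≤ c)
    (hK : ∀ u : EuclideanSpace ℂ (n × n),
      ∑ ν, ‖Matrix.toEuclideanLin (K ν ⊗ₖ (1 : Matrix n n ℂ)) u‖ ^ 2 ≤ c * ‖u‖ ^ 2) :
    diamondNorm (∑ ν, sandwich (K ν)) ≤ c := by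
  refine diamondNorm_le hc fun X => ?_
  have h : amplify n (∑ ν, sandwich (K ν)) X = ∑ ν, amplify n (sandwich (K ν)) X := by
    ext p q
    change (∑ ν, sandwich (K ν)) _ p.1 q.1 = _
    rw [LinearMap.sum_apply, Matrix.sum_apply, Matrix.sum_apply]
    rfl
  rw [h]
  simp only [amplify_sandwich]
  exact traceNorm_kraus_le _ hc hK X

theorem lindbladGenerator_apply {H : Matrix n n ℂ} (hH : H.IsHermitian) {k : ℕ}
    (J : Fin k → Matrix n n ℂ) (ρ : Matrix n n ℂ) :
    lindbladGenerator H J ρ = lindbladDrift H J * ρ + ρ * (lindbladDrift H J)ᴴ +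
      ∑ ν, sandwich (J ν) ρ := by
  rw [conjTranspose_lindbladDrift hH]
  simp only [sandwich_apply]
  change (-Complex.I) • (H * ρ - ρ * H) + ∑ ν, (J ν * ρ * (J ν)ᴴ
      - (1 / 2 : ℂ) • ((J ν)ᴴ * J ν * ρ + ρ * ((J ν)ᴴ * J ν))) = _
  rw [Finset.sum_sub_distrib, ← Finset.smul_sum, Finset.sum_add_distrib, ← Finset.sum_mul,
    ← Finset.mul_sum]
  simp only [lindbladDrift, sub_mul, mul_sub, smul_mul_assoc, mul_smul_comm, smul_add, smul_sub,
    neg_smul, neg_mul]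
  abel

/-- The Kraus operators `1 + h G` and `√h J_ν` of an approximate Euler step. -/
def eulerKraus (H : Matrix n n ℂ) {k : ℕ} (J : Fin k → Matrix n n ℂ) (h : ℝ) :
    Option (Fin k) → Matrix n n ℂ
  | none => 1 + (h : ℂ) • lindbladDrift H J
  | some ν => ((√h : ℝ) : ℂ) • J ν

theorem one_add_smul_lindbladGenerator {H : Matrix n n ℂ} (hH : H.IsHermitian) {k : ℕ}
    (J : Fin k → Matrix n n ℂ) {h : ℝ} (hh : 0 ≤ h) :
    1 + (h : ℂ) • lindbladGenerator H J =
      ∑ ν, sandwich (eulerKraus H J h ν) - ((h : ℂ) ^ 2) • sandwich (lindbladDrift H J) := by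
  have hsq : ((√h : ℝ) : ℂ) * ((√h : ℝ) : ℂ) = h := by exact_mod_cast Real.mul_self_sqrt hh
  refine LinearMap.ext fun ρ => ?_
  rw [Fintype.sum_option]
  simp only [LinearMap.add_apply, LinearMap.sub_apply, LinearMap.smul_apply, LinearMap.sum_apply,
    Module.End.one_apply, lindbladGenerator_apply hH, sandwich_apply, eulerKraus,
    Matrix.conjTranspose_add, Matrix.conjTranspose_smul, Matrix.conjTranspose_one,
    RCLike.star_def, Complex.conj_ofReal]
  simp only [add_mul, mul_add, one_mul, mul_one, smul_mul_assoc, mul_smul_comm, smul_smul, hsq,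
    smul_add, Finset.smul_sum, pow_two]
  abel

/-- The step is trace preserving up to `h²`, since `G + G† = -∑ J_ν† J_ν`. -/
theorem sum_eulerKraus {H : Matrix n n ℂ} (hH : H.IsHermitian) {k : ℕ}
    (J : Fin k → Matrix n n ℂ) {h : ℝ} (hh : 0 ≤ h) :
    ∑ ν, (eulerKraus H J h ν)ᴴ * eulerKraus H J h ν =
      1 + ((h ^ 2 : ℝ) : ℂ) • ((lindbladDrift H J)ᴴ * lindbladDrift H J) := by
  have hsq : ((√h : ℝ) : ℂ) * ((√h : ℝ) : ℂ) = h := by exact_mod_cast Real.mul_self_sqrt hh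
  have hsum : (lindbladDrift H J)ᴴ + lindbladDrift H J = -∑ ν, (J ν)ᴴ * J ν := by
    rw [conjTranspose_lindbladDrift hH, lindbladDrift]
    module
  rw [Fintype.sum_option]
  simp only [eulerKraus, Matrix.conjTranspose_add, Matrix.conjTranspose_smul,
    Matrix.conjTranspose_one, RCLike.star_def, Complex.conj_ofReal, add_mul, mul_add, one_mul,
    mul_one, smul_mul_assoc, mul_smul_comm, smul_smul, hsq, ← Finset.smul_sum]
  rw [← neg_eq_iff_eq_neg.2 hsum.symm.symm]
  push_cast
  module

theorem exists_diamondNorm_one_add_smul_le {H : Matrix n n ℂ} (hH : H.IsHermitian) {k : ℕ}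
    (J : Fin k → Matrix n n ℂ) : ∃ C : ℝ, ∀ h : ℝ, 0 ≤ h →
      diamondNorm (1 + (h : ℂ) • lindbladGenerator H J) ≤ 1 + C * h ^ 2 := by
  set G := lindbladDrift H J with hG
  let T := LinearMap.toContinuousLinearMap (Matrix.toEuclideanLin (G ⊗ₖ (1 : Matrix n n ℂ)))
  have hT : ∀ u, ‖Matrix.toEuclideanLin (G ⊗ₖ (1 : Matrix n n ℂ)) u‖ ^ 2 ≤ ‖T‖ ^ 2 * ‖u‖ ^ 2 := by
    intro u
    rw [← mul_pow]
    exact pow_le_pow_left₀ (norm_nonneg _) (T.le_opNorm u) 2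
  refine ⟨2 * ‖T‖ ^ 2, fun h hh => ?_⟩
  have h1 : diamondNorm (sandwich G) ≤ ‖T‖ ^ 2 := by
    have := diamondNorm_kraus_le (fun _ : Unit => G) (sq_nonneg ‖T‖) (by simpa using hT)
    simpa using this
  have h2 : diamondNorm (∑ ν, sandwich (eulerKraus H J h ν)) ≤ 1 + h ^ 2 * ‖T‖ ^ 2 := by
    refine diamondNorm_kraus_le _ (by positivity) fun u => ?_
    have e : ∑ ν, (eulerKraus H J h ν ⊗ₖ (1 : Matrix n n ℂ))ᴴ *
        (eulerKraus H J h ν ⊗ₖ (1 : Matrix n n ℂ)) =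
        1 + ((h ^ 2 : ℝ) : ℂ) • ((G ⊗ₖ (1 : Matrix n n ℂ))ᴴ * (G ⊗ₖ (1 : Matrix n n ℂ))) := by
      simp only [Matrix.conjTranspose_kronecker, Matrix.conjTranspose_one,
        ← Matrix.mul_kronecker_mul, mul_one]
      have e1 := congrArg (· ⊗ₖ (1 : Matrix n n ℂ)) (sum_eulerKraus hH J hh)
      simp only [Matrix.add_kronecker, Matrix.smul_kronecker, Matrix.one_kronecker_one] at e1
      rw [hG, ← e1]
      ext p q
      simp [Matrix.sum_apply, add_mul, Finset.sum_mul]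
    simp only [norm_sq_toEuclideanLin (eulerKraus H J h _ ⊗ₖ (1 : Matrix n n ℂ))]
    have h3 : Matrix.toEuclideanLin (1 : Matrix (n × n) (n × n) ℂ) u = u := by
      ext a
      simp
    rw [← map_sum, ← inner_sum, ← LinearMap.sum_apply, ← map_sum, e, map_add, LinearMap.add_apply,
      map_smul, LinearMap.smul_apply, inner_add_right, inner_smul_right, map_add, h3,
      inner_self_eq_norm_sq]
    have h4 := norm_sq_toEuclideanLin (G ⊗ₖ (1 : Matrix n n ℂ)) u
    rw [RCLike.re_eq_complex_re] at h4 ⊢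
    rw [Complex.re_ofReal_mul, ← h4]
    nlinarith [hT u, sq_nonneg h]
  rw [one_add_smul_lindbladGenerator hH J hh, sub_eq_add_neg]
  refine (diamondNorm_add_le _ _).trans ?_
  rw [diamondNorm_neg]
  have h3 := diamondNorm_smul_le ((h : ℂ) ^ 2) (sandwich G)
  rw [norm_pow, Complex.norm_real, Real.norm_of_nonneg hh] at h3
  nlinarith [sq_nonneg h]

/-- A nonnegative multiple of a Lindbladian is a Lindbladian, with jump operators scaled by the
square root. -/
theorem IsLindbladian.smul {Φ : Superop n} (hΦ : IsLindbladian Φ) {c : ℝ} (hc : 0 ≤ c) :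
    IsLindbladian ((c : ℂ) • Φ) := by
  obtain ⟨H, k, J, hH, rfl⟩ := hΦ
  have hsq : ((√c : ℝ) : ℂ) * ((√c : ℝ) : ℂ) = c := by exact_mod_cast Real.mul_self_sqrt hc
  refine ⟨(c : ℂ) • H, k, fun ν => ((√c : ℝ) : ℂ) • J ν, ?_, ?_⟩
  · rw [Matrix.IsHermitian, Matrix.conjTranspose_smul, hH.eq, RCLike.star_def, Complex.conj_ofReal]
  · refine LinearMap.ext fun ρ => ?_
    change (c : ℂ) • ((-Complex.I) • (H * ρ - ρ * H) + ∑ ν, (J ν * ρ * (J ν)ᴴ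
        - (1 / 2 : ℂ) • ((J ν)ᴴ * J ν * ρ + ρ * ((J ν)ᴴ * J ν)))) =
      (-Complex.I) • ((c : ℂ) • H * ρ - ρ * (c : ℂ) • H) +
        ∑ ν, ((((√c : ℝ) : ℂ) • J ν) * ρ * (((√c : ℝ) : ℂ) • J ν)ᴴ
          - (1 / 2 : ℂ) • ((((√c : ℝ) : ℂ) • J ν)ᴴ * (((√c : ℝ) : ℂ) • J ν) * ρ +
            ρ * ((((√c : ℝ) : ℂ) • J ν)ᴴ * (((√c : ℝ) : ℂ) • J ν))))
    simp only [Matrix.conjTranspose_smul, RCLike.star_def, Complex.conj_ofReal, smul_mul_assoc,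
      mul_smul_comm, smul_smul, hsq, smul_add, smul_sub, Finset.smul_sum]
    congr 1
    · simp only [mul_comm]
    · refine Finset.sum_congr rfl fun ν _ => ?_
      simp only [mul_assoc, mul_comm]

end Kraus

/-! ### Lindblad semigroups are contractive in the diamond norm -/

section LindbladContraction

variable {n : Type*} [Fintype n] [DecidableEq n]

attribute [local instance] diamondNormedRing diamondNormedAlgebra

theorem IsLindbladian.norm_exp_smul_le_one {Φ : Superop n} (hΦ : IsLindbladian Φ) {s : ℝ}
    (hs : 0 ≤ s) : ‖NormedSpace.exp (s • Φ)‖ ≤ 1 := by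
  have : CompleteSpace (Superop n) := FiniteDimensional.complete ℂ _
  obtain ⟨H, k, J, hH, rfl⟩ := hΦ
  obtain ⟨C, hC⟩ := exists_diamondNorm_one_add_smul_le hH J
  exact BCHTruncation.norm_exp_smul_le_one diamondNorm_one_le hC hs

end LindbladContraction

/-! ### Truncated BCH series of Lindbladians -/

section Superoperators

variable {n : Type*} {M m : ℕ}

theorem blockList_eq_map (L : Fin M → Superop n) (p : Fin M → ℕ) :
    blockList L p = (blockIndices p).map L := by
  simp [blockList, blockIndices, List.map_flatMap]

/-- The index of the generator at each place of `L_1, …, L_m, L_m, …, L_1`. -/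
def palindromeIndex (m : ℕ) : Fin (m + m) → Fin m := Fin.append id Fin.rev

theorem card_palindromeIndex_fiber (j : Fin m) :
    (Finset.univ.filter fun v => palindromeIndex m v = j).card = 2 := by
  have h : (Finset.univ.filter fun v => palindromeIndex m v = j) =
      {Fin.castAdd m j, Fin.natAdd m j.rev} := by
    ext v
    induction v using Fin.addCases with
    | left i =>
      have : Fin.castAdd m i ≠ Fin.natAdd m j.rev := by
        rw [Ne, Fin.ext_iff, Fin.val_castAdd, Fin.val_natAdd]
        omega
      rw [Finset.mem_filter, Finset.mem_insert, Finset.mem_singleton, or_iff_left this,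
        Fin.castAdd_inj, palindromeIndex, Fin.append_left]
      simp
    | right i =>
      have : Fin.natAdd m i ≠ Fin.castAdd m j := by
        rw [Ne, Fin.ext_iff, Fin.val_castAdd, Fin.val_natAdd]
        omega
      rw [Finset.mem_filter, Finset.mem_insert, Finset.mem_singleton, or_iff_right this,
        Fin.natAdd_inj, palindromeIndex, Fin.append_right, Fin.rev_eq_iff]
      simp
  rw [h, Finset.card_pair]
  rw [Ne, Fin.ext_iff, Fin.val_castAdd, Fin.val_natAdd]
  omega

theorem smul_halvedPalindrome (t : ℝ) (L : Fin m → Superop n) (v : Fin (m + m)) :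
    (t : ℂ) • halvedPalindrome L v = ((t / 2 : ℝ) : ℂ) • L (palindromeIndex m v) := by
  have e : (t : ℂ) * (1 / 2) = ((t / 2 : ℝ) : ℂ) := by
    push_cast
    ring
  induction v using Fin.addCases with
  | left i => simp only [halvedPalindrome, palindromeIndex, Fin.append_left, smul_smul, e, id]
  | right i => simp only [halvedPalindrome, palindromeIndex, Fin.append_right, smul_smul, e]

variable [Fintype n] [DecidableEq n]

attribute [local instance] diamondNormedRing diamondNormedAlgebra

theorem bchTerm_eq_bchWord (L : Fin M → Superop n) (q : ℕ) : bchTerm L q = bchWord L q := by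
  refine (sum_wordSum_smul bchCoeff (fun w => nestedComm (List.ofFn fun i => L (w i)))
    (fun p => ((1 / ∏ v, ((p v)! : ℝ) : ℝ) : ℂ) •
      ∑ σ : Equiv.Perm (Fin q), ((bchCoeff σ : ℝ) : ℂ) •
        nestedComm (List.ofFn fun i => (blockList L p).getD (σ i) 0)) ?_).symm
  intro p _ b _ _ hb
  have h1 : ∀ σ : Equiv.Perm (Fin q), ∀ i, (blockList L p).getD (σ i) 0 = L (b (σ i)) := by
    intro σ i
    rw [blockList_eq_map, List.getD_eq_getElem?_getD, List.getElem?_map, hb]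
    rfl
  simp only [h1, multiFactorial, Nat.cast_prod]
  rfl

theorem expProduct_eq (L : Fin M → Superop n) :
    expProduct L = ((List.finRange M).reverse.map fun v => NormedSpace.exp (L v)).prod := by
  simp only [expProduct, superExp_eq_exp, List.ofFn_eq_map, List.map_reverse]

/-- The error of the truncated BCH series for a product of Lindblad exponentials. -/
theorem diamondNorm_superExp_sub_expProduct_le {L : Fin M → Superop n} {q₀ : ℕ}
    (hL : ∀ v, IsLindbladian (L v)) (hq : 1 ≤ q₀) (hα : alphaTrunc L q₀ ≤ 1) :
    diamondNorm (superExp (∑ q ∈ Finset.Icc 1 q₀, bchTerm L q) - expProduct L) ≤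
      Real.exp 1 * (alphaTrunc L q₀).toReal := by
  rw [superExp_eq_exp, expProduct_eq]
  simp only [bchTerm_eq_bchWord]
  exact norm_exp_sum_bchWord_sub_le L hq diamondNorm_one_le
    (fun v s hs => (hL v).norm_exp_smul_le_one hs) rfl hα

theorem bchTerm_smul (t : ℝ) (L : Fin M → Superop n) (q : ℕ) :
    bchTerm (fun v => (t : ℂ) • L v) q = ((t ^ q : ℝ) : ℂ) • bchTerm L q := by
  rw [bchTerm_eq_bchWord, bchTerm_eq_bchWord]
  refine (bchWord_smul (fun _ => t) L q).trans ?_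
  change _ = (t ^ q : ℝ) • bchWord L q
  simp only [Finset.prod_const, Finset.card_univ, Fintype.card_fin, bchWord, Finset.smul_sum,
    smul_smul, mul_comm]

/-- Each letter has weight `t / 2` and stands at two places of the palindrome. -/
theorem alphaComm_smul_halvedPalindrome {t : ℝ} (ht : 0 ≤ t) (L : Fin m → Superop n) {d : ℕ}
    (q : Fin d → ℕ) :
    alphaComm (fun v => (t : ℂ) • halvedPalindrome L v) q = alphaComm L q * t ^ (∑ i, q i) := by
  have h1 : ∀ v : (i : Fin d) → Fin (q i) → Fin (m + m),
      diamondNorm (nestedComm (List.ofFn fun i => nestedComm (List.ofFn fun j =>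
        (t : ℂ) • halvedPalindrome L (v i j)))) = (t / 2) ^ (∑ i, q i) *
      diamondNorm (nestedComm (List.ofFn fun i => nestedComm (List.ofFn fun j =>
        L (palindromeIndex m (v i j))))) := by
    intro v
    simp only [smul_halvedPalindrome]
    change ‖nestedComm (List.ofFn fun i => nestedComm (List.ofFn fun j =>
      (t / 2) • L (palindromeIndex m (v i j))))‖ = _ *
        ‖nestedComm (List.ofFn fun i => nestedComm (List.ofFn fun j =>
          L (palindromeIndex m (v i j))))‖
    simp only [nestedComm_ofFn_smul]
    rw [norm_smul, Real.norm_of_nonneg (by positivity)]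
    simp only [Finset.prod_const, Finset.card_univ, Fintype.card_fin, Finset.prod_pow_eq_pow_sum]
  -- every word in the letters of `L` comes from `2 ^ (q_1 + ⋯ + q_d)` words in the palindrome
  have h2 : ∀ w : (i : Fin d) → Fin (q i) → Fin m,
      (Finset.univ.filter fun v : (i : Fin d) → Fin (q i) → Fin (m + m) =>
        (fun i j => palindromeIndex m (v i j)) = w).card = 2 ^ (∑ i, q i) := by
    intro w
    have h3 : (Finset.univ.filter fun v : (i : Fin d) → Fin (q i) → Fin (m + m) =>
        (fun i j => palindromeIndex m (v i j)) = w) =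
        Fintype.piFinset fun i => Fintype.piFinset fun j =>
          Finset.univ.filter fun v => palindromeIndex m v = w i j := by
      ext v
      simp [funext_iff]
    rw [h3, Fintype.card_piFinset]
    simp only [Fintype.card_piFinset, card_palindromeIndex_fiber]
    simp [Finset.prod_pow_eq_pow_sum]
  simp only [alphaComm, h1]
  rw [← Finset.mul_sum, ← Finset.sum_fiberwise' _
    (fun (v : (i : Fin d) → Fin (q i) → Fin (m + m)) i j => palindromeIndex m (v i j))
    (fun w => diamondNorm (nestedComm (List.ofFn fun i => nestedComm (List.ofFn fun j =>
      L (w i j)))))]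
  simp only [Finset.sum_const, h2, nsmul_eq_mul]
  rw [← Finset.mul_sum, ← mul_assoc, mul_comm]
  push_cast
  rw [← mul_pow, div_mul_cancel₀ t two_ne_zero]

theorem alphaTrunc_smul_halvedPalindrome {t : ℝ} (ht : 0 ≤ t) (L : Fin m → Superop n) (q₀ : ℕ) :
    alphaTrunc (fun v => (t : ℂ) • halvedPalindrome L v) q₀ = alphaTruncStep L q₀ t := by
  simp only [alphaTrunc, alphaTruncStep, alphaComm_smul_halvedPalindrome ht]

theorem expProduct_smul_halvedPalindrome (t : ℝ) (L : Fin m → Superop n) :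
    expProduct (fun v => (t : ℂ) • halvedPalindrome L v) = secondOrderFormula L t := by
  have h : (fun v => superExp ((t : ℂ) • halvedPalindrome L v)) =
      Fin.append (fun j => superExp (((t / 2 : ℝ) : ℂ) • L j))
        (fun j => superExp (((t / 2 : ℝ) : ℂ) • L j.rev)) := by
    funext v
    rw [smul_halvedPalindrome]
    induction v using Fin.addCases with
    | left i => simp only [palindromeIndex, Fin.append_left, id]
    | right i => simp only [palindromeIndex, Fin.append_right]
  have h2 : ∀ g : Fin m → Superop n, (List.ofFn fun j => g j.rev).reverse = List.ofFn g := by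
    intro g
    refine List.ext_getElem (by simp) fun i h1 h2 => ?_
    simp only [List.getElem_reverse, List.getElem_ofFn, List.length_ofFn]
    congr 1
    rw [Fin.ext_iff, Fin.val_rev]
    simp at h2
    simp only
    omega
  rw [expProduct, h, List.ofFn_fin_append, List.reverse_append, List.prod_append,
    h2 fun j => superExp (((t / 2 : ℝ) : ℂ) • L j)]
  rfl

theorem isLindbladian_smul_halvedPalindrome {t : ℝ} (ht : 0 ≤ t) {L : Fin m → Superop n}
    (hL : ∀ j, IsLindbladian (L j)) (v : Fin (m + m)) :
    IsLindbladian ((t : ℂ) • halvedPalindrome L v) := by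
  rw [smul_halvedPalindrome]
  exact (hL _).smul (by positivity)

/-- The error for the second-order product formula. It is a product of exponentials of the
generators `t • halvedPalindrome L`, whose commutator sums are those of `L` at step `t`. -/
theorem diamondNorm_superExp_sub_secondOrderFormula_le {L : Fin m → Superop n} {q₀ : ℕ} {t : ℝ}
    (hL : ∀ j, IsLindbladian (L j)) (hq : 1 ≤ q₀) (ht : 0 ≤ t) (hα : alphaTruncStep L q₀ t ≤ 1) :
    diamondNorm (superExp (∑ q ∈ Finset.Icc 1 q₀,
        ((t ^ q : ℝ) : ℂ) • bchTerm (halvedPalindrome L) q) - secondOrderFormula L t) ≤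
      Real.exp 1 * (alphaTruncStep L q₀ t).toReal := by
  rw [← alphaTrunc_smul_halvedPalindrome ht] at hα ⊢
  rw [← expProduct_smul_halvedPalindrome]
  simp only [← bchTerm_smul]
  exact diamondNorm_superExp_sub_expProduct_le (isLindbladian_smul_halvedPalindrome ht hL) hq hα

end Superoperators

end BCHTruncation

end

theorem mainTheorem4 {n : Type*} [Fintype n] [DecidableEq n] :
    (∀ (M : ℕ) (L : Fin M → BCHTruncation.Superop n) (q₀ : ℕ),
      (∀ v, BCHTruncation.IsLindbladian (L v)) → 1 ≤ q₀ →
      BCHTruncation.alphaTrunc L q₀ ≤ 1 →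
      BCHTruncation.diamondNorm
          (BCHTruncation.superExp (∑ q ∈ Finset.Icc 1 q₀, BCHTruncation.bchTerm L q)
            - BCHTruncation.expProduct L)
        ≤ Real.exp 1 * (BCHTruncation.alphaTrunc L q₀).toReal) ∧
    (∀ (m : ℕ) (L : Fin m → BCHTruncation.Superop n) (q₀ : ℕ) (t : ℝ),
      (∀ j, BCHTruncation.IsLindbladian (L j)) → 1 ≤ q₀ → 0 ≤ t →
      BCHTruncation.alphaTruncStep L q₀ t ≤ 1 →
      BCHTruncation.diamondNorm
          (BCHTruncation.superExp (∑ q ∈ Finset.Icc 1 q₀,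
              ((t ^ q : ℝ) : ℂ) •
                BCHTruncation.bchTerm (BCHTruncation.halvedPalindrome L) q)
            - BCHTruncation.secondOrderFormula L t)
        ≤ Real.exp 1 * (BCHTruncation.alphaTruncStep L q₀ t).toReal) :=
  ⟨fun _ _ _ hL hq hα => BCHTruncation.diamondNorm_superExp_sub_expProduct_le hL hq hα,
    fun _ _ _ _ hL hq ht hα =>
      BCHTruncation.diamondNorm_superExp_sub_secondOrderFormula_le hL hq ht hα⟩
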